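/- Let $E$ be a division ring, finite-dimensional over its center $K$, with $\operatorname{char} K\neq 2$. An involution $\sigma$ of $E$ is an additive anti-automorphism with $\sigma^2=\mathrm{id}$. It is of the first kind if $\sigma|_K=\mathrm{id}$; it is then orthogonal (resp. symplectic) if $\dim_K\{x\in E:\sigma(x)=x\}$ equals $d(d+1)/2$ (resp. $d(d-1)/2$), where $\dim_KE=d^2$. For a subfield $F\subseteq K$, $\sigma$ is unitary over $F$ if $\sigma|_K\ne\mathrm{id}$ and $\{z\in K:\sigma(z)=z\}=F$. For $\varepsilon\in\{1,-1\}$, an $\varepsilon$-hermitian space over $(E,\sigma)$ is a finitely generated right $E$-module $V$ with a nondegenerate bi-additive map $h:V\times V\to E$ such that $h(xa,yb)=\sigma(a)h(x,y)b$ and $h(y,x)=\varepsilon\sigma(h(x,y))$; it is anisotropic if $h(x,x)=0$ only for $x=0$. Let $u(E,\sigma,\varepsilon)\in\mathbb N\cup\{\infty\}$ be the supremum of $\dim_E V$ over all anisotropic $\varepsilon$-hermitian spaces $(V,h)$ over $(E,\sigma)$. Define - $u^+(E)=u(E,\sigma,\varepsilon)$ for any orthogonal $\sigma$ with $\varepsilon=1$,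 or any symplectic $\sigma$ with $\varepsilon=-1$; - $u^-(E)=u(E,\sigma,\varepsilon)$ for any orthogonal $\sigma$ with $\varepsilon=-1$, or any symplectic $\sigma$ with $\varepsilon=1$; - $u^0(E/F)=u(E,\sigma,\varepsilon)$ for any $\sigma$ unitary over $F$ and any $\varepsilon\in\{1,-1\}$, where an invariant is called defined if at least one such pair $(\sigma,\varepsilon)$ exists and all such pairs give the same value. Let $k$ be a field that is complete with respect to a discrete valuation $v$, with residue field $\overline k$ of characteristic different from $2$. Let $D$ be a finite-dimensional central division $k$-algebra of period $2$, that is, whose class in the Brauer group of $k$ has order exactly $2$. Let $w$ be the unique extension of $v$ to a valuation of $D$, namely $w(x)=\frac{1}{[D:k]}v(N_{D/k}(x))$, and let $\overline D=\{x\in D:w(x)\ge 0\}/\{x\in D:w(x)>0\}$ be the residue division algebra, a $\overline k$-algebra. Call $D$ unramified if $w(D^*)=v(k^*)$, and ramified otherwise. Then: 1. If $D$ is unramified, then $u^{\pm}(D)$ and $u^{\pm}(\overline D)$ are defined and $$u^+(D)=2u^+(\overline D),\qquad u^-(D)=2u^-(\overline D).$$ 2. If $D$ is ramified, then $u^{\pm}(D)$,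 $u^{\pm}(\overline D)$ and $u^0(\overline D/\overline k)$ are defined and $$u^+(D)=u^0(\overline D/\overline k)+u^+(\overline D),\qquad u^-(D)=u^0(\overline D/\overline k)+u^-(\overline D).$$ -/

import Mathlib

universe u

open Module
open scoped TensorProduct Valued

noncomputable section

namespace HermU

/-! ### Involutions and hermitian forms over a division ring -/

section Hermitian

variable {E : Type*} [DivisionRing E]

/-- An involution on `E`: an additive anti-automorphism with `σ (σ x) = x`. -/
structure Involution (E : Type*) [DivisionRing E] where
  toFun : E → E
  map_add' : ∀ x y, toFun (x + y) = toFun x + toFun y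
  map_mul' : ∀ x y, toFun (x * y) = toFun y * toFun x
  invol' : ∀ x, toFun (toFun x) = x

instance : CoeFun (Involution E) (fun _ => E → E) := ⟨Involution.toFun⟩

/-- `h : V × V → E` is an `ε`-hermitian form over `(E, σ)` on the right `E`-module `V`
(right `E`-modules are modules over `Eᵐᵒᵖ`, `x · a = MulOpposite.op a • x`). -/
structure IsHermitianForm (σ : Involution E) (ε : ℤˣ) {V : Type*} [AddCommGroup V]
    [Module Eᵐᵒᵖ V] (h : V → V → E) : Prop where
  add_left : ∀ x x' y, h (x + x') y = h x y + h x' y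
  add_right : ∀ x y y', h x (y + y') = h x y + h x y'
  smul_smul : ∀ (a b : E) (x y : V),
    h (MulOpposite.op a • x) (MulOpposite.op b • y) = σ a * h x y * b
  symm : ∀ x y, h y x = ε • σ (h x y)

/-- Nondegeneracy, the condition that makes a hermitian form a hermitian space. -/
def IsNondegenerate {V : Type*} [Zero V] (h : V → V → E) : Prop :=
  ∀ y, (∀ x, h x y = 0) → y = 0

/-- `h` is anisotropic: `h x x = 0` only for `x = 0`. -/
def IsAnisotropic {V : Type*} [Zero V] (h : V → V → E) : Prop :=
  ∀ x, h x x = 0 → x = 0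

/-- The hermitian `u`-invariant `u(E, σ, ε)`: the supremum in `ℕ ∪ {∞}` of the ranks of the
anisotropic `ε`-hermitian spaces over `(E, σ)`. Over a division ring `E` of degree
(hence also index) `d` over its center `K`, the rank `dim_K V / d ^ 2` is `dim_E V`. -/
def uInvariant {E : Type u} [DivisionRing E] (σ : Involution E) (ε : ℤˣ) : ℕ∞ :=
  sSup {n : ℕ∞ | ∃ (V : Type u) (_ : AddCommGroup V) (_ : Module Eᵐᵒᵖ V) (h : V → V → E),
    Module.Finite Eᵐᵒᵖ V ∧ IsHermitianForm σ ε h ∧ IsNondegenerate h ∧ IsAnisotropic h ∧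
      n = (finrank Eᵐᵒᵖ V : ℕ)}

/-- `σ` is of the first kind: it is the identity on the center of `E`. -/
def Involution.IsFirstKind (σ : Involution E) : Prop :=
  ∀ z ∈ Subring.center E, σ z = z

/-- The space of symmetric elements of an involution of the first kind, over the center. -/
def Involution.sym (σ : Involution E) (hσ : σ.IsFirstKind) :
    Submodule (Subring.center E) E where
  carrier := {x | σ x = x}
  add_mem' {x y} hx hy := by
    change σ (x + y) = x + y
    rw [σ.map_add', hx, hy]
  zero_mem' := hσ 0 (Subring.zero_mem _)
  smul_mem' c x hx := by
    change σ ((c : E) * x) = (c : E) * x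
    rw [σ.map_mul', hx, hσ _ c.2]
    exact Subring.mem_center_iff.1 c.2 x

/-- `σ` is orthogonal: of the first kind, with symmetric elements of dimension `d (d + 1) / 2`
over the center `K`, where `dim_K E = d ^ 2`. -/
def Involution.IsOrthogonal (σ : Involution E) : Prop :=
  ∃ (hσ : σ.IsFirstKind) (d : ℕ), finrank (Subring.center E) E = d ^ 2 ∧
    2 * finrank (Subring.center E) (σ.sym hσ) = d * (d + 1)

/-- `σ` is symplectic: of the first kind, with symmetric elements of dimension `d (d - 1) / 2`
over the center `K`, where `dim_K E = d ^ 2`. -/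
def Involution.IsSymplectic (σ : Involution E) : Prop :=
  ∃ (hσ : σ.IsFirstKind) (d : ℕ), finrank (Subring.center E) E = d ^ 2 ∧
    2 * finrank (Subring.center E) (σ.sym hσ) = d * (d - 1)

/-- `σ` is unitary (of the second kind) over the base field `F`: it is not the identity on the
center, and the elements of the center that it fixes are exactly those of `F`. -/
def Involution.IsUnitary (F : Type*) [Field F] [Algebra F E] (σ : Involution E) : Prop :=
  ¬ σ.IsFirstKind ∧ ∀ z ∈ Subring.center E, σ z = z ↔ z ∈ Set.range (algebraMap F E)

/-- `u⁺(E) = n`: there are pairs `(σ, ε)` with `σ` orthogonal and `ε = 1`, or `σ` symplectic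
and `ε = -1`, and `u(E, σ, ε) = n` for every such pair. -/
def IsUPlus (E : Type*) [DivisionRing E] (n : ℕ∞) : Prop :=
  (∃ (σ : Involution E) (ε : ℤˣ), (σ.IsOrthogonal ∧ ε = 1) ∨ (σ.IsSymplectic ∧ ε = -1)) ∧
  ∀ (σ : Involution E) (ε : ℤˣ), (σ.IsOrthogonal ∧ ε = 1) ∨ (σ.IsSymplectic ∧ ε = -1) →
    uInvariant σ ε = n

/-- `u⁻(E) = n`: there are pairs `(σ, ε)` with `σ` orthogonal and `ε = -1`, or `σ` symplectic
and `ε = 1`, and `u(E, σ, ε) = n` for every such pair. -/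
def IsUMinus (E : Type*) [DivisionRing E] (n : ℕ∞) : Prop :=
  (∃ (σ : Involution E) (ε : ℤˣ), (σ.IsOrthogonal ∧ ε = -1) ∨ (σ.IsSymplectic ∧ ε = 1)) ∧
  ∀ (σ : Involution E) (ε : ℤˣ), (σ.IsOrthogonal ∧ ε = -1) ∨ (σ.IsSymplectic ∧ ε = 1) →
    uInvariant σ ε = n

/-- `u⁰(E / F) = n`: there are involutions of `E` that are unitary over `F`, and
`u(E, σ, ε) = n` for every such `σ` and for both signs `ε`. -/
def IsUZero (F : Type*) [Field F] (E : Type*) [DivisionRing E] [Algebra F E] (n : ℕ∞) : Prop :=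
  (∃ σ : Involution E, σ.IsUnitary F) ∧
  ∀ (σ : Involution E) (ε : ℤˣ), σ.IsUnitary F → uInvariant σ ε = n

end Hermitian

/-! ### Period two -/

/-- The `k`-algebra `A` is split: isomorphic to a matrix algebra over `k`. -/
def IsSplit (k : Type*) [Field k] (A : Type*) [Ring A] [Algebra k A] : Prop :=
  ∃ n : ℕ, n ≠ 0 ∧ Nonempty (A ≃ₐ[k] Matrix (Fin n) (Fin n) k)

/-- The class of `A` in the Brauer group of `k` has order exactly two. -/
def HasPeriodTwo (k : Type*) [Field k] (A : Type*) [Ring A] [Algebra k A] : Prop :=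
  ¬ IsSplit k A ∧ IsSplit k (A ⊗[k] A)

/-! ### The valuation of a division algebra over a complete discretely valued field -/

theorem norm_field {k L : Type*} [NontriviallyNormedField k] [IsUltrametricDist k]
    [CompleteSpace k] [Field L] [Algebra k L] [FiniteDimensional k L] (z : L) :
    ‖Algebra.norm k z‖ ≤ 1 ↔ spectralNorm k L z ≤ 1 := by
  have hz : IsIntegral k z := Algebra.IsIntegral.isIntegral z
  have h3 := Algebra.PowerBasis.norm_gen_eq_coeff_zero_minpoly
    (IntermediateField.adjoin.powerBasis hz)
  rw [IntermediateField.adjoin.powerBasis_gen, IntermediateField.adjoin.powerBasis_dim,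
    IntermediateField.minpoly_gen] at h3
  have hr : finrank (IntermediateField.adjoin k {z}) L ≠ 0 := finrank_pos.ne'
  have hd : 0 < (minpoly k z).natDegree := minpoly.natDegree_pos hz
  have hd' : (0 : ℝ) < 1 / ((minpoly k z).natDegree : ℝ) := by positivity
  rw [Algebra.norm_eq_norm_adjoin, h3, spectralNorm.spectralNorm_eq_norm_coeff_zero_rpow,
    norm_pow, norm_mul, norm_pow, norm_neg, norm_one, one_pow, one_mul,
    pow_le_one_iff_of_nonneg (norm_nonneg _) hr]
  refine ⟨fun h => Real.rpow_le_one (norm_nonneg _) h hd'.le, fun h => ?_⟩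
  by_contra! h'
  exact absurd (Real.one_lt_rpow h' hd') (not_lt.2 h)

theorem norm_lift {k D L : Type*} [Field k] [DivisionRing D] [Algebra k D]
    [FiniteDimensional k D] [Field L] [Algebra k L] (φ : L →ₐ[k] D) :
    ∃ r : ℕ, r ≠ 0 ∧ ∀ z : L, Algebra.norm k (φ z) = Algebra.norm k z ^ r := by
  let : Module L D := Module.compHom D φ.toRingHom
  have hsm : ∀ (z : L) (d : D), z • d = φ z * d := fun _ _ => rfl
  have : IsScalarTower k L D := ⟨fun a z d => by
    rw [hsm, hsm, map_smul, smul_mul_assoc]⟩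
  have : FiniteDimensional k L :=
    FiniteDimensional.of_injective φ.toLinearMap φ.toRingHom.injective
  have : FiniteDimensional L D := FiniteDimensional.right k L D
  refine ⟨finrank L D, finrank_pos.ne', fun z => ?_⟩
  have h := LinearMap.det_restrictScalars (R := k) (S := L) (A := D)
    (f := z • (LinearMap.id : D →ₗ[L] D))
  rw [LinearMap.det_smul, LinearMap.det_id, mul_one, map_pow] at h
  rw [← h, Algebra.norm_apply]
  rfl

theorem exists_field {k D : Type*} [Field k] [DivisionRing D] [Algebra k D]
    [FiniteDimensional k D] (x : D) :
    ∃ (p : Polynomial k) (_ : Fact (Irreducible p)) (φ : AdjoinRoot p →ₐ[k] D)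
      (z : AdjoinRoot p), φ z = x := by
  have hx : IsIntegral k x := Algebra.IsIntegral.isIntegral x
  refine ⟨minpoly k x, ⟨minpoly.irreducible hx⟩,
    Ideal.Quotient.liftₐ _ (Polynomial.aeval x) (fun a ha => ?_), AdjoinRoot.root _, ?_⟩
  · obtain ⟨c, rfl⟩ := Ideal.mem_span_singleton.1 ha
    simp
  · change Polynomial.aeval x Polynomial.X = x
    simp

variable (k : Type*) [Field k] {Γ₀ : Type*} [LinearOrderedCommGroupWithZero Γ₀]
  [Valued k Γ₀] [CompleteSpace k] [(Valued.v : Valuation k Γ₀).IsRankOneDiscrete]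
  (D : Type*) [DivisionRing D] [Algebra k D] [FiniteDimensional k D]

variable {k D} in
theorem norm_one_add (x : D) (hx : Valued.v (Algebra.norm k x) ≤ 1) :
    Valued.v (Algebra.norm k (1 + x)) ≤ 1 := by
  let : (Valued.v : Valuation k Γ₀).RankOne :=
    Valuation.IsRankOneDiscrete.rankOne _ (e := 2) (by norm_num)
  let : NontriviallyNormedField k := Valued.toNontriviallyNormedField k Γ₀
  obtain ⟨p, _, φ, z, rfl⟩ := exists_field (k := k) x
  obtain ⟨r, hr, h⟩ := norm_lift φ
  have : FiniteDimensional k (AdjoinRoot p) :=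
    FiniteDimensional.of_injective φ.toLinearMap φ.toRingHom.injective
  have key : ∀ y : AdjoinRoot p, Valued.v (Algebra.norm k (φ y)) ≤ 1 ↔
      spectralNorm k (AdjoinRoot p) y ≤ 1 := fun y => by
    rw [h, map_pow, pow_le_one_iff hr, ← norm_field, Valued.toNormedField.norm_le_one_iff]
  rw [key] at hx
  rw [← map_one φ, ← map_add, key]
  refine (isNonarchimedean_spectralNorm 1 z).trans (max_le ?_ hx)
  rw [spectralNorm_one]

/-- The valuation `x ↦ v (N_{D/k} x)` of `D`, in multiplicative notation, where `N_{D/k}` is the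
determinant of left multiplication. It is the `[D : k]`-th multiple of the unique
extension of `v` to `D`: if `D` is central of degree `d`, then `N_{D/k} = Nrd ^ d`. -/
def valD : Valuation D Γ₀ where
  toFun x := Valued.v (Algebra.norm k x)
  map_zero' := by
    rw [Algebra.norm_zero, map_zero]
  map_one' := by simp
  map_mul' x y := by simp
  map_add_le_max' := by
    have aux : ∀ x y : D, x ≠ 0 → Valued.v (Algebra.norm k y) ≤ Valued.v (Algebra.norm k x) →
        Valued.v (Algebra.norm k (x + y)) ≤ Valued.v (Algebra.norm k x) := by
      intro x y hx hxy
      have h1 : x + y = x * (1 + x⁻¹ * y) := by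
        rw [mul_add, mul_one, mul_inv_cancel_left₀ hx]
      have hu : Valued.v (Algebra.norm k x⁻¹) * Valued.v (Algebra.norm k x) = 1 := by
        rw [← map_mul, ← map_mul, inv_mul_cancel₀ hx, map_one, map_one]
      rw [h1, map_mul, map_mul]
      refine mul_le_of_le_one_right' (norm_one_add _ ?_)
      rw [map_mul, map_mul, ← hu]
      exact mul_le_mul_right hxy _
    intro x y
    by_cases hx : x = 0
    · simp [hx]
    by_cases hy : y = 0
    · simp [hy]
    rcases le_total (Valued.v (Algebra.norm k y)) (Valued.v (Algebra.norm k x)) with h | h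
    · exact (aux x y hx h).trans (le_max_left _ _)
    · rw [add_comm]
      exact (aux y x hy h).trans (le_max_right _ _)

/-- `D` is unramified over `k`: the (unique) extension of `v` to `D` has the same value group
as `v`, i.e. the ramification index is one. (For `D` central over `k` of period two and residue
characteristic not two, `[D : k]` is a power of two and `D` is tame over `k`, so then also
`[D̄ : k̄] = [D : k]`, and `D̄` is central over `k̄`.) -/
def IsUnramified : Prop :=
  ∀ x : D, x ≠ 0 → ∃ a : k, valD k D x = valD k D (algebraMap k D a)

/-- The valuation ring `R_w = {x ∈ D | w x ≥ 0}`. -/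
abbrev valRing : Subring D := (valD k D).integer

/-- The maximal ideal `𝔪_w = {x ∈ D | w x > 0}` of `R_w`. -/
def valIdeal : Ideal (valRing k D) where
  carrier := {x | valD k D x < 1}
  add_mem' {x y} hx hy := (valD k D).map_add_lt hx hy
  zero_mem' := by simp
  smul_mem' c x hx := by
    change valD k D ((c : D) * x) < 1
    rw [map_mul]
    exact mul_lt_one_of_nonneg_of_lt_one_right c.2 zero_le hx

theorem mem_valIdeal {x : valRing k D} : x ∈ valIdeal k D ↔ valD k D x < 1 := Iff.rfl

instance : (valIdeal k D).IsTwoSided where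
  mul_mem_of_left {x} c hx := by
    rw [mem_valIdeal] at hx ⊢
    rw [Subring.coe_mul, map_mul]
    exact mul_lt_one_of_nonneg_of_lt_one_left zero_le hx c.2

/-- The residue division algebra `R_w / 𝔪_w` of `D`. -/
def ResidueAlgebra : Type _ := valRing k D ⧸ valIdeal k D

instance : Ring (ResidueAlgebra k D) := inferInstanceAs (Ring (valRing k D ⧸ valIdeal k D))

/-- The residue map `R_w → R_w / 𝔪_w`. -/
def residue : valRing k D →+* ResidueAlgebra k D := Ideal.Quotient.mk (valIdeal k D)

theorem residue_surjective : Function.Surjective (residue k D) := Ideal.Quotient.mk_surjective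

theorem residue_eq_zero {x : valRing k D} : residue k D x = 0 ↔ valD k D x < 1 :=
  Ideal.Quotient.eq_zero_iff_mem

instance : Nontrivial (ResidueAlgebra k D) :=
  ⟨1, 0, fun h => by
    rw [← map_one (residue k D), residue_eq_zero] at h
    simp at h⟩

instance : DivisionRing (ResidueAlgebra k D) :=
  DivisionRing.ofIsUnitOrEqZero fun a => by
    obtain ⟨x, rfl⟩ := residue_surjective k D a
    by_cases hx : valD k D x < 1
    · exact Or.inr ((residue_eq_zero k D).2 hx)
    refine Or.inl (IsUnit.map (residue k D) ?_)
    have h1 : valD k D x = 1 := le_antisymm x.2 (not_lt.1 hx)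
    have h0 : (x : D) ≠ 0 := fun h => by simp [h] at h1
    have hm : valD k D (x : D)⁻¹ = 1 := by
      have := map_mul (valD k D) (x : D)⁻¹ x
      rwa [inv_mul_cancel₀ h0, map_one, h1, mul_one, eq_comm] at this
    exact ⟨⟨x, ⟨(x : D)⁻¹, hm.le⟩, Subtype.ext (mul_inv_cancel₀ h0),
      Subtype.ext (inv_mul_cancel₀ h0)⟩, rfl⟩

theorem valD_algebraMap (a : k) :
    valD k D (algebraMap k D a) = Valued.v a ^ finrank k D := by
  change Valued.v (Algebra.norm k (algebraMap k D a)) = _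
  rw [Algebra.norm_algebraMap, map_pow]

/-- The inclusion of the valuation ring of `k` into that of `D`. -/
def integerMap : 𝒪[k] →+* valRing k D :=
  ((algebraMap k D).comp (Subring.subtype 𝒪[k])).codRestrict (valRing k D) fun a => by
    change valD k D (algebraMap k D a) ≤ 1
    rw [valD_algebraMap]
    exact pow_le_one' a.2 _

/-- The map of residue rings induced by `𝒪[k] → R_w`. -/
def residueMap : 𝓀[k] →+* ResidueAlgebra k D :=
  Ideal.Quotient.lift 𝓂[k] ((residue k D).comp (integerMap k D)) fun a ha => by
    rw [RingHom.comp_apply, residue_eq_zero]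
    change valD k D (algebraMap k D a) < 1
    rw [valD_algebraMap]
    refine pow_lt_one' (lt_of_le_of_ne a.2 fun h => ?_) finrank_pos.ne'
    have h0 : (a : k) ≠ 0 := fun h' => by simp [h'] at h
    refine (IsLocalRing.mem_maximalIdeal a).1 ha ⟨⟨a, ⟨(a : k)⁻¹, ?_⟩,
      Subtype.ext (mul_inv_cancel₀ h0), Subtype.ext (inv_mul_cancel₀ h0)⟩, rfl⟩
    change Valued.v (a : k)⁻¹ ≤ 1
    rw [map_inv₀, h, inv_one]

/-- The residue division algebra of `D` is an algebra over the residue field of `k`. -/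
instance : Algebra 𝓀[k] (ResidueAlgebra k D) :=
  (residueMap k D).toAlgebra' fun c x => by
    obtain ⟨a, rfl⟩ := Ideal.Quotient.mk_surjective c
    obtain ⟨y, rfl⟩ := residue_surjective k D x
    change residue k D (integerMap k D a) * residue k D y =
      residue k D y * residue k D (integerMap k D a)
    rw [← map_mul, ← map_mul]
    exact congrArg _ (Subtype.ext (Algebra.commutes (a : k) (y : D)))

end HermU

end

noncomputable section

namespace HermU

/-! ### Endomorphisms of a central division algebra as two-sided multiplications -/

section CentralDivision

variable {K E : Type*} [Field K] [DivisionRing E] [Algebra K E]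

/-! Period two yields an involution `σ` of `D` that is trivial on `k`: the splitting of `D ⊗ D`
makes `D` anti-isomorphic to itself, and a dimension count improves the anti-automorphism to an
involution (Albert). It also shows that no odd prime divides `[D : k]`, so that in residue
characteristic different from two everything is tame.

An involution fixing `k` preserves norms, hence the valuation, and acts on the residue algebra.
Choose a uniformizer `p` of `D` with `σ p = δ p`, `δ = ±1`, and let `σ' x = p⁻¹ σ(x) p`. A diagonal
form over `D` can be scaled so that its entries have the value of `1` or of `p`. By Hensel's lemma
it is anisotropic exactly when its two residue forms, over the residues of `σ` and `σ'`, are. This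
is Larmour's theorem `uInvariant_eq_add`: `u(D, σ, ε)` is the sum of the two residue invariants with
signs `ε` and `δ ε`.

It remains to identify the residue involutions. Their composite is the automorphism `θ` of the
residue algebra induced by conjugation by `p`. An element of `D` that commutes with units and with
`p` up to higher order is congruent to an element of `k`: average its conjugates, whose sum is in
`k` by Wedderburn's factorization (`exists_algebraMap_sub_lt`). Hence the fixed field of `θ` in the
center `Z` of the residue algebra is the residue field of `k`. So `θ` generates the Galois group of
`Z`, and being a product of two involutions it has order at most two, with one factor trivial on `Z`
(`dihedral_cases`).

If `D` is unramified, `p` can be taken in `k`, and the two residue involutions coincide. If `D` is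
ramified, then, after exchanging `σ` and `σ'` if needed, the residue of `σ` is of the first kind and
that of `σ'` is unitary. Comparing dimensions of symmetric and skew elements, with `[D : k] ≤ e f`,
shows that `σ` and its residue have the same type. Finally the invariants do not depend on the
involution chosen, since two involutions that agree on the center differ by an inner automorphism,
which amounts to scaling forms. -/

theorem mulLeftRight_bijective (K E : Type*) [Field K] [DivisionRing E] [Algebra K E]
    [FiniteDimensional K E] [Algebra.IsCentral K E] :
    Function.Bijective (AlgHom.mulLeftRight K E) := by
  let : Module (E ⊗[K] Eᵐᵒᵖ) E := instModuleTensorProductMop K E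
  have hsm : ∀ (t : E ⊗[K] Eᵐᵒᵖ) (x : E), t • x = AlgHom.mulLeftRight K E t x := fun _ _ => rfl
  have hs : IsSimpleModule (E ⊗[K] Eᵐᵒᵖ) E := by
    refine isSimpleModule_iff_toSpanSingleton_surjective.2 ⟨inferInstance, fun x hx y => ?_⟩
    refine ⟨(y * x⁻¹) ⊗ₜ 1, ?_⟩
    simp [hsm, AlgHom.mulLeftRight_apply, hx]
  -- Jacobson density: the endomorphisms of the simple module `E` are multiplications by central
  -- scalars, so every `K`-linear map commutes with them and is reached by the action of `E ⊗ Eᵐᵒᵖ`.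
  have hsurj : Function.Surjective (AlgHom.mulLeftRight K E) := by
    intro φ
    have key : ∀ (g : Module.End (E ⊗[K] Eᵐᵒᵖ) E) (x : E), φ (g x) = g (φ x) := by
      intro g x
      have h1 : ∀ y, g y = y * g 1 := fun y => by
        have := g.map_smul (y ⊗ₜ[K] 1) 1
        simpa [hsm, AlgHom.mulLeftRight_apply] using this
      have h2 : ∀ y, g y = g 1 * y := fun y => by
        have := g.map_smul (1 ⊗ₜ[K] MulOpposite.op y) 1
        simpa [hsm, AlgHom.mulLeftRight_apply] using this
      have h3 : g 1 ∈ Subalgebra.center K E :=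
        Subalgebra.mem_center_iff.2 fun y => by rw [← h1, ← h2]
      obtain ⟨c, hc⟩ := (Algebra.IsCentral.mem_center_iff K).1 h3
      rw [h2, h2 (φ x), hc, ← Algebra.smul_def, ← Algebra.smul_def, map_smul]
    let f : Module.End (Module.End (E ⊗[K] Eᵐᵒᵖ) E) E :=
      { toFun := φ, map_add' := map_add φ, map_smul' := fun g x => key g x }
    classical
    let b := Module.finBasis K E
    obtain ⟨r, hr⟩ := jacobson_density f (Finset.univ.image b)
    refine ⟨r, b.ext fun i => ?_⟩
    exact (hr (b i) (Finset.mem_image_of_mem _ (Finset.mem_univ i))).symm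
  refine ⟨?_, hsurj⟩
  have : finrank K (E ⊗[K] Eᵐᵒᵖ) = finrank K (Module.End K E) := by
    rw [finrank_tensorProduct, finrank_linearMap, (MulOpposite.opLinearEquiv K).finrank_eq]
  exact (LinearMap.injective_iff_surjective_of_finrank_eq_finrank this
    (f := (AlgHom.mulLeftRight K E).toLinearMap)).2 hsurj

theorem exists_sum_mul_mul [FiniteDimensional K E] [Algebra.IsCentral K E] (φ : Module.End K E) :
    ∃ (m : ℕ) (a b : Fin m → E), ∀ x, φ x = ∑ i, a i * x * b i := by
  obtain ⟨t, ht⟩ := (mulLeftRight_bijective K E).2 φ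
  obtain ⟨m, a, b, rfl⟩ : ∃ (m : ℕ) (a : Fin m → E) (b : Fin m → Eᵐᵒᵖ), t = ∑ i, a i ⊗ₜ b i := by
    obtain ⟨s, rfl⟩ := TensorProduct.exists_finset t
    refine ⟨s.card, fun i => (s.equivFin.symm i).1.1, fun i => (s.equivFin.symm i).1.2, ?_⟩
    rw [← Finset.sum_coe_sort, ← s.equivFin.symm.sum_comp]
  refine ⟨m, a, fun i => (b i).unop, fun x => ?_⟩
  simp [← ht]

/-- A `K`-linear ring endomorphism of a central division algebra is inner. -/
theorem exists_intertwiner [FiniteDimensional K E] [Algebra.IsCentral K E] (α : E →ₐ[K] E) :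
    ∃ a : E, a ≠ 0 ∧ ∀ x, α x * a = a * x := by
  obtain ⟨t, ht⟩ := (mulLeftRight_bijective K E).2 α.toLinearMap
  let e := TensorProduct.equivFinsuppOfBasisRight (M := E) (Module.finBasis K Eᵐᵒᵖ)
  -- Both sides act on `E` as `y ↦ α x * α y`. Any nonzero coordinate of `t` along the basis of
  -- `Eᵐᵒᵖ` then intertwines.
  have hcomm : ∀ x : E, t * (x ⊗ₜ 1) = (α x ⊗ₜ 1) * t := fun x => by
    apply (mulLeftRight_bijective K E).1
    ext y
    simp [ht]
  have h1 : ∀ (x : E) (s : E ⊗[K] Eᵐᵒᵖ) i, e (s * (x ⊗ₜ 1)) i = e s i * x := by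
    intro x s i
    induction s with
    | zero => simp
    | add s s' h h' => simp [add_mul, h, h']
    | tmul a b => simp [e]
  have h2 : ∀ (x : E) (s : E ⊗[K] Eᵐᵒᵖ) i, e ((x ⊗ₜ 1) * s) i = x * e s i := by
    intro x s i
    induction s with
    | zero => simp
    | add s s' h h' => simp [mul_add, h, h']
    | tmul a b => simp [e]
  have ht0 : t ≠ 0 := by
    rintro rfl
    have := congrArg (fun f => f 1) ht
    simp at this
  obtain ⟨i, hi⟩ : ∃ i, e t i ≠ 0 := by
    by_contra! h
    exact ht0 (e.injective (by ext i; simpa using h i))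
  exact ⟨e t i, hi, fun x => by rw [← h1, ← h2, hcomm]⟩

end CentralDivision

/-- The symmetric tensors over a space of dimension `n` have dimension `n (n + 1) / 2`. -/
theorem finrank_symmetricTensor (K V : Type*) [Field K] [AddCommGroup V] [Module K V]
    [FiniteDimensional K V] :
    2 * finrank K (LinearMap.eqLocus (TensorProduct.comm K V V).toLinearMap LinearMap.id) =
      finrank K V * (finrank K V + 1) := by
  let b := Module.finBasis K V
  let n := finrank K V
  let bb := b.tensorProduct b
  have hsw : ∀ t i j, bb.repr (TensorProduct.comm K V V t) (i, j) = bb.repr t (j, i) := by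
    intro t i j
    induction t with
    | zero => simp
    | add s s' h h' => simp [h, h']
    | tmul x y => simp [bb, mul_comm]
  -- A symmetric tensor is a symmetric matrix of coordinates, that is, a function on unordered pairs
  -- of indices.
  let f : (LinearMap.eqLocus (TensorProduct.comm K V V).toLinearMap LinearMap.id) ≃ₗ[K]
      (Sym2 (Fin n) → K) :=
    { toFun := fun t s => s.lift ⟨fun i j => bb.repr t.1 (i, j), fun i j => by
          dsimp only; rw [← hsw]; congr 2; exact t.2⟩
      map_add' := fun t t' => by
        ext s; induction s with | _ i j => simp
      map_smul' := fun c t => by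
        ext s; induction s with | _ i j => simp
      invFun := fun g => ⟨bb.equivFun.symm fun p => g s(p.1, p.2), by
        change TensorProduct.comm K V V _ = _
        apply bb.repr.injective
        ext ⟨i, j⟩
        rw [hsw]
        change bb.equivFun _ _ = bb.equivFun _ _
        rw [LinearMap.id_apply]
        rw [LinearEquiv.apply_symm_apply, Sym2.eq_swap]⟩
      left_inv := fun t => by
        apply Subtype.ext
        apply bb.equivFun.injective
        ext ⟨i, j⟩
        simp
      right_inv := fun g => by
        ext s
        induction s with | _ i j =>
        change bb.equivFun _ _ = _
        rw [LinearEquiv.apply_symm_apply] }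
  rw [f.finrank_eq, finrank_fintype_fun_eq_card, Sym2.card]
  simp only [Fintype.card_fin]
  rw [Nat.choose_two_right, Nat.mul_div_cancel' ]
  · simp [n, mul_comm]
  · exact (Nat.even_mul_pred_self _).two_dvd

/-! ### Dimensions of commutants -/

section Commutant

variable {K V : Type*} [Field K] [AddCommGroup V] [Module K V]

/-- The endomorphisms commuting with `T`. -/
def commutant (T : Module.End K V) : Submodule K (Module.End K V) :=
  LinearMap.eqLocus (LinearMap.mulLeft K T) (LinearMap.mulRight K T)

theorem mem_commutant {T X : Module.End K V} : X ∈ commutant T ↔ T * X = X * T := Iff.rfl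

/-- The eigenspace of `T` for the eigenvalue `1` or `-1`. -/
def signSpace (T : Module.End K V) (ζ : ℤˣ) : Submodule K V :=
  LinearMap.eqLocus T (ζ • LinearMap.id)

theorem mem_signSpace {T : Module.End K V} {ζ : ℤˣ} {v : V} :
    v ∈ signSpace T ζ ↔ T v = ζ • v := Iff.rfl

theorem isCompl_signSpace (h2 : (2 : K) ≠ 0) {T : Module.End K V} (hT : ∀ v, T (T v) = v) :
    IsCompl (signSpace T 1) (signSpace T (-1)) := by
  constructor
  · rw [Submodule.disjoint_def]
    intro v h1 h1'
    rw [mem_signSpace] at h1 h1'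
    rw [h1, one_smul, Units.neg_smul, one_smul] at h1'
    have : (2 : K) • v = 0 := by rw [two_smul]; nth_rewrite 1 [h1']; simp
    exact (smul_eq_zero.1 this).resolve_left h2
  · rw [Submodule.codisjoint_iff_exists_add_eq]
    intro v
    refine ⟨(2 : K)⁻¹ • (v + T v), (2 : K)⁻¹ • (v - T v), ?_, ?_, ?_⟩
    · simp [mem_signSpace, hT, add_comm]
    · simp [mem_signSpace, hT, ← smul_neg]
    · rw [← smul_add, add_add_sub_cancel, ← two_smul K v, inv_smul_smul₀ h2]

theorem finrank_signSpace_add [FiniteDimensional K V] (h2 : (2 : K) ≠ 0) {T : Module.End K V}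
    (hT : ∀ v, T (T v) = v) :
    finrank K (signSpace T 1) + finrank K (signSpace T (-1)) = finrank K V :=
  Submodule.finrank_add_eq_of_isCompl (isCompl_signSpace h2 hT)

/-- Commuting with `T` means preserving both eigenspaces, so the commutant consists of the block
diagonal endomorphisms. -/
theorem finrank_commutant_of_involution [FiniteDimensional K V] (h2 : (2 : K) ≠ 0)
    {T : Module.End K V} (hT : ∀ v, T (T v) = v) :
    finrank K (commutant T) =
      finrank K (signSpace T 1) ^ 2 + finrank K (signSpace T (-1)) ^ 2 := by
  have hc := isCompl_signSpace h2 hT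
  have hmap : ∀ (ζ : ℤˣ) (X : commutant T), ∀ v ∈ signSpace T ζ, X.1 v ∈ signSpace T ζ := by
    intro ζ X v hv
    rw [mem_signSpace] at hv ⊢
    have := LinearMap.congr_fun X.2 v
    simp only [LinearMap.mulLeft_apply, LinearMap.mulRight_apply, Module.End.mul_apply] at this
    rw [this, hv]
    rcases Int.units_eq_one_or ζ with rfl | rfl <;> simp
  let f : commutant T →ₗ[K] (Module.End K (signSpace T 1)) × (Module.End K (signSpace T (-1))) :=
    { toFun := fun X => (X.1.restrict (hmap 1 X), X.1.restrict (hmap (-1) X))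
      map_add' := fun _ _ => rfl
      map_smul' := fun _ _ => rfl }
  have hf : Function.Bijective f := by
    constructor
    · rw [injective_iff_map_eq_zero]
      intro X hX
      apply Subtype.ext
      ext v
      obtain ⟨a, b, ha, hb, rfl⟩ := Submodule.codisjoint_iff_exists_add_eq.1 hc.codisjoint v
      have h1 : X.1 a = 0 := congrArg Subtype.val (LinearMap.congr_fun (congrArg Prod.fst hX) ⟨a, ha⟩)
      have h2 : X.1 b = 0 := congrArg Subtype.val (LinearMap.congr_fun (congrArg Prod.snd hX) ⟨b, hb⟩)
      rw [map_add, h1, h2, add_zero]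
      rfl
    · rintro ⟨A, B⟩
      let X : Module.End K V := LinearMap.ofIsCompl hc ((signSpace T 1).subtype ∘ₗ A)
        ((signSpace T (-1)).subtype ∘ₗ B)
      have hX1 : ∀ v : signSpace T 1, X v = A v := fun v => by simp [X]
      have hX2 : ∀ v : signSpace T (-1), X v = B v := fun v => by simp [X]
      have hX : X ∈ commutant T := by
        rw [mem_commutant]
        ext v
        obtain ⟨a, b, ha, hb, rfl⟩ := Submodule.codisjoint_iff_exists_add_eq.1 hc.codisjoint v
        have hA := (A ⟨a, ha⟩).2
        have hB := (B ⟨b, hb⟩).2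
        rw [mem_signSpace] at hA hB ha hb
        simp only [Module.End.mul_apply, map_add, ha, hb]
        rw [one_smul, Units.neg_smul, one_smul, map_neg, hX1 ⟨a, ha⟩, hX2 ⟨b, hb⟩, hA, hB]
        simp
      refine ⟨⟨X, hX⟩, ?_⟩
      exact Prod.ext (LinearMap.ext fun v => Subtype.ext (hX1 v))
        (LinearMap.ext fun v => Subtype.ext (hX2 v))
  rw [(LinearEquiv.ofBijective f hf).finrank_eq, finrank_prod, finrank_linearMap,
    finrank_linearMap]
  ring

/-- `T` makes `V` a vector space over the quadratic field `L = K(√c)`, and the commutant is `End_L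
V`, of `K`-dimension `2 (dim_L V) ^ 2`. -/
theorem two_mul_finrank_commutant_of_not_isSquare [FiniteDimensional K V] {T : Module.End K V}
    {c : K} (hT : ∀ v, T (T v) = c • v) (hc : ¬ IsSquare c) :
    2 * finrank K (commutant T) = finrank K V ^ 2 := by
  have hirr : Irreducible (Polynomial.X ^ 2 - Polynomial.C c) := by
    refine (X_pow_sub_C_irreducible_iff_of_prime Nat.prime_two).2 fun b hb => hc ?_
    exact ⟨b, by rw [← hb, sq]⟩
  have : Fact (Irreducible (Polynomial.X ^ 2 - Polynomial.C c)) := ⟨hirr⟩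
  let L := AdjoinRoot (Polynomial.X ^ 2 - Polynomial.C c)
  have hT' : T * T = algebraMap K (Module.End K V) c := by ext v; simp [hT]
  let ρ : L →ₐ[K] Module.End K V :=
    Ideal.Quotient.liftₐ _ (Polynomial.aeval T) fun a ha => by
      obtain ⟨q, rfl⟩ := Ideal.mem_span_singleton.1 ha
      simp [sq, hT']
  have hρ : ∀ p, ρ (AdjoinRoot.mk _ p) = Polynomial.aeval T p := fun p => rfl
  let : Module L V := Module.compHom V ρ.toRingHom
  have hsm : ∀ (z : L) (v : V), z • v = ρ z v := fun _ _ => rfl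
  have : IsScalarTower K L V := ⟨fun a z v => by simp [hsm]⟩
  have hL : finrank K L = 2 := by
    rw [(AdjoinRoot.powerBasis hirr.ne_zero).finrank, AdjoinRoot.powerBasis_dim,
      Polynomial.natDegree_X_pow_sub_C]
  have : FiniteDimensional K L := FiniteDimensional.of_finrank_pos (by omega)
  have : FiniteDimensional L V := FiniteDimensional.right K L V
  have hmem : ∀ X : Module.End K V, X ∈ commutant T → ∀ (z : L) (v : V), X (z • v) = z • X v := by
    intro X hX z v
    obtain ⟨p, rfl⟩ := AdjoinRoot.mk_surjective z
    rw [hsm, hsm, hρ]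
    have h1 : Commute X T := (mem_commutant.1 hX).symm
    have : Commute X (Polynomial.aeval T p) := by
      induction p using Polynomial.induction_on' with
      | add p q hp hq => rw [map_add]; exact hp.add_right hq
      | monomial m a =>
        rw [Polynomial.aeval_monomial]
        exact (show Commute X _ from (Algebra.commutes a X).symm).mul_right (h1.pow_right m)
    exact LinearMap.congr_fun this v
  let e : commutant T ≃ₗ[K] (V →ₗ[L] V) :=
    { toFun := fun X => { toFun := X.1, map_add' := map_add X.1, map_smul' := hmem X.1 X.2 }
      map_add' := fun _ _ => rfl
      map_smul' := fun _ _ => rfl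
      invFun := fun X => ⟨X.restrictScalars K, by
        rw [mem_commutant]
        ext v
        have := X.map_smul (AdjoinRoot.root _) v
        have hr : ρ (AdjoinRoot.root _) = T := by
          rw [← AdjoinRoot.mk_X, hρ, Polynomial.aeval_X]
        rw [hsm, hsm, hr] at this
        exact this.symm⟩
      left_inv := fun _ => rfl
      right_inv := fun _ => rfl }
  rw [e.finrank_eq, ← finrank_mul_finrank K L (V →ₗ[L] V), finrank_linearMap,
    ← finrank_mul_finrank K L V, hL]
  ring

end Commutant

/-! ### Symmetric and skew elements of a first kind involution -/

section CentralDivision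

variable {K E : Type*} [Field K] [DivisionRing E] [Algebra K E] [FiniteDimensional K E]
  [Algebra.IsCentral K E]

/-- Identify `E ⊗ E` with `End E` by `x ⊗ y ↦ (u ↦ x u ψ(y))`. The two relations say that
conjugation by `T` is the exchange of factors, so the commutant is the space of symmetric tensors.
-/
theorem two_mul_finrank_commutant_of_swap (ψ : E ≃ₗ[K] E)
    {T : Module.End K E} (hT0 : Function.Bijective T) (h1 : ∀ x u, T (x * u) = T u * ψ x)
    (h2 : ∀ x u, T (u * ψ x) = x * T u) :
    2 * finrank K (commutant T) = finrank K E * (finrank K E + 1) := by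
  let Ψ : (E ⊗[K] E) ≃ₗ[K] Module.End K E :=
    (TensorProduct.congr (LinearEquiv.refl K E) (ψ.trans (MulOpposite.opLinearEquiv K))).trans
      (LinearEquiv.ofBijective (AlgHom.mulLeftRight K E).toLinearMap (mulLeftRight_bijective K E))
  have hΨ : ∀ x y u, Ψ (x ⊗ₜ y) u = x * u * ψ y := fun x y u =>
    AlgHom.mulLeftRight_apply K E x (MulOpposite.op (ψ y)) u
  have hsw : ∀ t, T * Ψ t = Ψ (TensorProduct.comm K E E t) * T := by
    intro t
    induction t with
    | zero => simp
    | add s s' h h' => simp [mul_add, add_mul, h, h']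
    | tmul x y =>
      ext u
      simp only [Module.End.mul_apply, hΨ, TensorProduct.comm_tmul]
      rw [h2, h1, mul_assoc]
  rw [← finrank_symmetricTensor K E]
  have : commutant T = (LinearMap.eqLocus (TensorProduct.comm K E E).toLinearMap
      LinearMap.id).map Ψ.toLinearMap := by
    ext X
    obtain ⟨t, rfl⟩ := Ψ.surjective X
    rw [mem_commutant, hsw]
    have : Ψ t ∈ (LinearMap.eqLocus (TensorProduct.comm K E E).toLinearMap
      LinearMap.id).map Ψ.toLinearMap ↔ TensorProduct.comm K E E t = t := by
      constructor
      · rintro ⟨s, hs, hst⟩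
        obtain rfl := Ψ.injective hst
        exact hs
      · exact fun h => ⟨t, h, rfl⟩
    rw [this]
    constructor
    · intro h
      apply Ψ.injective
      ext u
      obtain ⟨v, rfl⟩ := hT0.2 u
      exact LinearMap.congr_fun h v
    · intro h
      rw [h]
  rw [this, LinearEquiv.finrank_map_eq]

/-- Eigenspaces of an involution of the first kind on a central division algebra. -/
theorem sq_finrank_signSpace_sub (h2 : (2 : K) ≠ 0) (T : Module.End K E)
    (hT : ∀ v, T (T v) = v) (hmul : ∀ x y, T (x * y) = T y * T x) :
    ((finrank K (signSpace T 1) : ℤ) - finrank K (signSpace T (-1))) ^ 2 = finrank K E := by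
  have hb : Function.Bijective T := Function.Involutive.bijective hT
  have h := two_mul_finrank_commutant_of_swap (LinearEquiv.ofBijective T hb) hb
    (fun x u => hmul x u) (fun x u => by simp [hmul, hT])
  -- With eigenspaces of dimensions `s`, `t` and `n = dim E`, the commutant has been counted twice:
  -- `2 (s² + t²) = n (n + 1)`. With `s + t = n` this gives `(s - t)² = n`.
  rw [finrank_commutant_of_involution h2 hT] at h
  have h' := finrank_signSpace_add h2 hT
  zify at h h'
  linear_combination h - ((finrank K (signSpace T 1) : ℤ) + finrank K (signSpace T (-1)) + finrank K E) * h'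

end CentralDivision

/-- The exponent depends only on `L` and not on the embedding, so two embeddings of one field have
the same norms. This is what `norm_involution` needs. -/
theorem norm_algHom {k D L : Type*} [Field k] [DivisionRing D] [Algebra k D]
    [FiniteDimensional k D] [Field L] [Algebra k L] (φ : L →ₐ[k] D) (z : L) :
    Algebra.norm k (φ z) = Algebra.norm k z ^ (finrank k D / finrank k L) := by
  let : Module L D := Module.compHom D φ.toRingHom
  have hsm : ∀ (z : L) (d : D), z • d = φ z * d := fun _ _ => rfl
  have : IsScalarTower k L D := ⟨fun a z d => by
    rw [hsm, hsm, map_smul, smul_mul_assoc]⟩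
  have : FiniteDimensional k L :=
    FiniteDimensional.of_injective φ.toLinearMap φ.toRingHom.injective
  have : FiniteDimensional L D := FiniteDimensional.right k L D
  have hr : finrank k D / finrank k L = finrank L D := by
    rw [← finrank_mul_finrank k L D, Nat.mul_div_cancel_left _ finrank_pos]
  have h := LinearMap.det_restrictScalars (R := k) (S := L) (A := D)
    (f := z • (LinearMap.id : D →ₗ[L] D))
  rw [LinearMap.det_smul, LinearMap.det_id, mul_one, map_pow] at h
  rw [hr, ← h, Algebra.norm_apply]
  rfl

/-- An involution that fixes the base field, as a linear map. -/
def Involution.toEnd {k D : Type*} [Field k] [DivisionRing D] [Algebra k D] (σ : Involution D)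
    (hσ : ∀ c : k, σ (algebraMap k D c) = algebraMap k D c) : Module.End k D where
  toFun := σ
  map_add' := σ.map_add'
  map_smul' c x := by
    change σ _ = c • σ x
    rw [Algebra.smul_def, σ.map_mul', hσ, ← Algebra.commutes, ← Algebra.smul_def]

theorem Involution.map_zero {D : Type*} [DivisionRing D] (σ : Involution D) : σ 0 = 0 := by
  have := σ.map_add' 0 0
  rwa [add_zero, left_eq_add] at this

theorem Involution.map_one {D : Type*} [DivisionRing D] (σ : Involution D) : σ 1 = 1 := by
  have := σ.map_mul' (σ 1) 1
  rwa [mul_one, σ.invol', mul_one, eq_comm] at this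

/-- On the commutative subfield `k(x)` an anti-automorphism is multiplicative, so `σ` composed with
the inclusion is a second embedding of that field. -/
theorem norm_involution {k D : Type*} [Field k] [DivisionRing D] [Algebra k D]
    [FiniteDimensional k D] (σ : Involution D)
    (hσ : ∀ c : k, σ (algebraMap k D c) = algebraMap k D c) (x : D) :
    Algebra.norm k (σ x) = Algebra.norm k x := by
  obtain ⟨p, _, φ, z, rfl⟩ := exists_field (k := k) x
  let χ : AdjoinRoot p →ₐ[k] D := AlgHom.ofLinearMap (σ.toEnd hσ ∘ₗ φ.toLinearMap)
    (by change σ (φ 1) = 1; rw [_root_.map_one, σ.map_one])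
    (fun a b => by
      change σ (φ (a * b)) = σ (φ a) * σ (φ b)
      rw [mul_comm, map_mul, σ.map_mul'])
  have h : χ z = σ (φ z) := rfl
  rw [← h, norm_algHom, norm_algHom]

/-! ### Existence of involutions of the first kind -/

section CentralDivision

variable {K E : Type*} [Field K] [DivisionRing E] [Algebra K E] [FiniteDimensional K E]
  [Algebra.IsCentral K E]

/-- An anti-automorphism of a central division algebra gives rise to an involution of the first
kind. -/
theorem exists_involution_of_antiAutomorphism (ψ : E ≃ₐ[K] Eᵐᵒᵖ) :
    ∃ σ : Involution E, ∀ c : K, σ (algebraMap K E c) = algebraMap K E c := by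
  let Φ : (E ⊗[K] E) ≃ₐ[K] Module.End K E :=
    (Algebra.TensorProduct.congr AlgEquiv.refl ψ).trans
      (AlgEquiv.ofBijective (AlgHom.mulLeftRight K E) (mulLeftRight_bijective K E))
  have hΦ : ∀ x y u, Φ (x ⊗ₜ y) u = x * u * (ψ y).unop := fun x y u =>
    AlgHom.mulLeftRight_apply K E x (ψ y) u
  -- Transport the exchange of factors of `E ⊗ E` to `End E`. Automorphisms of `End E` are inner,
  -- which produces `T`. As the exchange has order two, `T²` will be a scalar `a`.
  let c := Φ.symm.trans ((Algebra.TensorProduct.comm K E E).trans Φ)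
  obtain ⟨T, hT⟩ := c.eq_linearEquivConjAlgEquiv
  have hsw : ∀ t u, T (Φ t u) = Φ (Algebra.TensorProduct.comm K E E t) (T u) := fun t u => by
    have : c (Φ t) = Φ (Algebra.TensorProduct.comm K E E t) := by simp [c]
    rw [← this, hT, LinearEquiv.conjAlgEquiv_apply]
    simp
  have h1 : ∀ x u, T (x * u) = T u * (ψ x).unop := fun x u => by
    simpa [hΦ] using hsw (x ⊗ₜ 1) u
  have h2 : ∀ x u, T (u * (ψ x).unop) = x * T u := fun x u => by
    simpa [hΦ] using hsw (1 ⊗ₜ x) u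
  have h3 : ∀ x, T (T x) = x * T (T 1) := fun x => by
    rw [← h2, ← h1, mul_one]
  have h4 : ∀ x, T (T x) = T (T 1) * x := fun x => by
    obtain ⟨y, rfl⟩ : ∃ y, (ψ y).unop = x :=
      ⟨ψ.symm (MulOpposite.op x), by simp⟩
    rw [← h1, ← h2, one_mul]
  have h5 : T (T 1) ∈ Subalgebra.center K E :=
    Subalgebra.mem_center_iff.2 fun y => by rw [← h3, ← h4]
  obtain ⟨a, ha⟩ := (Algebra.IsCentral.mem_center_iff K).1 h5
  have h6 : ∀ x, T (T x) = a • x := fun x => by rw [h4, ha, Algebra.smul_def]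
  have ha0 : a ≠ 0 := by
    rintro rfl
    have := h6 1
    simp at this
  -- Otherwise the commutant of `T` would satisfy both `2 dim = n²` and `2 dim = n (n + 1)`.
  have hsq : IsSquare a := by
    by_contra h
    have e1 := two_mul_finrank_commutant_of_not_isSquare (T := T.toLinearMap) h6 h
    rw [two_mul_finrank_commutant_of_swap (ψ.toLinearEquiv.trans (MulOpposite.opLinearEquiv K).symm)
      T.bijective h1 h2] at e1
    have : 0 < finrank K E := finrank_pos
    nlinarith
  obtain ⟨ν, rfl⟩ := hsq
  -- An eigenvector of `T`, where `T² = ν²`: either `1` itself, for `-ν`, or `T 1 + ν`, for `ν`.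
  -- Twisting `ψ` by `w` makes it involutive.
  obtain ⟨w, hw, η, hη, hTw⟩ : ∃ w : E, w ≠ 0 ∧ ∃ η : K, η ≠ 0 ∧ T w = η • w := by
    have hν : ν ≠ 0 := fun h => ha0 (by simp [h])
    by_cases h : T 1 + ν • (1 : E) = 0
    · exact ⟨1, one_ne_zero, -ν, neg_ne_zero.2 hν, by rw [neg_smul]; exact eq_neg_of_add_eq_zero_left h⟩
    · exact ⟨_, h, ν, hν, by rw [map_add, h6, map_smul, smul_add, smul_smul, add_comm]⟩
  -- Compute `T (w ψ(y))` in two ways, by `h2`, and by `h1` after writing `w ψ(y)` as a left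
  -- multiple of `w`.
  have hinv : ∀ y, w * (ψ (w * (ψ y).unop * w⁻¹)).unop = y * w := fun y => by
    have e1 : T (w * (ψ y).unop) = η • (y * w) := by rw [h2, hTw, mul_smul_comm]
    have e2 : T (w * (ψ y).unop * w⁻¹ * w) = η • (w * (ψ (w * (ψ y).unop * w⁻¹)).unop) := by
      rw [h1, hTw, smul_mul_assoc]
    rw [inv_mul_cancel_right₀ hw, e1] at e2
    exact (smul_right_injective E hη e2).symm
  refine ⟨⟨fun y => w * (ψ y).unop * w⁻¹, fun x y => ?_, fun x y => ?_, fun y => ?_⟩, fun c => ?_⟩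
  · simp [mul_add, add_mul]
  · simp [mul_assoc, hw]
  · rw [hinv, mul_inv_cancel_right₀ hw]
  · change w * (ψ (algebraMap K E c)).unop * w⁻¹ = _
    rw [AlgEquiv.commutes, MulOpposite.algebraMap_apply, MulOpposite.unop_op, ← Algebra.commutes,
      mul_inv_cancel_right₀ hw]

/-- Two commuting actions of a central division algebra `E` on a space of the dimension of `E`
give an involution of the first kind. -/
theorem exists_involution_of_commute {W : Type*} [AddCommGroup W] [Module K W]
    [FiniteDimensional K W] (α β : E →ₐ[K] Module.End K W) (hc : ∀ x y, Commute (α x) (β y))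
    (hd : finrank K W = finrank K E) :
    ∃ σ : Involution E, ∀ c : K, σ (algebraMap K E c) = algebraMap K E c := by
  have : Nontrivial W := nontrivial_of_finrank_pos (R := K) (by rw [hd]; exact finrank_pos)
  obtain ⟨w, hw⟩ := exists_ne (0 : W)
  have hinj : ∀ (γ : E →ₐ[K] Module.End K W) x, γ x w = 0 → x = 0 := fun γ x hx => by
    by_contra h0
    have : γ (x⁻¹ * x) w = γ x⁻¹ (γ x w) := by rw [map_mul]; rfl
    rw [inv_mul_cancel₀ h0, hx, map_zero, map_one] at this
    exact hw this
  let f : (E →ₐ[K] Module.End K W) → E →ₗ[K] W := fun γ =>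
    LinearMap.applyₗ w ∘ₗ γ.toLinearMap
  have hf : ∀ γ, Function.Bijective (f γ) := fun γ => by
    have : Function.Injective (f γ) := (injective_iff_map_eq_zero _).2 (hinj γ)
    exact ⟨this, (LinearMap.injective_iff_surjective_of_finrank_eq_finrank hd.symm).1 this⟩
  let e := LinearEquiv.ofBijective _ (hf α)
  have he : ∀ x, e x = α x w := fun _ => rfl
  -- Each action has the nonzero vector `w` as a free generator. Expressing the `β`-orbit of `w`
  -- through `α` reverses products because the two actions commute.
  let ψ : E ≃ₗ[K] E := (LinearEquiv.ofBijective _ (hf β)).trans e.symm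
  have hψ : ∀ y, α (ψ y) w = β y w := fun y => e.apply_symm_apply _
  refine exists_involution_of_antiAutomorphism
    (AlgEquiv.ofLinearEquiv (ψ.trans (MulOpposite.opLinearEquiv K)) ?_ fun x y => ?_)
  · apply MulOpposite.unop_injective
    apply e.injective
    rw [he, he]
    simp [hψ]
  · apply MulOpposite.unop_injective
    apply e.injective
    rw [he, he]
    change α (ψ (x * y)) w = α (ψ y * ψ x) w
    rw [hψ, map_mul, map_mul, Module.End.mul_apply, Module.End.mul_apply, hψ, ← hψ y]
    exact (LinearMap.congr_fun (hc (ψ y) x) w).symm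

/-- A central division algebra of odd dimension with an involution of the first kind is
commutative. -/
theorem finrank_eq_one_of_odd (h2 : (2 : K) ≠ 0) (σ : Involution E)
    (hσ : ∀ c : K, σ (algebraMap K E c) = algebraMap K E c) (hodd : Odd (finrank K E)) :
    finrank K E = 1 := by
  let T : Module.End K E := σ.toEnd hσ
  have h := sq_finrank_signSpace_sub h2 T σ.invol' σ.map_mul'
  have hs := finrank_signSpace_add h2 (T := T) σ.invol'
  -- A skew `x` satisfies `N(x) = N(-x) = -N(x)` in odd dimension. Without skew elements `(s - t)² =
  -- n` reads `n² = n`.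
  have hskew : finrank K (signSpace T (-1)) = 0 := by
    rw [finrank_eq_zero_iff_of_free, Submodule.subsingleton_iff_eq_bot, Submodule.eq_bot_iff]
    intro x hx
    have hx' : σ x = -x := by rw [mem_signSpace, Units.neg_smul, one_smul] at hx; exact hx
    by_contra h0
    have hN := norm_involution σ hσ x
    rw [hx', ← neg_one_mul, map_mul, ← map_one (algebraMap K E), ← map_neg, Algebra.norm_algebraMap,
      hodd.neg_one_pow] at hN
    have hN0 : Algebra.norm K x ≠ 0 := Algebra.norm_ne_zero_iff.2 h0
    apply hN0
    have : 2 * Algebra.norm K x = 0 := by linear_combination -hN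
    exact (mul_eq_zero.1 this).resolve_left h2
  rw [hskew, add_zero] at hs
  rw [hskew, hs] at h
  have : 0 < finrank K E := finrank_pos
  zify at this
  push_cast at h
  have : (finrank K E : ℤ) = 1 := by nlinarith
  exact_mod_cast this

end CentralDivision

/-! ### Base change of central division algebras -/

section BaseChange

variable (k F D : Type*) [Field k] [Field F] [Algebra k F] [DivisionRing D] [Algebra k D]
  [FiniteDimensional k D] [Algebra.IsCentral k D]

/-- Coordinate functions on `D` are sums of two-sided multiplications, and the same formula computes
coordinates after base change. Two-sided ideals are therefore stable under taking coordinates. -/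
theorem exists_sum_eq_repr_smul {ι : Type*} (b : Basis ι k D) (j : ι) :
    ∃ (m : ℕ) (u v : Fin m → D), ∀ x : F ⊗[k] D,
      ∑ i, (1 ⊗ₜ u i) * x * (1 ⊗ₜ v i) = (Algebra.TensorProduct.basis F b).repr x j • 1 := by
  obtain ⟨m, u, v, h⟩ := exists_sum_mul_mul ((b.coord j).smulRight (1 : D))
  refine ⟨m, u, v, fun x => ?_⟩
  induction x with
  | zero => simp
  | add x y hx hy => simp [mul_add, add_mul, Finset.sum_add_distrib, hx, hy, add_smul]
  | tmul a d =>
    have := h d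
    simp only [LinearMap.smulRight_apply, Basis.coord_apply] at this
    simp only [Algebra.TensorProduct.tmul_mul_tmul, one_mul, mul_one, ← TensorProduct.tmul_sum,
      ← this, Algebra.TensorProduct.basis_repr_tmul]
    simp [Algebra.TensorProduct.one_def, TensorProduct.smul_tmul']
    rw [Algebra.smul_def, mul_comm]

/-- A nonzero element of a two-sided ideal has a nonzero coordinate in `F`, and this scalar again
lies in the ideal. -/
instance isSimpleRing_baseChange : IsSimpleRing (F ⊗[k] D) := by
  rw [isSimpleRing_iff_isTwoSided_imp]
  refine ⟨inferInstance, fun I hI => ?_⟩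
  rw [or_iff_not_imp_left]
  intro h
  obtain ⟨x, hx, hx0⟩ := Submodule.exists_mem_ne_zero_of_ne_bot h
  let b := Module.finBasis k D
  obtain ⟨j, hj⟩ : ∃ j, (Algebra.TensorProduct.basis F b).repr x j ≠ 0 := by
    by_contra! h
    exact hx0 ((Algebra.TensorProduct.basis F b).repr.injective (by ext j; simpa using h j))
  obtain ⟨m, u, v, h⟩ := exists_sum_eq_repr_smul k F D b j
  have hmem : (Algebra.TensorProduct.basis F b).repr x j • (1 : F ⊗[k] D) ∈ I := by
    rw [← h]
    exact I.sum_mem fun i _ => I.mul_mem_right _ (I.mul_mem_left _ hx)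
  rw [Ideal.eq_top_iff_one]
  have := I.mul_mem_left (algebraMap F (F ⊗[k] D) ((Algebra.TensorProduct.basis F b).repr x j)⁻¹) hmem
  rwa [← Algebra.smul_def, smul_smul, inv_mul_cancel₀ hj, one_smul] at this

/-- Write a projection of `D` onto `k` as `x ↦ ∑ uᵢ x vᵢ` with `∑ uᵢ vᵢ = 1`. The extended operator
fixes central elements and has values in `F`. -/
instance isCentral_baseChange : Algebra.IsCentral F (F ⊗[k] D) := by
  constructor
  intro z hz
  rw [Subalgebra.mem_center_iff] at hz
  obtain ⟨f, hf⟩ := Module.Projective.exists_dual_eq_one k (one_ne_zero (α := D))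
  obtain ⟨m, u, v, h⟩ := exists_sum_mul_mul (f.smulRight (1 : D))
  have h1 : ∑ i, u i * v i = 1 := by simpa [hf] using (h 1).symm
  have h2 : z = ∑ i, (1 ⊗ₜ u i) * z * (1 ⊗ₜ v i) := by
    simp only [hz, mul_assoc, ← Finset.mul_sum]
    simp [Algebra.TensorProduct.tmul_mul_tmul, ← TensorProduct.tmul_sum, h1,
      ← Algebra.TensorProduct.one_def]
  rw [h2]
  clear h2 hz
  induction z with
  | zero => simp
  | add x y hx hy =>
    simp only [mul_add, add_mul, Finset.sum_add_distrib]
    exact add_mem hx hy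
  | tmul a d =>
    have := h d
    simp only [LinearMap.smulRight_apply] at this
    simp only [Algebra.TensorProduct.tmul_mul_tmul, one_mul, mul_one, ← TensorProduct.tmul_sum,
      ← this]
    rw [Algebra.mem_bot]
    exact ⟨f d • a, by simp [Algebra.TensorProduct.algebraMap_apply, TensorProduct.smul_tmul]⟩

end BaseChange

/-- Wedderburn's theorem for the base change of a central division algebra. -/
theorem exists_baseChange_equiv_matrix.{v, w} (k : Type*) (F : Type v) (D : Type w) [Field k] [Field F] [Algebra k F]
    [DivisionRing D] [Algebra k D] [FiniteDimensional k D] [Algebra.IsCentral k D] :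
    ∃ (r : ℕ) (_ : NeZero r) (B : Type (max v w)) (_ : DivisionRing B) (_ : Algebra F B)
      (_ : FiniteDimensional F B) (_ : Algebra.IsCentral F B),
      Nonempty ((F ⊗[k] D) ≃ₐ[F] Matrix (Fin r) (Fin r) B) := by
  have : IsArtinianRing (F ⊗[k] D) := IsArtinianRing.of_finite F _
  obtain ⟨r, hr, B, _, _, _, ⟨e⟩⟩ :=
    IsSimpleRing.exists_algEquiv_matrix_divisionRing_finite F (F ⊗[k] D)
  have : Algebra.IsCentral F (Matrix (Fin r) (Fin r) B) := Algebra.IsCentral.of_algEquiv F _ _ e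
  refine ⟨r, hr, B, _, _, inferInstance, ⟨fun z hz => ?_⟩, ⟨e⟩⟩
  have h1 : Matrix.scalar (Fin r) z ∈ Subalgebra.center F (Matrix (Fin r) (Fin r) B) := by
    rw [Subalgebra.mem_center_iff] at hz ⊢
    intro M
    ext i j
    simp [Matrix.scalar, hz]
  obtain ⟨c, hc⟩ := (Algebra.IsCentral.mem_center_iff F).1 h1
  have := congrFun (congrFun hc 0) 0
  rw [Algebra.mem_bot]
  exact ⟨c, by simpa [Matrix.algebraMap_matrix_apply] using this.symm⟩

/-! ### Passing from matrices over a division algebra to the division algebra -/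

section Corner

/-- The compression of a representation of a matrix algebra over `B` to a representation of `B`,
together with a commuting representation. -/
theorem exists_corner.{v} {F B C : Type*} {W : Type v} [Field F] [Ring B] [Algebra F B] [Ring C]
    [Algebra F C] [AddCommGroup W] [Module F W] [FiniteDimensional F W] {r : ℕ} [NeZero r]
    (γ : Matrix (Fin r) (Fin r) B →ₐ[F] Module.End F W)
    (δ : C →ₐ[F] Module.End F W) (hc : ∀ x y, Commute (γ x) (δ y)) :
    ∃ (W₁ : Type v) (_ : AddCommGroup W₁) (_ : Module F W₁) (_ : FiniteDimensional F W₁)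
      (γ₁ : B →ₐ[F] Module.End F W₁) (δ₁ : C →ₐ[F] Module.End F W₁),
      (∀ x y, Commute (γ₁ x) (δ₁ y)) ∧ finrank F W = r * finrank F W₁ := by
  let E : Fin r → Fin r → B → Module.End F W := fun i j b => γ (Matrix.single i j b)
  have hE : ∀ i j l b b' w, E i j b (E j l b' w) = E i l (b * b') w := fun i j l b b' w => by
    rw [← Module.End.mul_apply, ← map_mul, Matrix.single_mul_single_same]
  have hE0 : ∀ i j j' l b b' w, j ≠ j' → E i j b (E j' l b' w) = 0 := fun i j j' l b b' w h => by
    rw [← Module.End.mul_apply, ← map_mul, Matrix.single_mul_single_of_ne _ _ _ _ h]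
    simp
  -- The image of the idempotent matrix unit; the matrix units identify `W` with `r` copies of it.
  let W₁ : Submodule F W := LinearMap.range (E 0 0 1)
  have hW : ∀ w : W₁, E 0 0 1 w = w := by
    rintro ⟨_, w, rfl⟩
    simp [hE]
  have hδ : ∀ c w, E 0 0 1 (δ c w) = δ c (E 0 0 1 w) := fun c w => LinearMap.congr_fun (hc _ c) w
  let γ₁ : B →ₐ[F] Module.End F W₁ := AlgHom.ofLinearMap
    { toFun := fun b => (E 0 0 b).restrict (p := W₁) (q := W₁) fun w hw => ⟨E 0 0 b w, by simp [hE]⟩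
      map_add' := fun b b' => by ext w; simp [E, Matrix.single_add]; rfl
      map_smul' := fun a b => by ext w; simp [E, ← Matrix.smul_single]; rfl }
    (by ext w; exact hW w)
    (fun b b' => by ext w; exact (hE 0 0 0 b b' w).symm)
  let δ₁ : C →ₐ[F] Module.End F W₁ := AlgHom.ofLinearMap
    { toFun := fun c => (δ c).restrict (p := W₁) (q := W₁) fun w hw => ⟨δ c w, by
        rw [hδ, hW ⟨w, hw⟩]⟩
      map_add' := fun b b' => by ext w; simp; rfl
      map_smul' := fun a b => by ext w; simp; rfl }
    (by ext w; simp)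
    (fun b b' => by ext w; simp; rfl)
  refine ⟨W₁, inferInstance, inferInstance, inferInstance, γ₁, δ₁, fun x y => ?_, ?_⟩
  · ext w
    exact LinearMap.congr_fun (hc (Matrix.single 0 0 x) y) w
  · let f : W ≃ₗ[F] (Fin r → W₁) :=
      { toFun := fun w i => ⟨E 0 i 1 w, E 0 i 1 w, by simp [hE]⟩
        map_add' := fun _ _ => by ext i; simp
        map_smul' := fun _ _ => by ext i; simp
        invFun := fun v => ∑ i, E i 0 1 (v i)
        left_inv := fun w => by
          simp only [hE, mul_one]
          have : ∑ i : Fin r, Matrix.single i i (1 : B) = 1 := by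
            ext i j
            by_cases h : i = j
            · subst h
              simp [Matrix.sum_apply, Matrix.single_apply]
            · rw [Matrix.sum_apply, Matrix.one_apply_ne h]
              refine Finset.sum_eq_zero fun l _ => ?_
              rw [Matrix.single_apply_of_ne]
              rintro ⟨rfl, h'⟩
              exact h h'
          rw [← LinearMap.sum_apply, ← map_sum, this, map_one, Module.End.one_apply]
        right_inv := fun v => by
          ext i
          simp only [map_sum]
          rw [Finset.sum_eq_single i]
          · rw [hE, mul_one, hW]
          · exact fun j _ hj => hE0 _ _ _ _ _ _ _ hj.symm
          · simp }
    rw [f.finrank_eq, finrank_pi_fintype]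
    simp

end Corner

theorem finrank_dvd_of_algHom {k D W : Type*} [Field k] [DivisionRing D] [Algebra k D]
    [FiniteDimensional k D] [AddCommGroup W] [Module k W] [FiniteDimensional k W]
    (γ : D →ₐ[k] Module.End k W) : finrank k D ∣ finrank k W := by
  let : Module D W := Module.compHom W γ.toRingHom
  have hsm : ∀ (z : D) (d : W), z • d = γ z d := fun _ _ => rfl
  have : IsScalarTower k D W := ⟨fun a z d => by simp [hsm]⟩
  exact ⟨_, (finrank_mul_finrank k D W).symm⟩

/-- The action of matrices over an `F`-algebra on column vectors. -/
def mulVecAlgHom (F B : Type*) [Field F] [Ring B] [Algebra F B] (r : ℕ) :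
    Matrix (Fin r) (Fin r) B →ₐ[F] Module.End F (Fin r → B) :=
  AlgHom.ofLinearMap
    { toFun := fun M =>
        { toFun := M.mulVec
          map_add' := M.mulVec_add
          map_smul' := fun c v => by
            ext i
            simp [Matrix.mulVec, dotProduct, Finset.smul_sum] }
      map_add' := fun M M' => LinearMap.ext fun v => Matrix.add_mulVec M M' v
      map_smul' := fun c M => LinearMap.ext fun v => by
        ext i
        simp [Matrix.mulVec, dotProduct, Finset.smul_sum] }
    (LinearMap.ext fun v => Matrix.one_mulVec v)
    (fun M M' => LinearMap.ext fun v => (Matrix.mulVec_mulVec v M M').symm)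

/-! ### Galois splitting fields and the absence of odd prime factors -/

/-- A central division algebra is split by a finite Galois extension. -/
theorem exists_galois_splitting.{v, w} (k : Type v) (D : Type w) [Field k] [DivisionRing D]
    [Algebra k D] [FiniteDimensional k D] [Algebra.IsCentral k D] :
    ∃ (m : ℕ) (N : Type v) (_ : Field N) (_ : Algebra k N),
      FiniteDimensional k N ∧ IsGalois k N ∧
      Nonempty (D →ₐ[k] Matrix (Fin m) (Fin m) N) ∧ finrank k D = m ^ 2 := by
  let Ω := SeparableClosure k
  obtain ⟨m, _, B, _, _, _, _, ⟨e⟩⟩ := exists_baseChange_equiv_matrix k Ω D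
  -- By Jacobson–Noether a larger `B` would contain a noncentral element separable over `Ω`, which
  -- is impossible over a separably closed field.
  have hB : Function.Bijective (algebraMap Ω B) := by
    refine ⟨(algebraMap Ω B).injective, ?_⟩
    by_contra hs
    obtain ⟨x, hx, hsep⟩ := JacobsonNoether.exists_separable_and_not_isCentral' (L := Ω) (D := B)
      (fun h => hs fun x => Algebra.mem_bot.1 (h ▸ Algebra.mem_top))
    have hint : IsIntegral Ω x := Algebra.IsIntegral.isIntegral x
    have := IsSepClosed.degree_eq_one_of_irreducible Ω (minpoly.irreducible hint) hsep
    exact hx (Algebra.mem_bot.2 (minpoly.mem_range_of_degree_eq_one Ω x this))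
  let eB : B ≃ₐ[Ω] Ω := (AlgEquiv.ofBijective (Algebra.ofId Ω B) hB).symm
  let e' : (Ω ⊗[k] D) ≃ₐ[Ω] Matrix (Fin m) (Fin m) Ω := e.trans eB.mapMatrix
  have hdim : finrank k D = m ^ 2 := by
    rw [← finrank_baseChange (R := Ω) (S := k) (M' := D), e'.toLinearEquiv.finrank_eq,
      finrank_matrix]
    simp [sq]
  let f : D →ₐ[k] Matrix (Fin m) (Fin m) Ω :=
    (e'.toAlgHom.restrictScalars k).comp Algebra.TensorProduct.includeRight
  let b := Module.finBasis k D
  -- The finitely many matrix entries of a basis of `D` already define the splitting; the normal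
  -- closure of the field they generate suffices.
  let S : Set Ω := Set.range fun p : Fin (finrank k D) × Fin m × Fin m => f (b p.1) p.2.1 p.2.2
  have hS : S.Finite := Set.finite_range _
  let N₀ := IntermediateField.adjoin k S
  have : FiniteDimensional k N₀ :=
    have := hS.to_subtype
    IntermediateField.finiteDimensional_adjoin fun x _ => Algebra.IsIntegral.isIntegral x
  let N := IntermediateField.normalClosure k N₀ Ω
  have hfin : FiniteDimensional k N := inferInstance
  have hN : ∀ d i j, f d i j ∈ N := by
    intro d i j
    have h : ∀ l, f (b l) i j ∈ N := fun l => by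
      have h0 : N₀ ≤ N := IntermediateField.le_normalClosure N₀
      exact h0 (IntermediateField.subset_adjoin k S ⟨(l, i, j), rfl⟩)
    rw [← b.sum_repr d, map_sum, Matrix.sum_apply]
    refine sum_mem fun l _ => ?_
    rw [map_smul, Matrix.smul_apply]
    exact N.smul_mem (h l)
  have : Normal k N := normalClosure.normal k N₀ Ω
  refine ⟨m, N, inferInstance, inferInstance, hfin, ⟨⟩, ⟨?_⟩, hdim⟩
  exact AlgHom.ofLinearMap
    { toFun := fun d => Matrix.of fun i j => ⟨f d i j, hN d i j⟩
      map_add' := fun d d' => by ext i j; simp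
      map_smul' := fun c d => Matrix.ext fun i j => Subtype.ext (by
        change f (c • d) i j = c • f d i j
        rw [map_smul, Matrix.smul_apply]) }
    (by
      ext i j
      by_cases h : i = j
      · subst h; simp
      · simp [h])
    (fun d d' => by ext i j; simp [Matrix.mul_apply])

/-- The fixed field of a Sylow `p`-subgroup. -/
theorem exists_subfield_of_isGalois.{v} (k N : Type v) [Field k] [Field N] [Algebra k N]
    [FiniteDimensional k N] [IsGalois k N] {p : ℕ} (hp : p.Prime) :
    ∃ (F : Type v) (_ : Field F) (_ : Algebra k F) (_ : Algebra F N) (a : ℕ),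
      IsScalarTower k F N ∧ FiniteDimensional k F ∧ finrank F N = p ^ a ∧ ¬ p ∣ finrank k F := by
  have : Fact p.Prime := ⟨hp⟩
  let P : Sylow p Gal(N/k) := default
  let F := IntermediateField.fixedField (P : Subgroup Gal(N/k))
  obtain ⟨a, ha⟩ := P.isPGroup'.exists_card_eq
  have hFN : finrank F N = p ^ a := by
    rw [IntermediateField.finrank_fixedField_eq_card, ← ha]
  refine ⟨F, inferInstance, inferInstance, inferInstance, a, inferInstance, inferInstance, hFN, ?_⟩
  have h1 := P.not_dvd_index
  have h2 := (P : Subgroup Gal(N/k)).card_mul_index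
  have h3 := finrank_mul_finrank k F N
  rw [IsGalois.card_aut_eq_finrank, ← h3, hFN, ha, mul_comm] at h2
  rwa [← Nat.eq_of_mul_eq_mul_right (pow_pos hp.pos a) h2]

/-- The dimension of a central division algebra with split tensor square is prime to every odd
prime. -/
theorem not_dvd_finrank_of_commute (k D W : Type*) [Field k] [DivisionRing D] [Algebra k D]
    [FiniteDimensional k D] [Algebra.IsCentral k D] (h2 : (2 : k) ≠ 0) [AddCommGroup W]
    [Module k W] [FiniteDimensional k W] (α β : D →ₐ[k] Module.End k W)
    (hc : ∀ x y, Commute (α x) (β y)) (hW : finrank k W = finrank k D) {p : ℕ} (hp : p.Prime)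
    (hp2 : p ≠ 2) : ¬ p ∣ finrank k D := by
  obtain ⟨m, N, _, _, _, _, ⟨f⟩, hm⟩ := exists_galois_splitting k D
  obtain ⟨F, _, _, _, a, _, _, hFN, hkF⟩ := exists_subfield_of_isGalois k N hp
  have : FiniteDimensional F N := FiniteDimensional.right k F N
  obtain ⟨r, _, B, _, _, _, _, ⟨e⟩⟩ := exists_baseChange_equiv_matrix k F D
  have hr : r ^ 2 * finrank F B = finrank k D := by
    rw [← finrank_baseChange (R := F) (S := k) (M' := D), e.toLinearEquiv.finrank_eq,
      finrank_matrix]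
    simp [sq]
  have hrpos : 0 < r := Nat.pos_of_ne_zero (NeZero.ne r)
  have hBpos : 0 < finrank F B := finrank_pos
  have h2F : (2 : F) ≠ 0 := by
    have := (map_ne_zero (algebraMap k F)).2 h2
    rwa [map_ofNat] at this
  -- `N` splits `F ⊗ D` and `[N : F] = p ^ a`, so letting `B` act on the corner of `N ^ m` shows
  -- that `dim B` divides `p ^ (2 a)`.
  have hodd : Odd (finrank F B) := by
    let g : (F ⊗[k] D) →ₐ[F] Matrix (Fin m) (Fin m) N :=
      Algebra.TensorProduct.lift (Algebra.ofId F _) f fun x y => Algebra.commutes x (f y)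
    let γ := ((mulVecAlgHom F N m).comp g).comp e.symm.toAlgHom
    obtain ⟨W₁, _, _, _, γ₁, -, -, hW₁⟩ := exists_corner γ (Algebra.ofId F _)
      fun x y => (Algebra.commutes y (γ x)).symm
    obtain ⟨l, hl⟩ := finrank_dvd_of_algHom γ₁
    rw [finrank_pi_fintype, Finset.sum_const, Finset.card_univ, Fintype.card_fin, hFN, hl,
      smul_eq_mul] at hW₁
    have h4 : finrank F B ∣ (p ^ a) ^ 2 := by
      have : r ^ 2 * finrank F B * (finrank F B * l ^ 2) = r ^ 2 * finrank F B * (p ^ a) ^ 2 := by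
        rw [hr]
        nth_rewrite 2 [hm]
        rw [← mul_pow, hW₁, ← hr]
        ring
      exact ⟨l ^ 2, (Nat.eq_of_mul_eq_mul_left (by positivity) this).symm⟩
    exact Odd.of_dvd_nat (((hp.odd_of_ne_two hp2).pow).pow) h4
  -- The commuting actions of `D` descend to commuting actions of `B` on a space of dimension `dim
  -- B` (take two corners). So `B` has an involution of the first kind, and its odd dimension forces
  -- `B = F`.
  have hB : finrank F B = 1 := by
    let ext : (D →ₐ[k] Module.End k W) → (F ⊗[k] D) →ₐ[F] Module.End F (F ⊗[k] W) := fun γ =>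
      Algebra.TensorProduct.lift (Algebra.ofId F _)
        ((Module.End.baseChangeHom k F W).comp γ) fun x y => Algebra.commutes x _
    have hext : ∀ x y, Commute (ext α x) (ext β y) := by
      intro x y
      induction x with
      | zero => simp
      | add x x' hx hx' => rw [map_add]; exact hx.add_left hx'
      | tmul a d =>
        induction y with
        | zero => simp
        | add y y' hy hy' => rw [map_add]; exact hy.add_right hy'
        | tmul a' d' =>
          have h := (hc d d').map (Module.End.baseChangeHom k F W)
          simp only [ext]
          exact (show Commute _ _ from Algebra.commutes a _).mul_left
            ((show Commute _ _ from (Algebra.commutes a' _).symm).mul_right h)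
    obtain ⟨W₁, _, _, _, α₁, β₁, h1, hW₁⟩ := exists_corner ((ext α).comp e.symm.toAlgHom)
      ((ext β).comp e.symm.toAlgHom) fun x y => hext _ _
    have h1' : ∀ x y, Commute (β₁ x) (α₁ y) := fun x y => (h1 y x).symm
    obtain ⟨W₂, _, _, _, β₂, α₂, h2, hW₂⟩ := exists_corner β₁ α₁ h1'
    obtain ⟨σ, hσ⟩ := exists_involution_of_commute β₂ α₂ h2 (by
      rw [finrank_baseChange, hW, hW₂, ← hr] at hW₁
      have : r ^ 2 * finrank F W₂ = r ^ 2 * finrank F B := by rw [hW₁]; ring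
      exact Nat.eq_of_mul_eq_mul_left (by positivity) this)
    exact finrank_eq_one_of_odd h2F σ hσ hodd
  rw [hB, mul_one] at hr
  let : Algebra k B := Algebra.compHom B (algebraMap k F)
  have : IsScalarTower k F B := IsScalarTower.of_algebraMap_eq fun _ => rfl
  have : FiniteDimensional k B := FiniteDimensional.trans k F B
  -- Now `F` splits `D`, so `D` acts on `F ^ r` and `r² = dim D` divides `r [F : k]`. Hence `r`
  -- divides `[F : k]`, which is prime to `p`.
  let γ : D →ₐ[k] Module.End k (Fin r → B) := (mulVecAlgHom k B r).comp
    ((e.toAlgHom.restrictScalars k).comp Algebra.TensorProduct.includeRight)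
  have h := finrank_dvd_of_algHom γ
  rw [finrank_pi_fintype, Finset.sum_const, Finset.card_univ, Fintype.card_fin,
    ← finrank_mul_finrank k F B, hB, mul_one, ← hr, sq, smul_eq_mul] at h
  intro hpd
  rw [← hr] at hpd
  exact hkF ((hp.dvd_of_dvd_pow hpd).trans (Nat.dvd_of_mul_dvd_mul_left hrpos h))

/-- A split tensor square gives two commuting representations. -/
theorem exists_commute_of_isSplit.{v} {k : Type v} {D : Type*} [Field k] [DivisionRing D]
    [Algebra k D] [FiniteDimensional k D] (h : IsSplit k (D ⊗[k] D)) :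
    ∃ (W : Type v) (_ : AddCommGroup W) (_ : Module k W) (_ : FiniteDimensional k W)
      (α β : D →ₐ[k] Module.End k W), (∀ x y, Commute (α x) (β y)) ∧ finrank k W = finrank k D := by
  obtain ⟨m, -, ⟨e⟩⟩ := h
  have hm : m = finrank k D := by
    have := e.toLinearEquiv.finrank_eq
    rw [finrank_tensorProduct, finrank_matrix] at this
    simp only [Fintype.card_fin, finrank_self, mul_one] at this
    exact (Nat.mul_self_inj.1 this).symm
  refine ⟨Fin m → k, inferInstance, inferInstance, inferInstance,
    ((mulVecAlgHom k k m).comp e.toAlgHom).comp Algebra.TensorProduct.includeLeft,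
    ((mulVecAlgHom k k m).comp e.toAlgHom).comp Algebra.TensorProduct.includeRight,
    fun x y => ?_, by simp [hm]⟩
  have h : Commute (x ⊗ₜ[k] (1 : D)) ((1 : D) ⊗ₜ[k] y) := by
    simp [Commute, SemiconjBy]
  exact h.map ((mulVecAlgHom k k m).comp e.toAlgHom)

/-! ### Wedderburn's factorization of minimal polynomials -/

section Wedderburn

open Polynomial

variable {D : Type*} [DivisionRing D]

theorem exists_eq_mul_X_sub_C_add (x : D) (p : D[X]) :
    ∃ g : D[X], p = g * (X - C x) + C (p.eval x) := by
  induction p using Polynomial.induction_on' with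
  | add p q hp hq =>
    obtain ⟨g, hg⟩ := hp
    obtain ⟨g', hg'⟩ := hq
    refine ⟨g + g', ?_⟩
    nth_rewrite 1 [hg, hg']
    rw [eval_add, C_add, add_mul]
    abel
  | monomial n a =>
    induction n generalizing a with
    | zero => exact ⟨0, by simp⟩
    | succ n ih =>
      obtain ⟨g, hg⟩ := ih (a * x)
      refine ⟨monomial n a + g, ?_⟩
      have h1 : (monomial (n + 1) a : D[X]) = monomial n a * (X - C x) + monomial n (a * x) := by
        rw [mul_sub, monomial_mul_X, monomial_mul_C, sub_add_cancel]
      have h2 : (monomial (n + 1) a : D[X]).eval x = (monomial n (a * x) : D[X]).eval x := by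
        rw [eval_monomial, eval_monomial, pow_succ', mul_assoc]
      rw [h2, add_mul, add_assoc, ← hg, h1]

/-- Evaluation with coefficients on the left is not multiplicative: moving `q(x)` past the powers of
`x` replaces `x` by its conjugate under `q(x)`. -/
theorem eval_mul_of_ne_zero (g q : D[X]) {x : D} (h : q.eval x ≠ 0) :
    (g * q).eval x = g.eval (q.eval x * x * (q.eval x)⁻¹) * q.eval x := by
  induction g using Polynomial.induction_on' with
  | add p p' hp hp' => rw [add_mul, eval_add, eval_add, add_mul, hp, hp']
  | monomial n a =>
    have hs : SemiconjBy (q.eval x) x (q.eval x * x * (q.eval x)⁻¹) := by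
      rw [SemiconjBy, inv_mul_cancel_right₀ h]
    rw [eval_monomial, mul_assoc, ← (hs.pow_right n).eq, ← C_mul_X_pow_eq_monomial, mul_assoc,
      X_pow_mul, eval_C_mul, eval_mul_X_pow]

theorem monic_prod_X_sub_C (l : List D) :
    (l.map fun z => X - C z).prod.Monic ∧
      (l.map fun z => X - C z).prod.natDegree = l.length ∧
    (l.map fun z => X - C z).prod.nextCoeff = - l.sum := by
  induction l with
  | nil => simp [nextCoeff]
  | cons z l ih =>
    obtain ⟨h1, h2, h3⟩ := ih
    simp only [List.map_cons, List.prod_cons, List.length_cons, List.sum_cons]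
    refine ⟨(monic_X_sub_C z).mul h1, ?_, ?_⟩
    · rw [(monic_X_sub_C z).natDegree_mul h1, h2, natDegree_X_sub_C, add_comm]
    · rw [(monic_X_sub_C z).nextCoeff_mul h1, h3, nextCoeff_X_sub_C, neg_add]

variable {k : Type*} [Field k] [Algebra k D] [Algebra.IsCentral k D]

/-- A monic polynomial that vanishes at all conjugates of `y` has degree at least that of `y`. -/
theorem natDegree_minpoly_le (y : D) (q : D[X]) (hq : q.Monic)
    (hy : ∀ u : D, u ≠ 0 → q.eval (u * y * u⁻¹) = 0) :
    (minpoly k y).natDegree ≤ q.natDegree := by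
  classical
  let P : ℕ → Prop := fun n => ∃ q : D[X], q.Monic ∧ q.natDegree = n ∧
    ∀ u : D, u ≠ 0 → q.eval (u * y * u⁻¹) = 0
  have hP : ∃ n, P n := ⟨_, q, hq, rfl, hy⟩
  obtain ⟨q₀, hm, hd, hv⟩ := Nat.find_spec hP
  have hmin : ∀ r : D[X], r.degree < q₀.degree → (∀ u : D, u ≠ 0 → r.eval (u * y * u⁻¹) = 0) →
      r = 0 := by
    intro r hr hrv
    by_contra hr0
    have hlc : r.leadingCoeff ≠ 0 := leadingCoeff_ne_zero.2 hr0
    have hdeg : (C r.leadingCoeff⁻¹ * r).natDegree = r.natDegree :=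
      natDegree_C_mul (inv_ne_zero hlc)
    refine Nat.find_min hP (m := r.natDegree) ?_ ⟨C r.leadingCoeff⁻¹ * r, ?_, hdeg, fun u hu => ?_⟩
    · rw [← hd]
      exact natDegree_lt_natDegree hr0 hr
    · rw [Monic, leadingCoeff_mul, leadingCoeff_C, inv_mul_cancel₀ hlc]
    · rw [eval_C_mul, hrv u hu, mul_zero]
  -- Conjugating the coefficients of `q₀` by `d` gives another monic polynomial that vanishes on the
  -- conjugacy class; the difference has lower degree, so it is zero by minimality.
  have hcentral : ∀ d : D, ∀ i, d * q₀.coeff i = q₀.coeff i * d := by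
    intro d i
    by_cases hd0 : d = 0
    · simp [hd0]
    let φ : D →+* D :=
      { toFun := fun x => d * x * d⁻¹
        map_one' := by simp [hd0]
        map_mul' := fun x y => by simp [mul_assoc, hd0]
        map_zero' := by simp
        map_add' := fun x y => by simp [mul_add, add_mul] }
    have h0 : q₀.map φ - q₀ = 0 := by
      refine hmin _ ?_ fun u hu => ?_
      · have h1 : (q₀.map φ).degree = q₀.degree := degree_map q₀ φ
        rw [← h1]
        refine degree_sub_lt_left h1 ?_ ?_
        · exact (hm.map φ).ne_zero
        · rw [(hm.map φ).leadingCoeff, hm.leadingCoeff]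
      · have h1 : u * y * u⁻¹ = φ ((d⁻¹ * u) * y * (d⁻¹ * u)⁻¹) := by
          simp [φ, mul_assoc, hd0]
        rw [eval_sub, hv u hu, sub_zero, h1, eval_map, eval₂_at_apply,
          hv _ (mul_ne_zero (inv_ne_zero hd0) hu), map_zero]
    have h1 := congrArg (fun p => coeff p i) (sub_eq_zero.1 h0)
    simp only [coeff_map] at h1
    change d * q₀.coeff i * d⁻¹ = _ at h1
    rwa [mul_inv_eq_iff_eq_mul₀ hd0] at h1
  have hl : q₀ ∈ lifts (algebraMap k D) := by
    rw [lifts_iff_coeff_lifts]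
    intro i
    obtain ⟨a, ha⟩ := (Algebra.IsCentral.mem_center_iff k).1
      (Subalgebra.mem_center_iff.2 fun d => hcentral d i)
    exact ⟨a, ha.symm⟩
  obtain ⟨p₀, rfl⟩ := (mem_lifts _).1 hl
  have hp0 : aeval y p₀ = 0 := by
    have := hv 1 one_ne_zero
    rw [one_mul, inv_one, mul_one] at this
    rwa [aeval_def, eval₂_eq_eval_map]
  have hne : p₀ ≠ 0 := fun h => hm.ne_zero (by simp [h])
  calc (minpoly k y).natDegree ≤ p₀.natDegree := natDegree_le_of_dvd (minpoly.dvd k y hp0) hne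
    _ = _ := by rw [← natDegree_map (algebraMap k D), hd]
    _ ≤ q.natDegree := Nat.find_min' hP ⟨q, hq, rfl, hy⟩

variable [FiniteDimensional k D]

/-- Wedderburn: the minimal polynomial is a product of linear factors at conjugates. -/
theorem exists_minpoly_eq_prod (y : D) :
    ∃ l : List D, (∀ z ∈ l, ∃ u : D, u ≠ 0 ∧ z = u * y * u⁻¹) ∧
      (minpoly k y).map (algebraMap k D) = (l.map fun z => X - C z).prod := by
  classical
  set f := (minpoly k y).map (algebraMap k D) with hf
  have hfm : f.Monic := (minpoly.monic (Algebra.IsIntegral.isIntegral y)).map _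
  have hfv : ∀ u : D, u ≠ 0 → f.eval (u * y * u⁻¹) = 0 := by
    intro u hu
    let φ : D →ₐ[k] D := AlgHom.ofLinearMap
      (LinearMap.mulRight k u⁻¹ ∘ₗ LinearMap.mulLeft k u) (by simp [hu]) (by simp [mul_assoc, hu])
    have : u * y * u⁻¹ = φ y := rfl
    rw [hf, ← eval₂_eq_eval_map, ← aeval_def, this, aeval_algHom_apply, minpoly.aeval, map_zero]
  have hprod := monic_prod_X_sub_C (D := D)
  -- Take a longest product of linear factors at conjugates of `y` that divides `f` on the right. If
  -- it did not vanish on the whole class, `eval_mul_of_ne_zero` would give a conjugate root of the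
  -- cofactor and a longer product. So its degree is that of `f`.
  let Q : ℕ → Prop := fun n => ∃ l : List D, l.length = n ∧
    (∀ z ∈ l, ∃ u : D, u ≠ 0 ∧ z = u * y * u⁻¹) ∧ ∃ g, f = g * (l.map fun z => X - C z).prod
  have hbound : ∀ n, Q n → n ≤ f.natDegree := by
    rintro n ⟨l, rfl, -, g, hg⟩
    have hg0 : g ≠ 0 := fun h => hfm.ne_zero (by rw [hg, h, zero_mul])
    rw [hg, natDegree_mul hg0 (hprod l).1.ne_zero, (hprod l).2.1]
    exact Nat.le_add_left _ _
  have hQ : Q (Nat.findGreatest Q f.natDegree) :=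
    Nat.findGreatest_spec (P := Q) (Nat.zero_le _) ⟨[], rfl, by simp, f, by simp⟩
  obtain ⟨l, hlen, hl, g, hg⟩ := hQ
  set q := (l.map fun z => X - C z).prod with hq
  have hqv : ∀ u : D, u ≠ 0 → q.eval (u * y * u⁻¹) = 0 := by
    intro u hu
    by_contra h0
    have h1 := hfv u hu
    rw [hg, eval_mul_of_ne_zero g q h0] at h1
    have h2 := (mul_eq_zero.1 h1).resolve_right h0
    set c := q.eval (u * y * u⁻¹) with hc
    obtain ⟨g', hg'⟩ := exists_eq_mul_X_sub_C_add (c * (u * y * u⁻¹) * c⁻¹) g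
    rw [h2, C_0, add_zero] at hg'
    have h3 : Q (l.length + 1) := by
      refine ⟨(c * (u * y * u⁻¹) * c⁻¹) :: l, rfl, fun z hz => ?_, g', ?_⟩
      · rcases List.mem_cons.1 hz with rfl | hz
        · exact ⟨c * u, mul_ne_zero h0 hu, by simp [mul_assoc]⟩
        · exact hl z hz
      · rw [List.map_cons, List.prod_cons, ← mul_assoc, ← hg', hg]
    have h4 := Nat.le_findGreatest (P := Q) (hbound _ h3) h3
    omega
  have h1 := natDegree_minpoly_le (k := k) y q (hprod l).1 hqv
  have hg0 : g ≠ 0 := fun h => hfm.ne_zero (by rw [hg, h, zero_mul])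
  have h2 : f.natDegree = g.natDegree + q.natDegree := by
    rw [hg, natDegree_mul hg0 (hprod l).1.ne_zero]
  rw [← natDegree_map (algebraMap k D), ← hf] at h1
  have h3 : g.natDegree = 0 := by omega
  have hgm : g.Monic := (hprod l).1.of_mul_monic_right (hg ▸ hfm)
  rw [(show g = 1 from hgm.natDegree_eq_zero.1 h3), one_mul] at hg
  exact ⟨l, hl, hg⟩

/-- Compare the second highest coefficients in Wedderburn's factorization. This plays the role of a
trace written as a sum of conjugates. -/
theorem exists_sum_conj_eq (y : D) :
    ∃ l : List D, (∀ z ∈ l, ∃ u : D, u ≠ 0 ∧ z = u * y * u⁻¹) ∧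
      l.length = (minpoly k y).natDegree ∧ ∃ a : k, algebraMap k D a = l.sum := by
  obtain ⟨l, hl, h⟩ := exists_minpoly_eq_prod (k := k) y
  obtain ⟨h1, h2, h3⟩ := monic_prod_X_sub_C l
  have hinj := (algebraMap k D).injective
  refine ⟨l, hl, ?_, -(minpoly k y).nextCoeff, ?_⟩
  · rw [← h2, ← h, natDegree_map]
  · rw [map_neg, ← nextCoeff_map hinj, h, h3, neg_neg]

end Wedderburn

/-! ### Diagonal forms and scaling -/

section Diagonal

variable {E : Type*} [DivisionRing E]

theorem Involution.map_smul (σ : Involution E) (ε : ℤˣ) (x : E) : σ (ε • x) = ε • σ x := by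
  have hneg : σ (-x) = -σ x := by
    have := σ.map_add' x (-x)
    rw [add_neg_cancel, σ.map_zero] at this
    exact (neg_eq_of_add_eq_zero_right this.symm).symm
  rcases Int.units_eq_one_or ε with rfl | rfl
  · simp
  · simpa using hneg

theorem Involution.map_neg (σ : Involution E) (x : E) : σ (-x) = -σ x := by
  simpa using σ.map_smul (-1) x

theorem Involution.map_inv (σ : Involution E) (x : E) : σ x⁻¹ = (σ x)⁻¹ := by
  by_cases hx : x = 0
  · simp [hx, σ.map_zero]
  · refine eq_inv_of_mul_eq_one_left ?_
    rw [← σ.map_mul', mul_inv_cancel₀ hx, σ.map_one]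

theorem Involution.map_sum (σ : Involution E) {ι : Type*} (s : Finset ι) (f : ι → E) :
    σ (∑ i ∈ s, f i) = ∑ i ∈ s, σ (f i) :=
  _root_.map_sum (AddMonoidHom.mk' σ σ.map_add') f s

/-- The diagonal form with entries `a` is an anisotropic `ε`-hermitian form over `(E, σ)`. -/
structure IsAnisoDiag (σ : Involution E) (ε : ℤˣ) {ι : Type*} [Fintype ι] (a : ι → E) : Prop where
  symm : ∀ i, σ (a i) = ε • a i
  aniso : ∀ x : ι → E, ∑ i, σ (x i) * a i * x i = 0 → x = 0

theorem finrank_mulOpposite_self : finrank Eᵐᵒᵖ E = 1 := by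
  refine finrank_eq_one (1 : E) one_ne_zero fun w => ⟨MulOpposite.op w, by simp⟩

instance finite_mulOpposite_self : Module.Finite Eᵐᵒᵖ E :=
  Module.finite_of_finrank_eq_succ finrank_mulOpposite_self

/-- An anisotropic hermitian form has an orthogonal basis. -/
theorem exists_orthogonal {σ : Involution E} {ε : ℤˣ} {V : Type*} [AddCommGroup V]
    [Module Eᵐᵒᵖ V] [Module.Finite Eᵐᵒᵖ V] {h : V → V → E} (hh : IsHermitianForm σ ε h)
    (ha : IsAnisotropic h) (n : ℕ) (W : Submodule Eᵐᵒᵖ V) (hW : finrank Eᵐᵒᵖ W = n) :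
    ∃ v : Fin n → V, (∀ i, v i ∈ W) ∧ (∀ i, v i ≠ 0) ∧ ∀ i j, i ≠ j → h (v i) (v j) = 0 := by
  induction n generalizing W with
  | zero => exact ⟨Fin.elim0, fun i => i.elim0, fun i => i.elim0, fun i => i.elim0⟩
  | succ n ih =>
    have : Nontrivial W := nontrivial_of_finrank_pos (R := Eᵐᵒᵖ) (by omega)
    obtain ⟨⟨v, hv⟩, hv0⟩ := exists_ne (0 : W)
    have hv0 : v ≠ 0 := fun h => hv0 (Subtype.ext h)
    let φ : V →ₗ[Eᵐᵒᵖ] E :=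
      { toFun := h v
        map_add' := hh.add_right v
        map_smul' := fun c x => by
          have := hh.smul_smul 1 c.unop v x
          simpa [σ.map_one] using this }
    let ψ := φ.domRestrict W
    -- As `h v v ≠ 0`, the functional `h v` is onto, and its kernel in `W` is an orthogonal
    -- complement of `v` of dimension one less.
    have hψ : LinearMap.range ψ = ⊤ := by
      rw [LinearMap.range_eq_top]
      intro y
      have hvv : h v v ≠ 0 := fun h0 => hv0 (ha v h0)
      refine ⟨MulOpposite.op ((h v v)⁻¹ * y) • ⟨v, hv⟩, ?_⟩
      rw [LinearMap.map_smul]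
      change h v v * ((h v v)⁻¹ * y) = y
      rw [mul_inv_cancel_left₀ hvv]
    have hker := LinearMap.finrank_range_add_finrank_ker ψ
    rw [hψ, finrank_top, finrank_mulOpposite_self, hW] at hker
    let W' := (LinearMap.ker ψ).map W.subtype
    have hW' : finrank Eᵐᵒᵖ W' = n := by
      rw [Submodule.finrank_map_subtype_eq]
      omega
    obtain ⟨w, hw, hw0, hwo⟩ := ih W' hW'
    have hwW : ∀ i, w i ∈ W ∧ h v (w i) = 0 := fun i => by
      obtain ⟨⟨x, hx⟩, hx', hxw⟩ := hw i
      rw [← hxw]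
      exact ⟨hx, hx'⟩
    refine ⟨Fin.cons v w, fun i => ?_, fun i => ?_, fun i j => ?_⟩
    · refine Fin.cases hv (fun i => ?_) i
      exact (hwW i).1
    · refine Fin.cases hv0 (fun i => ?_) i
      exact hw0 i
    · refine Fin.cases ?_ (fun i => ?_) i <;> refine Fin.cases ?_ (fun j => ?_) j
      · simp
      · intro _
        exact (hwW j).2
      · intro _
        simp only [Fin.cons_succ, Fin.cons_zero]
        rw [hh.symm v, (hwW i).2, σ.map_zero, smul_zero]
      · intro hij
        exact hwo i j fun h => hij (by rw [h])

/-- The `u`-invariant can be computed with diagonal forms. -/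
theorem uInvariant_eq_sSup (σ : Involution E) (ε : ℤˣ) :
    uInvariant σ ε = sSup {m : ℕ∞ | ∃ (n : ℕ) (a : Fin n → E), IsAnisoDiag σ ε a ∧ m = n} := by
  unfold uInvariant
  congr 1
  ext m
  constructor
  · rintro ⟨V, _, _, h, _, hh, -, ha, rfl⟩
    obtain ⟨v, -, hv0, hvo⟩ := exists_orthogonal hh ha _ ⊤ (finrank_top Eᵐᵒᵖ V)
    have h0r : ∀ x, h x 0 = 0 := fun x => by
      have := hh.add_right x 0 0
      rwa [add_zero, left_eq_add] at this
    have h0l : ∀ x, h 0 x = 0 := fun x => by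
      have := hh.add_left 0 0 x
      rwa [add_zero, left_eq_add] at this
    have hsr : ∀ x (f : Fin (finrank Eᵐᵒᵖ V) → V), h x (∑ i, f i) = ∑ i, h x (f i) := fun x f =>
      map_sum (⟨⟨h x, h0r x⟩, hh.add_right x⟩ : V →+ E) f Finset.univ
    have hsl : ∀ y (f : Fin (finrank Eᵐᵒᵖ V) → V), h (∑ i, f i) y = ∑ i, h (f i) y := fun y f =>
      map_sum (⟨⟨fun x => h x y, h0l y⟩, fun x x' => hh.add_left x x' y⟩ : V →+ E) f Finset.univ
    refine ⟨_, fun i => h (v i) (v i), ⟨fun i => ?_, fun x hx => ?_⟩, rfl⟩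
    · have := hh.symm (v i) (v i)
      nth_rewrite 2 [this]
      rw [smul_smul, Int.units_mul_self, one_smul]
    · have key : ∀ j, h (v j) (∑ i, MulOpposite.op (x i) • v i) = h (v j) (v j) * x j := by
        intro j
        rw [hsr, Finset.sum_eq_single j]
        · simpa [σ.map_one] using hh.smul_smul 1 (x j) (v j) (v j)
        · intro i _ hij
          simpa [σ.map_one, hvo j i hij.symm] using hh.smul_smul 1 (x i) (v j) (v i)
        · simp
      have h0 : ∑ i, MulOpposite.op (x i) • v i = 0 := by
        apply ha
        rw [hsl, ← hx]
        refine Finset.sum_congr rfl fun i _ => ?_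
        have := hh.smul_smul (x i) 1 (v i) (∑ i, MulOpposite.op (x i) • v i)
        rw [MulOpposite.op_one, one_smul, mul_one, key] at this
        rw [this, mul_assoc]
      ext j
      have := key j
      rw [h0, h0r, eq_comm] at this
      exact (mul_eq_zero.1 this).resolve_left fun h => hv0 j (ha _ h)
  · rintro ⟨n, a, ha, rfl⟩
    have haniso : IsAnisotropic fun x y : Fin n → E => ∑ i, σ (x i) * a i * y i :=
      fun x hx => ha.aniso x hx
    refine ⟨Fin n → E, inferInstance, inferInstance, fun x y => ∑ i, σ (x i) * a i * y i,
      inferInstance, ⟨fun x x' y => ?_, fun x y y' => ?_, fun c d x y => ?_, fun x y => ?_⟩,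
      fun y hy => ?_, haniso, ?_⟩
    · simp [σ.map_add', add_mul, Finset.sum_add_distrib]
    · simp [mul_add, Finset.sum_add_distrib]
    · simp [σ.map_mul', Finset.mul_sum, Finset.sum_mul, mul_assoc]
    · simp only [σ.map_sum, σ.map_mul', σ.invol', ha.symm, Finset.smul_sum, mul_assoc,
        smul_mul_assoc, mul_smul_comm, smul_smul, Int.units_mul_self, one_smul]
    · exact haniso y (hy y)
    · rw [finrank_pi_fintype]
      simp [finrank_mulOpposite_self]

theorem IsAnisoDiag.comp {σ : Involution E} {ε : ℤˣ} {ι κ : Type*} [Fintype ι] [Fintype κ]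
    {a : ι → E} (ha : IsAnisoDiag σ ε a) {f : κ → ι} (hf : Function.Injective f) :
    IsAnisoDiag σ ε (a ∘ f) := by
  classical
  refine ⟨fun i => ha.symm _, fun x hx => ?_⟩
  have h := ha.aniso (fun i => if h : ∃ j, f j = i then x h.choose else 0) ?_
  · ext j
    have hj := congrFun h (f j)
    have hex : ∃ j', f j' = f j := ⟨j, rfl⟩
    rw [dif_pos hex, hf hex.choose_spec] at hj
    exact hj
  · refine Eq.trans (Eq.symm ?_) hx
    refine Finset.sum_of_injOn f hf.injOn (by simp) (fun i _ hi => ?_) fun j _ => ?_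
    · rw [dif_neg fun ⟨j, hj⟩ => hi ⟨j, by simp, hj⟩, mul_zero]
    · have hex : ∃ j', f j' = f j := ⟨j, rfl⟩
      rw [dif_pos hex, hf hex.choose_spec]
      rfl

theorem IsAnisoDiag.card_le {σ : Involution E} {ε : ℤˣ} {ι : Type*} [Fintype ι]
    {a : ι → E} (ha : IsAnisoDiag σ ε a) : (Fintype.card ι : ℕ∞) ≤ uInvariant σ ε := by
  rw [uInvariant_eq_sSup]
  exact le_sSup ⟨_, _, ha.comp (Fintype.equivFin ι).symm.injective, rfl⟩

theorem IsAnisoDiag.ne_zero {σ : Involution E} {ε : ℤˣ} {ι : Type*} [Fintype ι]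
    {a : ι → E} (ha : IsAnisoDiag σ ε a) (i : ι) : a i ≠ 0 := by
  intro h
  have := (ha.comp (f := fun _ : Unit => i) (fun _ _ _ => rfl)).aniso 1 (by simp [h])
  exact one_ne_zero (congrFun this ())

/-- Since `σ' x * c = c * σ x`, scaling the entries by `c` multiplies all values of the form by `c`,
so isotropic vectors do not change. -/
theorem IsAnisoDiag.scale {σ σ' : Involution E} {ε η : ℤˣ} {ι : Type*} [Fintype ι] {a : ι → E}
    (ha : IsAnisoDiag σ ε a) {c : E} (hc : c ≠ 0) (hc' : σ c = η • c)
    (h : ∀ x, σ' x = c * σ x * c⁻¹) : IsAnisoDiag σ' (η * ε) fun i => c * a i := by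
  refine ⟨fun i => ?_, fun x hx => ha.aniso x ?_⟩
  · rw [h, σ.map_mul', hc', ha.symm, mul_smul_comm, smul_mul_assoc, smul_smul, mul_smul_comm,
      smul_mul_assoc, mul_assoc, mul_inv_cancel_right₀ hc]
  · have : ∑ i, σ' (x i) * (c * a i) * x i = c * ∑ i, σ (x i) * a i * x i := by
      rw [Finset.mul_sum]
      refine Finset.sum_congr rfl fun i _ => ?_
      rw [h]
      simp [mul_assoc, hc]
    rw [this] at hx
    exact (mul_eq_zero.1 hx).resolve_left hc

theorem uInvariant_scale {σ σ' : Involution E} {η : ℤˣ} (ε : ℤˣ) {c : E} (hc : c ≠ 0)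
    (hc' : σ c = η • c) (h : ∀ x, σ' x = c * σ x * c⁻¹) :
    uInvariant σ' (η * ε) = uInvariant σ ε := by
  rw [uInvariant_eq_sSup, uInvariant_eq_sSup]
  congr 1
  ext m
  constructor
  · rintro ⟨n, a, ha, rfl⟩
    have h1 : σ' c⁻¹ = η • c⁻¹ := by
      rw [h, σ.map_inv, hc']
      rcases Int.units_eq_one_or η with rfl | rfl
      · simp [hc]
      · simp [hc, inv_neg]
    have h2 : ∀ x, σ x = c⁻¹ * σ' x * c⁻¹⁻¹ := fun x => by
      rw [h]
      simp [mul_assoc, hc]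
    have := ha.scale (inv_ne_zero hc) h1 h2
    rw [← mul_assoc, Int.units_mul_self, one_mul] at this
    exact ⟨n, _, this, rfl⟩
  · rintro ⟨n, a, ha, rfl⟩
    exact ⟨n, _, ha.scale hc hc' h, rfl⟩

end Diagonal

/-! ### Types of involutions and independence of the choice -/

section Types

variable {E : Type*} [DivisionRing E]

/-- The orthogonal involutions have type `1`, the symplectic ones type `-1`. -/
def Involution.HasType (σ : Involution E) (ζ : ℤˣ) : Prop :=
  ∃ (hσ : σ.IsFirstKind) (d : ℕ), finrank (Subring.center E) E = d ^ 2 ∧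
    2 * (finrank (Subring.center E) (σ.sym hσ) : ℤ) = d * (d + (ζ : ℤ))

theorem Involution.isOrthogonal_iff (σ : Involution E) : σ.IsOrthogonal ↔ σ.HasType 1 := by
  refine exists_congr fun hσ => exists_congr fun d => and_congr_right fun _ => ?_
  rw [Units.val_one]
  exact_mod_cast Iff.rfl

theorem Involution.isSymplectic_iff (σ : Involution E) : σ.IsSymplectic ↔ σ.HasType (-1) := by
  refine exists_congr fun hσ => exists_congr fun d => and_congr_right fun _ => ?_
  -- The subtraction `d - 1` of natural numbers truncates at `d = 0`, where both sides vanish.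
  rcases d with _ | d
  · simp
  · rw [Nat.add_sub_cancel, Units.val_neg, Units.val_one]
    push_cast
    rw [add_neg_cancel_right]
    exact_mod_cast Iff.rfl

/-- Encoding orthogonal and symplectic by signs, `u⁺` concerns the pairs in which `ε` is the type of
`σ`, and `u⁻` those in which it is the opposite. -/
theorem isUPlus_iff (n : ℕ∞) : IsUPlus E n ↔
    (∃ (σ : Involution E) (ε : ℤˣ), σ.HasType ε) ∧
      ∀ (σ : Involution E) (ε : ℤˣ), σ.HasType ε → uInvariant σ ε = n := by
  have : ∀ (σ : Involution E) (ε : ℤˣ),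
      (σ.IsOrthogonal ∧ ε = 1) ∨ (σ.IsSymplectic ∧ ε = -1) ↔ σ.HasType ε := by
    intro σ ε
    rw [σ.isOrthogonal_iff, σ.isSymplectic_iff]
    rcases Int.units_eq_one_or ε with rfl | rfl <;> simp
  simp only [IsUPlus, this]

theorem isUMinus_iff (n : ℕ∞) : IsUMinus E n ↔
    (∃ (σ : Involution E) (ε : ℤˣ), σ.HasType (-ε)) ∧
      ∀ (σ : Involution E) (ε : ℤˣ), σ.HasType (-ε) → uInvariant σ ε = n := by
  have : ∀ (σ : Involution E) (ε : ℤˣ),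
      (σ.IsOrthogonal ∧ ε = -1) ∨ (σ.IsSymplectic ∧ ε = 1) ↔ σ.HasType (-ε) := by
    intro σ ε
    rw [σ.isOrthogonal_iff, σ.isSymplectic_iff]
    rcases Int.units_eq_one_or ε with rfl | rfl <;> simp
  simp only [IsUMinus, this]

instance isCentral_center : Algebra.IsCentral (Subring.center E) E where
  out x hx := Algebra.mem_bot.2 ⟨⟨x, hx⟩, rfl⟩

theorem two_ne_zero_center (h2 : (2 : E) ≠ 0) : (2 : Subring.center E) ≠ 0 := fun h =>
  h2 (by
    have := congrArg (Subring.subtype (Subring.center E)) h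
    rwa [map_ofNat, map_zero] at this)

theorem Involution.IsFirstKind.algebraMap {σ : Involution E} (hσ : σ.IsFirstKind)
    (c : Subring.center E) : σ (algebraMap (Subring.center E) E c) = algebraMap _ E c :=
  hσ c c.2

theorem Involution.sym_eq_signSpace {σ : Involution E} (hσ : σ.IsFirstKind) :
    σ.sym hσ = signSpace (σ.toEnd hσ.algebraMap) 1 := by
  ext x
  rw [mem_signSpace, one_smul]
  rfl

theorem Involution.map_mem_center (σ : Involution E) {z : E} (hz : z ∈ Subring.center E) :
    σ z ∈ Subring.center E := by
  rw [Subring.mem_center_iff] at hz ⊢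
  intro g
  have := congrArg σ (hz (σ g))
  rw [σ.map_mul', σ.map_mul', σ.invol'] at this
  exact this.symm

theorem Involution.exists_skew_center {σ : Involution E} (hσ : ¬ σ.IsFirstKind) :
    ∃ l ∈ Subring.center E, l ≠ 0 ∧ σ l = -l := by
  unfold Involution.IsFirstKind at hσ
  push Not at hσ
  obtain ⟨z, hz, hne⟩ := hσ
  refine ⟨z - σ z, sub_mem hz (σ.map_mem_center hz), sub_ne_zero.2 (Ne.symm hne), ?_⟩
  rw [sub_eq_add_neg, σ.map_add', σ.map_neg, σ.invol']
  abel

/-- Let `l` be central with `σ l = -l`. Then `τ` fixes `l²`, so `τ l = ±l`, and `τ l = l` is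
excluded because `σ` and `τ` have the same fixed central elements. As `τ` fixes `z + σ z` and `(z -
σ z) l`, it agrees with `σ` at `z`. -/
theorem Involution.IsUnitary.eq_on_center (h2 : (2 : E) ≠ 0) {F : Type*} [Field F] [Algebra F E]
    {σ τ : Involution E} (hσ : σ.IsUnitary F) (hτ : τ.IsUnitary F) :
    ∀ z ∈ Subring.center E, σ z = τ z := by
  obtain ⟨l, hl, hl0, hσl⟩ := Involution.exists_skew_center hσ.1
  have hfix : ∀ z ∈ Subring.center E, σ z = z → τ z = z := fun z hz h =>
    (hτ.2 z hz).2 ((hσ.2 z hz).1 h)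
  have hlc : ∀ x, x * l = l * x := Subring.mem_center_iff.1 hl
  have hτl : τ l = -l := by
    have h1 : τ (l * l) = l * l := hfix _ (mul_mem hl hl) (by rw [σ.map_mul', hσl, neg_mul_neg])
    rw [τ.map_mul'] at h1
    have h3 : (τ l - l) * (τ l + l) = 0 := by
      rw [sub_mul, mul_add, mul_add, h1, hlc (τ l)]
      abel
    rcases mul_eq_zero.1 h3 with h | h
    · have := (hσ.2 l hl).2 ((hτ.2 l hl).1 (sub_eq_zero.1 h))
      rw [hσl] at this
      have h5 : 2 * l = 0 := by rw [two_mul]; nth_rewrite 1 [← this]; simp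
      exact absurd h5 (mul_ne_zero h2 hl0)
    · exact eq_neg_of_add_eq_zero_left h
  intro z hz
  have h1 : τ (z + σ z) = z + σ z := hfix _ (add_mem hz (σ.map_mem_center hz)) (by
    rw [σ.map_add', σ.invol', add_comm])
  have h3 : τ ((z - σ z) * l) = (z - σ z) * l :=
    hfix _ (mul_mem (sub_mem hz (σ.map_mem_center hz)) hl) (by
      rw [σ.map_mul', hσl, sub_eq_add_neg, σ.map_add', σ.map_neg, σ.invol', mul_add, add_mul, hlc]
      simp [hlc]
      abel)
  rw [τ.map_mul', hτl, neg_mul, ← hlc, ← neg_mul] at h3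
  have h4 := mul_right_cancel₀ hl0 h3
  rw [sub_eq_add_neg, τ.map_add', τ.map_neg] at h4
  rw [τ.map_add'] at h1
  have h5 : 2 * τ z = 2 * σ z := by
    have e1 : τ z + τ z = (τ z + τ (σ z)) - -(τ z + -τ (σ z)) := by abel
    rw [two_mul, two_mul, e1, h1, h4]
    abel
  exact (mul_left_cancel₀ h2 h5).symm

variable [FiniteDimensional (Subring.center E) E]

/-- The difference of the dimensions of symmetric and skew elements has square `dim E`. Its absolute
value is the degree and its sign the type. -/
theorem Involution.IsFirstKind.exists_hasType (h2 : (2 : E) ≠ 0) {σ : Involution E}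
    (hσ : σ.IsFirstKind) : ∃ ζ, σ.HasType ζ := by
  have h2' := two_ne_zero_center h2
  have h := sq_finrank_signSpace_sub h2' (σ.toEnd hσ.algebraMap) σ.invol' σ.map_mul'
  have hs := finrank_signSpace_add h2' (T := σ.toEnd hσ.algebraMap) σ.invol'
  rw [← Involution.sym_eq_signSpace hσ] at h hs
  set s := finrank (Subring.center E) (σ.sym hσ) with hs'
  set t := finrank (Subring.center E) (signSpace (σ.toEnd hσ.algebraMap) (-1))
  rcases le_total (t : ℤ) s with hst | hst
  · obtain ⟨d, hd⟩ := Int.eq_ofNat_of_zero_le (sub_nonneg.2 hst)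
    refine ⟨1, hσ, d, ?_, ?_⟩
    · rw [hd] at h
      exact_mod_cast h.symm
    · rw [Units.val_one, ← hs']
      zify at hs
      rw [← hd]
      linear_combination hs - h
  · obtain ⟨d, hd⟩ := Int.eq_ofNat_of_zero_le (sub_nonneg.2 hst)
    refine ⟨-1, hσ, d, ?_, ?_⟩
    · have : ((d : ℤ)) ^ 2 = (finrank (Subring.center E) E : ℤ) := by rw [← h, ← hd]; ring
      exact_mod_cast this.symm
    · rw [Units.val_neg, Units.val_one, ← hs']
      zify at hs
      rw [← hd]
      linear_combination hs - h

theorem Involution.HasType.unique {σ : Involution E} {ζ ζ' : ℤˣ} (h : σ.HasType ζ)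
    (h' : σ.HasType ζ') : ζ = ζ' := by
  obtain ⟨hσ, d, hd, hs⟩ := h
  obtain ⟨_, d', hd', hs'⟩ := h'
  have hdd : d = d' := by
    rw [hd] at hd'
    exact Nat.pow_left_injective two_ne_zero hd'
  subst hdd
  have hd0 : (d : ℤ) ≠ 0 := by
    rintro h0
    have : 0 < finrank (Subring.center E) E := finrank_pos
    simp_all
  rw [hs] at hs'
  have := mul_left_cancel₀ hd0 hs'
  exact Units.ext (by linarith)

/-- Left multiplication by `c` carries the `η`-eigenspace of `σ` onto the symmetric elements of `τ`.
-/
theorem Involution.HasType.scale (h2 : (2 : E) ≠ 0) {σ τ : Involution E} {ζ η : ℤˣ}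
    (h : σ.HasType ζ) (hτ : τ.IsFirstKind) {c : E} (hc : c ≠ 0) (hc' : σ c = η • c)
    (hcτ : ∀ x, τ x = c * σ x * c⁻¹) : τ.HasType (η * ζ) := by
  obtain ⟨hσ, d, hd, hs⟩ := h
  refine ⟨hτ, d, hd, ?_⟩
  have hsum := finrank_signSpace_add (two_ne_zero_center h2) (T := σ.toEnd hσ.algebraMap) σ.invol'
  rw [Involution.sym_eq_signSpace] at hs
  have key : finrank (Subring.center E) (τ.sym hτ) =
      finrank (Subring.center E) (signSpace (σ.toEnd hσ.algebraMap) η) := by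
    let f : E ≃ₗ[Subring.center E] E := LinearEquiv.ofBijective
      (LinearMap.mulLeft (Subring.center E) c) ⟨mul_right_injective₀ hc, fun y =>
        ⟨c⁻¹ * y, by simp [hc]⟩⟩
    have hf : ∀ x, f x = c * x := fun _ => rfl
    have : τ.sym hτ = (signSpace (σ.toEnd hσ.algebraMap) η).map f.toLinearMap := by
      ext x
      obtain ⟨y, rfl⟩ := f.surjective x
      have h1 : f y ∈ (signSpace (σ.toEnd hσ.algebraMap) η).map f.toLinearMap ↔ σ y = η • y := by
        constructor
        · rintro ⟨z, hz, hzy⟩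
          obtain rfl := f.injective hzy
          exact hz
        · exact fun h => ⟨y, h, rfl⟩
      rw [h1]
      change τ (c * y) = c * y ↔ _
      rw [hcτ, σ.map_mul', hc', mul_smul_comm, mul_smul_comm, smul_mul_assoc, mul_assoc,
        mul_inv_cancel_right₀ hc, ← mul_smul_comm, mul_right_inj' hc]
      constructor
      · intro h
        rw [← h, smul_smul, Int.units_mul_self, one_smul, h]
      · intro h
        rw [h, smul_smul, Int.units_mul_self, one_smul]
    rw [this, LinearEquiv.finrank_map_eq]
  rw [key]
  rcases Int.units_eq_one_or η with rfl | rfl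
  · rw [hs, one_mul]
  · rw [hd] at hsum
    zify at hsum
    rw [Units.val_mul, Units.val_neg, Units.val_one]
    linear_combination 2 * hsum - hs

/-- Two involutions with the same restriction to the center differ by an inner automorphism. -/
theorem exists_conj_of_eq_on_center {σ τ : Involution E}
    (h : ∀ z ∈ Subring.center E, σ z = τ z) :
    ∃ (c : E) (η : ℤˣ), c ≠ 0 ∧ σ c = η • c ∧ ∀ x, τ x = c * σ x * c⁻¹ := by
  let α : E →ₐ[Subring.center E] E := AlgHom.ofLinearMap
    { toFun := fun x => τ (σ x)
      map_add' := fun x y => by rw [σ.map_add', τ.map_add']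
      map_smul' := fun z x => by
        have hz : ∀ y : E, z • y = z * y := fun _ => rfl
        rw [hz, σ.map_mul', τ.map_mul', h z z.2, τ.invol']
        rfl }
    (by change τ (σ 1) = 1; rw [σ.map_one, τ.map_one])
    (fun x y => by change τ (σ (x * y)) = τ (σ x) * τ (σ y); rw [σ.map_mul', τ.map_mul'])
  obtain ⟨a, ha0, ha⟩ := exists_intertwiner α
  have h1 : ∀ x, τ x * a = a * σ x := fun x => by
    have := ha (σ x)
    change τ (σ (σ x)) * a = _ at this
    rwa [σ.invol'] at this
  have h2 : ∀ x, τ x * σ a = σ a * σ x := fun x => by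
    have := congrArg σ (h1 (τ x))
    rw [τ.invol', σ.map_mul', σ.map_mul', σ.invol'] at this
    exact this.symm
  -- Both `a` and `σ a` intertwine `σ` and `τ`. Either `a` is skew, or `a + σ a` is a nonzero
  -- symmetric intertwiner.
  by_cases h0 : a + σ a = 0
  · refine ⟨a, -1, ha0, ?_, fun x => ?_⟩
    · rw [Units.neg_smul, one_smul]
      exact eq_neg_of_add_eq_zero_right h0
    · rw [← h1, mul_inv_cancel_right₀ ha0]
  · refine ⟨a + σ a, 1, h0, ?_, fun x => ?_⟩
    · rw [one_smul, σ.map_add', σ.invol', add_comm]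
    · rw [add_mul, ← h1, ← h2, ← mul_add, mul_inv_cancel_right₀ h0]

/-- Twisting `σ` by `c` with `σ c = η c` multiplies the type and the sign of the forms by the same
`η`; only the product `κ` of type and sign matters. -/
theorem uInvariant_eq_of_hasType (h2 : (2 : E) ≠ 0) {σ τ : Involution E} {ζ ξ : ℤˣ}
    (hσ : σ.HasType ζ) (hτ : τ.HasType ξ) (κ : ℤˣ) :
    uInvariant τ (κ * ξ) = uInvariant σ (κ * ζ) := by
  obtain ⟨c, η, hc, hc', h⟩ := exists_conj_of_eq_on_center (σ := σ) (τ := τ)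
    fun z hz => by rw [hσ.1 z hz, hτ.1 z hz]
  rw [hτ.unique (hσ.scale h2 hτ.1 hc hc' h), ← uInvariant_scale _ hc hc' h]
  congr 1
  exact mul_left_comm _ _ _

theorem isUPlus_of_hasType (h2 : (2 : E) ≠ 0) {σ : Involution E} {ζ : ℤˣ} (hσ : σ.HasType ζ) :
    IsUPlus E (uInvariant σ ζ) :=
  (isUPlus_iff _).2 ⟨⟨σ, ζ, hσ⟩, fun τ ξ hτ => by
    simpa using uInvariant_eq_of_hasType h2 hσ hτ 1⟩

theorem isUMinus_of_hasType (h2 : (2 : E) ≠ 0) {σ : Involution E} {ζ : ℤˣ} (hσ : σ.HasType ζ) :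
    IsUMinus E (uInvariant σ (-ζ)) :=
  (isUMinus_iff _).2 ⟨⟨σ, -ζ, by rwa [neg_neg]⟩, fun τ ξ hτ => by
    simpa using uInvariant_eq_of_hasType h2 hσ hτ (-1)⟩

theorem isUZero_of_isUnitary (h2 : (2 : E) ≠ 0) (F : Type*) [Field F] [Algebra F E]
    {σ : Involution E} (hσ : σ.IsUnitary F) (ε : ℤˣ) : IsUZero F E (uInvariant σ ε) := by
  obtain ⟨l, hl, hl0, hσl⟩ := Involution.exists_skew_center hσ.1
  have hlc : ∀ x, x * l = l * x := Subring.mem_center_iff.1 hl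
  have hsign : ∀ ε', uInvariant σ ε' = uInvariant σ ε := by
    -- Scaling by the central skew element `l` reverses the sign of a form and leaves `σ` unchanged.
    have hneg : ∀ ε', uInvariant σ (-1 * ε') = uInvariant σ ε' := fun ε' =>
      uInvariant_scale ε' hl0 (by simpa using hσl)
        fun x => by rw [← hlc, mul_inv_cancel_right₀ hl0]
    intro ε'
    by_cases h : ε' = ε
    · rw [h]
    · rw [← hneg, neg_one_mul, ← Int.units_ne_iff_eq_neg.1 (Ne.symm h)]
  refine ⟨⟨σ, hσ⟩, fun τ ε' hτ => ?_⟩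
  obtain ⟨c, η, hc, hc', h⟩ := exists_conj_of_eq_on_center (hσ.eq_on_center h2 hτ)
  rw [← hsign (η * ε'), ← uInvariant_scale _ hc hc' h, ← mul_assoc, Int.units_mul_self, one_mul]

end Types

/-- Square roots of principal units. -/
theorem exists_sq_eq_one_add {L : Type*} [NormedField L] [IsUltrametricDist L] [CompleteSpace L]
    (h2 : ‖(2 : L)‖ = 1) {z : L} (hz : ‖z‖ < 1) : ∃ t : L, (1 + t) * (1 + t) = 1 + z ∧ ‖t‖ < 1 := by
  have h20 : (2 : L) ≠ 0 := fun h => by simp [h] at h2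
  -- Its fixed points solve `(1 + t)² = 1 + z`, and it contracts the ball of radius `‖z‖` by the
  -- factor `‖z‖`.
  let f : L → L := fun t => (z - t * t) / 2
  let S := Metric.closedBall (0 : L) ‖z‖
  have hS : ∀ t, t ∈ S ↔ ‖t‖ ≤ ‖z‖ := fun t => by simp [S]
  have hmaps : Set.MapsTo f S S := by
    intro t ht
    rw [hS] at ht ⊢
    rw [norm_div, h2, div_one, sub_eq_add_neg]
    refine (IsUltrametricDist.norm_add_le_max _ _).trans (max_le le_rfl ?_)
    rw [norm_neg, norm_mul]
    exact (mul_le_of_le_one_left (norm_nonneg _) (ht.trans hz.le)).trans ht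
  have hcontr : ContractingWith ⟨‖z‖, norm_nonneg z⟩ (hmaps.restrict f S S) := by
    refine ⟨hz, LipschitzWith.of_dist_le_mul fun s t => ?_⟩
    have hs := (hS _).1 s.2
    have ht := (hS _).1 t.2
    rw [Subtype.dist_eq, Subtype.dist_eq, dist_eq_norm, dist_eq_norm]
    change ‖(z - s * s) / 2 - (z - t * t) / 2‖ ≤ ‖z‖ * ‖(s : L) - t‖
    have : (z - s * s) / 2 - (z - t * t) / 2 = -((s + t) * ((s : L) - t)) / 2 := by ring
    rw [this, norm_div, h2, div_one, norm_neg, norm_mul]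
    gcongr
    exact (IsUltrametricDist.norm_add_le_max _ _).trans (max_le hs ht)
  obtain ⟨t, ht, hft, -⟩ := ContractingWith.exists_fixedPoint' (Metric.isClosed_closedBall.isComplete)
    hmaps hcontr (x := 0) (by simp [S]) (edist_ne_top _ _)
  refine ⟨t, ?_, ((hS t).1 ht).trans_lt hz⟩
  have h3 : (z - t * t) / 2 = t := hft
  rw [div_eq_iff h20] at h3
  linear_combination -h3

/-! ### Residues, induced involutions and Hensel's lemma -/

section Residue

variable (k : Type*) [Field k] {Γ₀ : Type*} [LinearOrderedCommGroupWithZero Γ₀]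
  [Valued k Γ₀] [CompleteSpace k] [(Valued.v : Valuation k Γ₀).IsRankOneDiscrete]
  (D : Type*) [DivisionRing D] [Algebra k D] [FiniteDimensional k D]

open Classical in
/-- The residue of an element of the valuation ring, extended by zero. -/
def res (x : D) : ResidueAlgebra k D :=
  if h : valD k D x ≤ 1 then residue k D ⟨x, h⟩ else 0

variable {k D}

theorem res_of_le {x : D} (h : valD k D x ≤ 1) : res k D x = residue k D ⟨x, h⟩ := dif_pos h

theorem res_add {x y : D} (hx : valD k D x ≤ 1) (hy : valD k D y ≤ 1) :
    res k D (x + y) = res k D x + res k D y := by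
  rw [res_of_le hx, res_of_le hy, res_of_le ((valD k D).map_add_le hx hy), ← map_add]
  rfl

theorem res_mul {x y : D} (hx : valD k D x ≤ 1) (hy : valD k D y ≤ 1) :
    res k D (x * y) = res k D x * res k D y := by
  have hxy : valD k D (x * y) ≤ 1 := by rw [map_mul]; exact mul_le_one' hx hy
  rw [res_of_le hx, res_of_le hy, res_of_le hxy, ← map_mul]
  rfl

theorem res_zero : res k D 0 = 0 := by
  rw [res_of_le (by simp)]
  exact map_zero (residue k D)

theorem res_one : res k D 1 = 1 := by
  rw [res_of_le (by simp)]
  exact map_one (residue k D)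

theorem res_neg {x : D} (hx : valD k D x ≤ 1) : res k D (-x) = -res k D x := by
  rw [res_of_le hx, res_of_le (by rwa [Valuation.map_neg]), ← map_neg]
  rfl

theorem res_sub {x y : D} (hx : valD k D x ≤ 1) (hy : valD k D y ≤ 1) :
    res k D (x - y) = res k D x - res k D y := by
  rw [sub_eq_add_neg, res_add hx (by rwa [Valuation.map_neg]), res_neg hy, sub_eq_add_neg]

theorem res_smul {x : D} (ε : ℤˣ) (hx : valD k D x ≤ 1) : res k D (ε • x) = ε • res k D x := by
  rcases Int.units_eq_one_or ε with rfl | rfl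
  · simp
  · simpa using res_neg hx

theorem valD_smul (ε : ℤˣ) (x : D) : valD k D (ε • x) = valD k D x := by
  rcases Int.units_eq_one_or ε with rfl | rfl <;> simp [Valuation.map_neg]

theorem res_eq_zero {x : D} (hx : valD k D x ≤ 1) : res k D x = 0 ↔ valD k D x < 1 := by
  rw [res_of_le hx, residue_eq_zero]

theorem res_ne_zero {x : D} (hx : valD k D x ≤ 1) : res k D x ≠ 0 ↔ valD k D x = 1 := by
  rw [Ne, res_eq_zero hx, not_lt]
  exact ⟨fun h => le_antisymm hx h, fun h => h.ge⟩

theorem res_eq_res {x y : D} (hx : valD k D x ≤ 1) (hy : valD k D y ≤ 1) :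
    res k D x = res k D y ↔ valD k D (x - y) < 1 := by
  rw [← sub_eq_zero, ← res_sub hx hy, res_eq_zero ((valD k D).map_sub_le hx hy)]

theorem exists_res_eq (a : ResidueAlgebra k D) : ∃ x : D, valD k D x ≤ 1 ∧ res k D x = a := by
  obtain ⟨⟨x, hx⟩, rfl⟩ := residue_surjective k D a
  exact ⟨x, hx, res_of_le hx⟩

theorem res_sum {ι : Type*} (s : Finset ι) {f : ι → D} (hf : ∀ i ∈ s, valD k D (f i) ≤ 1) :
    res k D (∑ i ∈ s, f i) = ∑ i ∈ s, res k D (f i) := by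
  classical
  induction s using Finset.induction_on with
  | empty => simp [res_zero]
  | insert i s hi ih =>
    rw [Finset.sum_insert hi, Finset.sum_insert hi,
      res_add (hf i (Finset.mem_insert_self i s)) ((valD k D).map_sum_le fun j hj =>
        hf j (Finset.mem_insert_of_mem hj)), ih fun j hj => hf j (Finset.mem_insert_of_mem hj)]

theorem valD_eq_one_of_residue_ne_zero {c : 𝒪[k]} (hc : IsLocalRing.residue 𝒪[k] c ≠ 0) :
    valD k D (algebraMap k D c) = 1 := by
  rw [valD_algebraMap]
  have : IsUnit c := by
    by_contra h
    exact hc ((IsLocalRing.residue_eq_zero_iff c).2 ((IsLocalRing.mem_maximalIdeal c).2 h))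
  have h : Valued.v (c : k) = 1 :=
    (Valuation.integer.integers (Valued.v : Valuation k Γ₀)).one_of_isUnit this
  rw [h, one_pow]

theorem valD_natCast {m : ℕ} (hm : (m : 𝓀[k]) ≠ 0) : valD k D (m : D) = 1 := by
  have := valD_eq_one_of_residue_ne_zero (D := D) (c := (m : 𝒪[k])) (by rwa [map_natCast])
  simpa using this

theorem algebraMap_residue (c : 𝒪[k]) :
    algebraMap 𝓀[k] (ResidueAlgebra k D) (IsLocalRing.residue 𝒪[k] c) =
      res k D (algebraMap k D c) := by
  rw [res_of_le (x := algebraMap k D c) (integerMap k D c).2]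
  rfl

theorem valD_algebraMap_le_one_iff {a : k} : valD k D (algebraMap k D a) ≤ 1 ↔ Valued.v a ≤ 1 := by
  rw [valD_algebraMap, pow_le_one_iff finrank_pos.ne']

/-- The map induced on residues by an additive map preserving the valuation. -/
def resLift (f : D → D) (a : ResidueAlgebra k D) : ResidueAlgebra k D :=
  res k D (f (exists_res_eq a).choose)

/-- Additivity and preservation of the valuation make the chosen lift irrelevant. -/
theorem resLift_res {f : D → D} (hadd : ∀ x y, f (x + y) = f x + f y)
    (hf : ∀ x, valD k D (f x) = valD k D x) {x : D} (hx : valD k D x ≤ 1) :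
    resLift f (res k D x) = res k D (f x) := by
  obtain ⟨h1, h2⟩ := (exists_res_eq (res k D x)).choose_spec
  unfold resLift
  rw [res_eq_res (by rwa [hf]) (by rwa [hf])]
  rw [res_eq_res h1 hx] at h2
  have : ∀ x y, f (x - y) = f x - f y := fun x y => by
    rw [eq_sub_iff_add_eq, ← hadd, sub_add_cancel]
  rwa [← this, hf]

theorem valD_involution (σ : Involution D)
    (hσ : ∀ c : k, σ (algebraMap k D c) = algebraMap k D c) (x : D) :
    valD k D (σ x) = valD k D x := by
  change Valued.v _ = Valued.v _
  rw [norm_involution σ hσ]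

/-- The involution induced on the residue algebra. -/
def resInvolution (σ : Involution D) (hσ : ∀ x, valD k D (σ x) = valD k D x) :
    Involution (ResidueAlgebra k D) where
  toFun := resLift σ
  map_add' a b := by
    obtain ⟨x, hx, rfl⟩ := exists_res_eq a
    obtain ⟨y, hy, rfl⟩ := exists_res_eq b
    have h := fun z hz => resLift_res (k := k) (x := z) σ.map_add' hσ hz
    rw [← res_add hx hy, h _ hx, h _ hy, h _ ((valD k D).map_add_le hx hy), σ.map_add',
      res_add (by rwa [hσ]) (by rwa [hσ])]
  map_mul' a b := by
    obtain ⟨x, hx, rfl⟩ := exists_res_eq a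
    obtain ⟨y, hy, rfl⟩ := exists_res_eq b
    have h := fun z hz => resLift_res (k := k) (x := z) σ.map_add' hσ hz
    rw [← res_mul hx hy, h _ hx, h _ hy, h _ (by rw [map_mul]; exact mul_le_one' hx hy), σ.map_mul',
      res_mul (by rwa [hσ]) (by rwa [hσ])]
  invol' a := by
    obtain ⟨x, hx, rfl⟩ := exists_res_eq a
    have h := fun z hz => resLift_res (k := k) (x := z) σ.map_add' hσ hz
    rw [h _ hx, h _ (by rwa [hσ]), σ.invol']

theorem resInvolution_res (σ : Involution D) (hσ : ∀ x, valD k D (σ x) = valD k D x) {x : D}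
    (hx : valD k D x ≤ 1) : resInvolution σ hσ (res k D x) = res k D (σ x) :=
  resLift_res σ.map_add' hσ hx

theorem map_aeval (τ : Involution D) (hτ : ∀ c : k, τ (algebraMap k D c) = algebraMap k D c)
    {y : D} (hτy : τ y = y) (g : Polynomial k) : τ (Polynomial.aeval y g) = Polynomial.aeval y g := by
  induction g using Polynomial.induction_on' with
  | add p q hp hq => rw [map_add, τ.map_add', hp, hq]
  | monomial n a =>
    have hpow : ∀ n : ℕ, τ (y ^ n) = y ^ n := fun n => by
      induction n with
      | zero => simpa using τ.map_one
      | succ n ih => rw [pow_succ, τ.map_mul', ih, hτy, ← pow_succ', pow_succ]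
    rw [Polynomial.aeval_monomial, τ.map_mul', hpow, hτ, Algebra.commutes]

/-- The field generated by an element, as a quotient of the polynomial ring. -/
theorem exists_field_aeval (x : D) :
    ∃ (p : Polynomial k) (_ : Fact (Irreducible p)) (φ : AdjoinRoot p →ₐ[k] D)
      (z : AdjoinRoot p), φ z = x ∧ ∀ a, ∃ g : Polynomial k, φ a = Polynomial.aeval x g := by
  have hx : IsIntegral k x := Algebra.IsIntegral.isIntegral x
  refine ⟨minpoly k x, ⟨minpoly.irreducible hx⟩,
    Ideal.Quotient.liftₐ _ (Polynomial.aeval x) (fun a ha => ?_), AdjoinRoot.root _, ?_, ?_⟩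
  · obtain ⟨c, rfl⟩ := Ideal.mem_span_singleton.1 ha
    simp
  · change Polynomial.aeval x Polynomial.X = x
    simp
  · intro a
    obtain ⟨g, rfl⟩ := Ideal.Quotient.mk_surjective a
    exact ⟨g, rfl⟩

/-- The square root is found in the complete commutative field `k(y)`, so it is a polynomial in `y`
and inherits the `τ`-symmetry of `y`. -/
theorem exists_sqrt_one_add (hchar : (2 : 𝓀[k]) ≠ 0) {y : D} (hy : valD k D y < 1)
    (τ : Involution D) (hτ : ∀ c : k, τ (algebraMap k D c) = algebraMap k D c) (hτy : τ y = y) :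
    ∃ s : D, s * s = 1 + y ∧ τ s = s ∧ valD k D (s - 1) < 1 := by
  let : (Valued.v : Valuation k Γ₀).RankOne :=
    Valuation.IsRankOneDiscrete.rankOne _ (e := 2) (by norm_num)
  let : NontriviallyNormedField k := Valued.toNontriviallyNormedField k Γ₀
  obtain ⟨p, _, φ, z, hz, hφ⟩ := exists_field_aeval (k := k) y
  obtain ⟨r, hr, h⟩ := norm_lift φ
  have : FiniteDimensional k (AdjoinRoot p) :=
    FiniteDimensional.of_injective φ.toLinearMap φ.toRingHom.injective
  let iL : NormedField (AdjoinRoot p) := spectralNorm.normedField k (AdjoinRoot p)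
  have : IsUltrametricDist (AdjoinRoot p) :=
    IsUltrametricDist.isUltrametricDist_of_isNonarchimedean_norm
      (isNonarchimedean_spectralNorm (K := k) (L := AdjoinRoot p))
  have : CompleteSpace (AdjoinRoot p) := spectralNorm.completeSpace k (AdjoinRoot p)
  -- On `k(y)` the valuation of `D` and the spectral norm have the same unit ball, though they are
  -- normalized differently.
  have key : ∀ y : AdjoinRoot p, valD k D (φ y) ≤ 1 ↔ ‖y‖ ≤ 1 := fun y => by
    change Valued.v (Algebra.norm k (φ y)) ≤ 1 ↔ spectralNorm k _ y ≤ 1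
    rw [h, map_pow, pow_le_one_iff hr, ← norm_field, Valued.toNormedField.norm_le_one_iff]
  have key' : ∀ y : AdjoinRoot p, valD k D (φ y) < 1 ↔ ‖y‖ < 1 := fun y => by
    by_cases hy : y = 0
    · simp [hy]
    have h1 := key y⁻¹
    rw [map_inv₀, map_inv₀, norm_inv, inv_le_one₀ (norm_pos_iff.2 hy),
      inv_le_one₀ (zero_lt_iff.2 ((valD k D).ne_zero_iff.2 ((map_ne_zero φ).2 hy)))] at h1
    rw [← not_le, h1, not_le]
  have hv2 : valD k D (2 : D) = 1 := by
    simpa using valD_natCast (D := D) (m := 2) (by simpa using hchar)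
  have h2 : ‖(2 : AdjoinRoot p)‖ = 1 := by
    refine le_antisymm ((key 2).1 ?_) (not_lt.1 fun h => ?_)
    · rw [map_ofNat, hv2]
    · rw [← key', map_ofNat, hv2] at h
      exact lt_irrefl _ h
  obtain ⟨t, ht, ht1⟩ := exists_sq_eq_one_add h2 (z := z) (by rwa [← key', hz])
  refine ⟨φ (1 + t), by rw [← map_mul, ht, map_add, map_one, hz], ?_, ?_⟩
  · obtain ⟨g, hg⟩ := hφ (1 + t)
    rw [hg, map_aeval τ hτ hτy]
  · rw [map_add, map_one, add_sub_cancel_left, key']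
    exact ht1

end Residue

/-- The involution `x ↦ c⁻¹ σ(x) c`, where `σ c = ± c`. -/
def Involution.conj {E : Type*} [DivisionRing E] (σ : Involution E) {c : E} {δ : ℤˣ} (hc : c ≠ 0)
    (hδ : σ c = δ • c) : Involution E where
  toFun x := c⁻¹ * σ x * c
  map_add' x y := by rw [σ.map_add', mul_add, add_mul]
  map_mul' x y := by
    rw [σ.map_mul']
    simp only [mul_assoc, mul_inv_cancel_left₀ hc]
  invol' x := by
    have hδ2 : δ * δ = 1 := Int.units_mul_self δ
    rw [σ.map_mul', σ.map_mul', σ.invol', σ.map_inv, hδ]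
    rcases Int.units_eq_one_or δ with rfl | rfl <;> simp [hc]

theorem Involution.conj_apply {E : Type*} [DivisionRing E] (σ : Involution E) {c : E} {δ : ℤˣ}
    (hc : c ≠ 0) (hδ : σ c = δ • c) (x : E) : σ.conj hc hδ x = c⁻¹ * σ x * c := rfl

theorem Involution.mul_conj_apply {E : Type*} [DivisionRing E] (σ : Involution E) {c : E} {δ : ℤˣ}
    (hc : c ≠ 0) (hδ : σ c = δ • c) (x : E) : c * σ.conj hc hδ x = σ x * c := by
  rw [conj_apply, mul_assoc, mul_inv_cancel_left₀ hc]

theorem IsAnisoDiag.rescale {E : Type*} [DivisionRing E] {σ : Involution E} {ε : ℤˣ} {ι : Type*}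
    [Fintype ι] {a : ι → E} (ha : IsAnisoDiag σ ε a) {c : ι → E} (hc : ∀ i, c i ≠ 0) :
    IsAnisoDiag σ ε fun i => σ (c i) * a i * c i := by
  refine ⟨fun i => ?_, fun x hx => ?_⟩
  · rw [σ.map_mul', σ.map_mul', σ.invol', ha.symm, smul_mul_assoc, mul_smul_comm, mul_assoc]
  · have := ha.aniso (fun i => c i * x i) (by
      rw [← hx]
      exact Finset.sum_congr rfl fun i _ => by rw [σ.map_mul']; simp only [mul_assoc])
    ext i
    exact (mul_eq_zero.1 (congrFun this i)).resolve_left (hc i)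

/-! ### Larmour's theorem: residue forms -/

section Larmour

variable (k : Type*) [Field k] {Γ₀ : Type*} [LinearOrderedCommGroupWithZero Γ₀]
  [Valued k Γ₀] [CompleteSpace k] [(Valued.v : Valuation k Γ₀).IsRankOneDiscrete]
  {D : Type*} [DivisionRing D] [Algebra k D] [FiniteDimensional k D]

/-- `p` generates the value group of `D`. -/
structure IsUnif (p : D) : Prop where
  ne_zero : p ≠ 0
  lt_one : valD k D p < 1
  exists_zpow : ∀ x : D, x ≠ 0 → ∃ j : ℤ, valD k D x = valD k D p ^ j

variable {k}

theorem IsUnif.of_eq {p q : D} (hp : IsUnif k p) (h : valD k D q = valD k D p) : IsUnif k q where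
  ne_zero := fun h0 => hp.ne_zero <| by
    rw [h0, map_zero, eq_comm, Valuation.zero_iff] at h
    exact h
  lt_one := h ▸ hp.lt_one
  exists_zpow := h ▸ hp.exists_zpow

theorem IsUnif.valD_ne_zero {p : D} (hp : IsUnif k p) : valD k D p ≠ 0 :=
  (valD k D).ne_zero_iff.2 hp.ne_zero

theorem IsUnif.zpow_inj {p : D} (hp : IsUnif k p) {i j : ℤ}
    (h : valD k D p ^ i = valD k D p ^ j) : i = j :=
  zpow_right_injective₀ (zero_lt_iff.2 hp.valD_ne_zero) hp.lt_one.ne h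

variable (k D) in
theorem exists_isUnif : ∃ p : D, IsUnif k p := by
  let v : Valuation k Γ₀ := Valued.v
  let γ := Valuation.IsRankOneDiscrete.generator v
  have hγ1 : (γ : Γ₀) < 1 := Units.val_lt_val.2 (Valuation.IsRankOneDiscrete.generator_lt_one v)
  have hγ0 : (γ : Γ₀) ≠ 0 := γ.ne_zero
  have hex : ∀ x : D, x ≠ 0 → ∃ j : ℤ, valD k D x = (γ : Γ₀) ^ j := fun x hx => by
    have h : valD k D x ∈ Set.range v \ {0} :=
      ⟨⟨_, rfl⟩, (valD k D).ne_zero_iff.2 hx⟩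
    rw [← Valuation.IsRankOneDiscrete.generator_zpowers_eq_range] at h
    obtain ⟨_, ⟨j, rfl⟩, hj⟩ := h
    exact ⟨j, by rw [← hj]; simp [γ]⟩
  -- The exponents of values of `D`, with respect to a generator for `k`, form a cyclic group; it is
  -- nonzero because `k` contributes a nontrivial value.
  let H : AddSubgroup ℤ :=
    { carrier := {j | ∃ x : D, x ≠ 0 ∧ valD k D x = (γ : Γ₀) ^ j}
      zero_mem' := ⟨1, one_ne_zero, by simp⟩
      add_mem' := by
        rintro i j ⟨x, hx, hxi⟩ ⟨y, hy, hyj⟩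
        exact ⟨x * y, mul_ne_zero hx hy, by rw [map_mul, hxi, hyj, zpow_add₀ hγ0]⟩
      neg_mem' := by
        rintro i ⟨x, hx, hxi⟩
        exact ⟨x⁻¹, inv_ne_zero hx, by rw [map_inv₀, hxi, zpow_neg]⟩ }
  obtain ⟨a, ha⟩ := Int.subgroup_cyclic H
  have hmem : ∀ j, j ∈ H ↔ ∃ m : ℤ, m • a = j := fun j => by
    rw [ha, AddSubgroup.mem_closure_singleton]
  obtain ⟨q, hq, hqa⟩ : a ∈ H := (hmem a).2 ⟨1, one_smul _ _⟩
  have hpow : ∀ x : D, x ≠ 0 → ∃ j : ℤ, valD k D x = valD k D q ^ j := fun x hx => by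
    obtain ⟨j, hj⟩ := hex x hx
    obtain ⟨m, rfl⟩ := (hmem j).1 ⟨x, hx, hj⟩
    exact ⟨m, by rw [hj, hqa, ← zpow_mul, smul_eq_mul, mul_comm]⟩
  have hq1 : valD k D q ≠ 1 := fun h1 => by
    obtain ⟨c, hc⟩ := Valuation.IsRankOneDiscrete.generator_mem_range k v
    have hc0 : c ≠ 0 := fun h => hγ0 (by rw [← hc, h, map_zero])
    obtain ⟨j, hj⟩ := hpow (algebraMap k D c) ((map_ne_zero _).2 hc0)
    rw [h1, one_zpow, valD_algebraMap] at hj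
    exact (pow_lt_one' (a := Valued.v c) (hc.trans_lt hγ1) finrank_pos.ne').ne hj
  rcases lt_or_gt_of_ne hq1 with h | h
  · exact ⟨q, hq, h, hpow⟩
  · refine ⟨q⁻¹, inv_ne_zero hq, by rw [map_inv₀]; exact inv_lt_one_of_one_lt₀ h, fun x hx => ?_⟩
    obtain ⟨j, hj⟩ := hpow x hx
    exact ⟨-j, by rw [hj, map_inv₀, inv_zpow', neg_neg]⟩

theorem valD_two (h2 : (2 : 𝓀[k]) ≠ 0) : valD k D (2 : D) = 1 := by
  simpa using valD_natCast (D := D) (m := 2) (by simpa using h2)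

theorem two_ne_zero_of_residue (h2 : (2 : 𝓀[k]) ≠ 0) : (2 : D) ≠ 0 := fun h => by
  have := valD_two (D := D) h2
  rw [h, map_zero] at this
  exact zero_ne_one this

/-- The sum of `p + σ p` and `p - σ p` is `2 p`, and `2` is a unit, so one of the two has the value
of `p`. -/
theorem IsUnif.exists_skew {p : D} (hp : IsUnif k p) (h2 : (2 : 𝓀[k]) ≠ 0) (σ : Involution D)
    (hσ : ∀ x, valD k D (σ x) = valD k D x) : ∃ (q : D) (δ : ℤˣ), IsUnif k q ∧ σ q = δ • q := by
  by_cases h : valD k D (p + σ p) = valD k D p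
  · refine ⟨p + σ p, 1, hp.of_eq h, ?_⟩
    rw [σ.map_add', σ.invol', add_comm, one_smul]
  · refine ⟨p - σ p, -1, hp.of_eq ?_, ?_⟩
    · refine le_antisymm ((valD k D).map_sub_le le_rfl (hσ p).le) (not_lt.1 fun h' => ?_)
      have h1 := lt_of_le_of_ne ((valD k D).map_add_le le_rfl (hσ p).le) h
      have := (valD k D).map_add_lt h1 h'
      rw [show p + σ p + (p - σ p) = 2 * p by rw [two_mul]; abel, map_mul, valD_two h2,
        one_mul] at this
      exact lt_irrefl _ this
    · rw [sub_eq_add_neg, σ.map_add', σ.map_neg, σ.invol', Units.neg_smul, one_smul]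
      abel

theorem valD_conj (σ : Involution D) (hσ : ∀ x, valD k D (σ x) = valD k D x) {p : D} {δ : ℤˣ}
    (hp : p ≠ 0) (hδ : σ p = δ • p) (x : D) : valD k D (σ.conj hp hδ x) = valD k D x := by
  rw [Involution.conj_apply, map_mul, map_mul, hσ, map_inv₀, mul_right_comm, inv_mul_cancel₀,
    one_mul]
  exact (valD k D).ne_zero_iff.2 hp

/-- As `2` is a unit, any lift `x` can be replaced by the average of `x` and `ε σ x`. -/
theorem exists_res_eq_symm (h2 : (2 : 𝓀[k]) ≠ 0) (σ : Involution D)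
    (hσ : ∀ x, valD k D (σ x) = valD k D x) {ε : ℤˣ} {a : ResidueAlgebra k D}
    (ha : resInvolution σ hσ a = ε • a) :
    ∃ x : D, valD k D x ≤ 1 ∧ σ x = ε • x ∧ res k D x = a := by
  obtain ⟨x, hx, rfl⟩ := exists_res_eq a
  rw [resInvolution_res σ hσ hx] at ha
  have hε : ε • ε • x = x := by rw [smul_smul, Int.units_mul_self, one_smul]
  have h20 : (2 : D) ≠ 0 := two_ne_zero_of_residue h2
  have hw2 : valD k D (2 : D)⁻¹ = 1 := by rw [map_inv₀, valD_two h2, inv_one]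
  have hσ2 : σ (2 : D)⁻¹ = 2⁻¹ := by
    rw [σ.map_inv, show (2 : D) = 1 + 1 by norm_num, σ.map_add', σ.map_one]
  have hx' : valD k D (ε • σ x) ≤ 1 := by rwa [valD_smul, hσ]
  have hcomm : ∀ y : D, y * 2⁻¹ = 2⁻¹ * y := fun y =>
    ((Commute.ofNat_right y 2).inv_right₀).eq
  refine ⟨2⁻¹ * (x + ε • σ x), ?_, ?_, ?_⟩
  · rw [map_mul, hw2, one_mul]
    exact (valD k D).map_add_le hx hx'
  · rw [σ.map_mul', hσ2, hcomm, σ.map_add', σ.map_smul, σ.invol', ← mul_smul_comm, smul_add,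
      smul_smul, Int.units_mul_self, one_smul, add_comm]
  · have h3 : res k D (x + ε • σ x) = res k D (2 * x) := by
      rw [res_add hx hx', res_smul ε (by rwa [hσ]), ha, smul_smul, Int.units_mul_self, one_smul,
        two_mul, res_add hx hx]
    rw [res_mul hw2.le ((valD k D).map_add_le hx hx'), h3, ← res_mul hw2.le
      (by rwa [map_mul, valD_two h2, one_mul]), inv_mul_cancel_left₀ h20]

/-- Divide by a coordinate of largest absolute value. The residue vector becomes nonzero, so by
anisotropy of the residue form the value of the divided vector is a unit. -/
theorem exists_valD_sum_eq {σ : Involution D} (hσ : ∀ x, valD k D (σ x) = valD k D x) {ε : ℤˣ}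
    {ι : Type*} [Fintype ι] {a : ι → D} (ha : ∀ i, valD k D (a i) ≤ 1)
    (h : IsAnisoDiag (resInvolution σ hσ) ε fun i => res k D (a i)) {x : ι → D} (hx : x ≠ 0) :
    ∃ i, x i ≠ 0 ∧ valD k D (∑ i, σ (x i) * a i * x i) = valD k D (x i) ^ 2 := by
  obtain ⟨i₁, hi₁⟩ := Function.ne_iff.1 hx
  have : Nonempty ι := ⟨i₁⟩
  obtain ⟨i₀, hi₀⟩ := Finite.exists_max fun i => valD k D (x i)
  have h0 : x i₀ ≠ 0 := fun h0 => hi₁ <| by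
    have := hi₀ i₁
    rw [h0, map_zero, le_zero_iff, Valuation.zero_iff] at this
    exact this
  refine ⟨i₀, h0, ?_⟩
  have hw0 : valD k D (x i₀) ≠ 0 := (valD k D).ne_zero_iff.2 h0
  let y : ι → D := fun i => x i * (x i₀)⁻¹
  have hy : ∀ i, valD k D (y i) ≤ 1 := fun i => by
    rw [map_mul, map_inv₀]
    exact mul_inv_le_of_le_mul₀ zero_le zero_le (by rw [one_mul]; exact hi₀ i)
  have hterm : ∀ i, valD k D (σ (y i) * a i * y i) ≤ 1 := fun i => by
    rw [map_mul, map_mul, hσ]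
    exact mul_le_one' (mul_le_one' (hy i) (ha i)) (hy i)
  have hsum : ∑ i, σ (x i) * a i * x i = σ (x i₀) * (∑ i, σ (y i) * a i * y i) * x i₀ := by
    rw [Finset.mul_sum, Finset.sum_mul]
    refine Finset.sum_congr rfl fun i _ => ?_
    have : x i = y i * x i₀ := by simp [y, h0]
    rw [this, σ.map_mul']
    simp only [mul_assoc]
  have hu : valD k D (∑ i, σ (y i) * a i * y i) = 1 := by
    refine (res_ne_zero ((valD k D).map_sum_le fun i _ => hterm i)).1 fun h' => ?_
    rw [res_sum _ fun i _ => hterm i] at h'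
    have := h.aniso (fun i => res k D (y i)) (by
      rw [← h']
      refine Finset.sum_congr rfl fun i _ => ?_
      rw [resInvolution_res σ hσ (hy i), res_mul _ (hy i), res_mul (by rw [hσ]; exact hy i) (ha i)]
      rw [map_mul, hσ]
      exact mul_le_one' (hy i) (ha i))
    have h1 := congrFun this i₀
    simp [y, h0, res_one] at h1
  rw [hsum, map_mul, map_mul, hσ, hu, mul_one, sq]

/-- A form of rank one does not change under a small perturbation: `b - q = b (1 - b⁻¹ q)`, and `1 -
b⁻¹ q` has a square root `s` symmetric for `x ↦ b⁻¹ σ(x) b`, so that `σ(s) b s = b s²`. -/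
theorem exists_conj_eq_sub (h2 : (2 : 𝓀[k]) ≠ 0) {σ : Involution D}
    (hσ : ∀ c : k, σ (algebraMap k D c) = algebraMap k D c) {ε : ℤˣ} {b q : D} (hb : σ b = ε • b)
    (hq : σ q = ε • q) (h : valD k D q < valD k D b) :
    ∃ s, σ s * b * s = b - q := by
  have hb0 : b ≠ 0 := fun h0 => by simp [h0] at h
  obtain ⟨s, hs, hτ, -⟩ := exists_sqrt_one_add h2 (y := -(b⁻¹ * q)) (by
      rw [Valuation.map_neg, map_mul, map_inv₀, mul_comm, ← div_eq_mul_inv]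
      exact (div_lt_one₀ (zero_lt_iff.2 ((valD k D).ne_zero_iff.2 hb0))).2 h)
    (σ.conj hb0 hb) (fun c => by
      rw [Involution.conj_apply, hσ, ← Algebra.commutes, mul_assoc, inv_mul_cancel₀ hb0, mul_one])
    (by
      rw [Involution.conj_apply, σ.map_neg, σ.map_mul', σ.map_inv, hb, hq]
      rcases Int.units_eq_one_or ε with rfl | rfl <;> simp [mul_assoc, hb0])
  refine ⟨s, ?_⟩
  rw [← Involution.mul_conj_apply σ hb0 hb, hτ, mul_assoc, hs, mul_add, mul_one, mul_neg,
    mul_inv_cancel_left₀ hb0, sub_eq_add_neg]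

/-- Hensel's lemma: lift an isotropic vector of the residue form to `y`, whose value `q` is small,
and correct one unit coordinate so that its contribution decreases by exactly `q`. -/
theorem IsAnisoDiag.res (h2 : (2 : 𝓀[k]) ≠ 0) {σ : Involution D}
    (hσ : ∀ c : k, σ (algebraMap k D c) = algebraMap k D c)
    (hw : ∀ x, valD k D (σ x) = valD k D x) {ε : ℤˣ} {ι : Type*} [Fintype ι] {a : ι → D}
    (h : IsAnisoDiag σ ε a) (ha : ∀ i, valD k D (a i) = 1) :
    IsAnisoDiag (resInvolution σ hw) ε fun i => res k D (a i) := by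
  classical
  refine ⟨fun i => ?_, fun x hx => ?_⟩
  · rw [resInvolution_res σ hw (ha i).le, h.symm, res_smul ε (ha i).le]
  by_contra hx0
  obtain ⟨i₀, hi₀⟩ := Function.ne_iff.1 hx0
  choose y hy hyx using fun i => exists_res_eq (x i)
  have hterm : ∀ i, valD k D (σ (y i) * a i * y i) ≤ 1 := fun i => by
    rw [map_mul, map_mul, hw, ha, mul_one]
    exact mul_le_one' (hy i) (hy i)
  let q := ∑ i, σ (y i) * a i * y i
  have hq : valD k D q < 1 := by
    rw [← res_eq_zero ((valD k D).map_sum_le fun i _ => hterm i), res_sum _ fun i _ => hterm i,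
      ← hx]
    refine Finset.sum_congr rfl fun i _ => ?_
    rw [← hyx, resInvolution_res σ hw (hy i), res_mul _ (hy i),
      res_mul (by rw [hw]; exact hy i) (ha i).le]
    rw [map_mul, hw, ha, mul_one]
    exact hy i
  have hterm' : ∀ i, σ (σ (y i) * a i * y i) = ε • (σ (y i) * a i * y i) := fun i => by
    rw [σ.map_mul', σ.map_mul', σ.invol', h.symm, smul_mul_assoc, mul_smul_comm, mul_assoc]
  have hqs : σ q = ε • q := by
    rw [σ.map_sum, Finset.smul_sum]
    exact Finset.sum_congr rfl fun i _ => hterm' i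
  have hy0 : valD k D (y i₀) = 1 := by
    rw [← res_ne_zero (hy i₀), hyx]
    exact hi₀
  have hb1 : valD k D (σ (y i₀) * a i₀ * y i₀) = 1 := by
    rw [map_mul, map_mul, hw, ha, hy0, mul_one, mul_one]
  obtain ⟨s, hs⟩ := exists_conj_eq_sub h2 hσ (hterm' i₀) hqs (by rwa [hb1])
  have h0 := h.aniso (Function.update y i₀ (y i₀ * s)) (by
    rw [← Finset.add_sum_erase _ _ (Finset.mem_univ i₀), Function.update_self]
    have : ∑ i ∈ Finset.univ.erase i₀, σ (Function.update y i₀ (y i₀ * s) i) * a i *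
        Function.update y i₀ (y i₀ * s) i = ∑ i ∈ Finset.univ.erase i₀, σ (y i) * a i * y i :=
      Finset.sum_congr rfl fun i hi => by
        rw [Function.update_of_ne (Finset.ne_of_mem_erase hi)]
    rw [this, eq_sub_of_add_eq' (Finset.add_sum_erase _ (fun i => σ (y i) * a i * y i)
      (Finset.mem_univ i₀)), σ.map_mul']
    have h3 : σ s * σ (y i₀) * a i₀ * (y i₀ * s) = σ s * (σ (y i₀) * a i₀ * y i₀) * s := by
      simp only [mul_assoc]
    rw [h3, hs]
    abel)
  have h1 := congrFun h0 i₀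
  rw [Function.update_self] at h1
  have h2' : valD k D (σ (y i₀) * a i₀ * y i₀ - q) = 1 := by
    rw [Valuation.map_sub_eq_of_lt_left, hb1]
    rwa [hb1]
  rw [← hs, map_mul] at h2'
  have hs0 : s = 0 := (mul_eq_zero.1 h1).resolve_left fun h => by simp [h] at hy0
  simp [hs0] at h2'

theorem valD_sum_eq_sq_zpow {σ : Involution D} (hσ : ∀ x, valD k D (σ x) = valD k D x) {ε : ℤˣ}
    {ι : Type*} [Fintype ι] {a : ι → D} (ha : ∀ i, valD k D (a i) ≤ 1)
    (h : IsAnisoDiag (resInvolution σ hσ) ε fun i => res k D (a i)) {p : D} (hp : IsUnif k p)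
    {x : ι → D} (hx : x ≠ 0) :
    ∃ j : ℤ, valD k D (∑ i, σ (x i) * a i * x i) = valD k D p ^ (2 * j) := by
  obtain ⟨i, hi, h⟩ := exists_valD_sum_eq hσ ha h hx
  obtain ⟨j, hj⟩ := hp.exists_zpow _ hi
  exact ⟨j, by rw [h, hj, mul_comm, zpow_mul]; norm_cast⟩

/-- Lift the entries of `b` and multiply them by `p`. Nonzero vectors of the first part have values
that are even powers of `p`, those of the second part odd powers, so the two cannot cancel. -/
theorem IsAnisoDiag.sum_lift (h2 : (2 : 𝓀[k]) ≠ 0) {σ : Involution D}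
    (hw : ∀ x, valD k D (σ x) = valD k D x) {p : D} (hp : IsUnif k p) {δ ε : ℤˣ}
    (hδ : σ p = δ • p) {ι κ : Type*} [Fintype ι] [Fintype κ] {a : ι → ResidueAlgebra k D}
    {b : κ → ResidueAlgebra k D} (ha : IsAnisoDiag (resInvolution σ hw) ε a)
    (hb : IsAnisoDiag (resInvolution (σ.conj hp.ne_zero hδ) (valD_conj σ hw hp.ne_zero hδ))
      (δ * ε) b) :
    ∃ c : ι ⊕ κ → D, IsAnisoDiag σ ε c := by
  choose a' ha1 haσ har using fun i => exists_res_eq_symm h2 σ hw (ha.symm i)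
  choose b' hb1 hbσ hbr using fun i =>
    exists_res_eq_symm h2 _ (valD_conj σ hw hp.ne_zero hδ) (hb.symm i)
  obtain rfl : a = fun i => HermU.res k D (a' i) := funext fun i => (har i).symm
  obtain rfl : b = fun i => HermU.res k D (b' i) := funext fun i => (hbr i).symm
  refine ⟨Sum.elim a' fun i => p * b' i, ?_, fun x hx => ?_⟩
  · rintro (i | i)
    · exact haσ i
    · change σ (p * b' i) = ε • (p * b' i)
      rw [σ.map_mul', hδ, mul_smul_comm, ← Involution.mul_conj_apply σ hp.ne_zero hδ, hbσ,
        mul_smul_comm, smul_smul, ← mul_assoc, Int.units_mul_self, one_mul]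
  · rw [Fintype.sum_sum_type] at hx
    simp only [Sum.elim_inl, Sum.elim_inr] at hx
    have hsum : ∑ i, σ (x (Sum.inr i)) * (p * b' i) * x (Sum.inr i) =
        p * ∑ i, σ.conj hp.ne_zero hδ (x (Sum.inr i)) * b' i * x (Sum.inr i) := by
      rw [Finset.mul_sum]
      refine Finset.sum_congr rfl fun i _ => ?_
      rw [← mul_assoc, ← Involution.mul_conj_apply σ hp.ne_zero hδ]
      simp only [mul_assoc]
    rw [hsum] at hx
    have hA := fun h0 : (fun i => x (Sum.inl i)) ≠ 0 => valD_sum_eq_sq_zpow hw ha1 ha hp h0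
    have hB := fun h0 : (fun i => x (Sum.inr i)) ≠ 0 =>
      valD_sum_eq_sq_zpow (valD_conj σ hw hp.ne_zero hδ) hb1 hb hp h0
    have hx1 : (fun i => x (Sum.inl i)) = 0 := by
      by_contra h0
      obtain ⟨j, hj⟩ := hA h0
      have hv := congrArg (valD k D) (eq_neg_of_add_eq_zero_left hx)
      rw [hj, Valuation.map_neg, map_mul] at hv
      by_cases h1 : (fun i => x (Sum.inr i)) = 0
      · have : ∀ i, x (Sum.inr i) = 0 := fun i => congrFun h1 i
        simp only [this, mul_zero, Finset.sum_const_zero, map_zero] at hv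
        exact zpow_ne_zero _ hp.valD_ne_zero hv
      · obtain ⟨j', hj'⟩ := hB h1
        rw [hj', ← zpow_one_add₀ hp.valD_ne_zero] at hv
        have := hp.zpow_inj hv
        omega
    have hx2 : (fun i => x (Sum.inr i)) = 0 := by
      by_contra h1
      obtain ⟨j', hj'⟩ := hB h1
      have : ∀ i, x (Sum.inl i) = 0 := fun i => congrFun hx1 i
      simp only [this, mul_zero, Finset.sum_const_zero, zero_add] at hx
      rw [(mul_eq_zero.1 hx).resolve_left hp.ne_zero, map_zero] at hj'
      exact zpow_ne_zero _ hp.valD_ne_zero hj'.symm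
    ext (i | i)
    · exact congrFun hx1 i
    · exact congrFun hx2 i

/-- Larmour's theorem. -/
theorem uInvariant_eq_add (h2 : (2 : 𝓀[k]) ≠ 0) {σ : Involution D}
    (hσ : ∀ c : k, σ (algebraMap k D c) = algebraMap k D c)
    (hw : ∀ x, valD k D (σ x) = valD k D x) {p : D} (hp : IsUnif k p) {δ : ℤˣ}
    (hδ : σ p = δ • p) (ε : ℤˣ) :
    uInvariant σ ε = uInvariant (resInvolution σ hw) ε +
      uInvariant (resInvolution (σ.conj hp.ne_zero hδ) (valD_conj σ hw hp.ne_zero hδ))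
        (δ * ε) := by
  classical
  refine le_antisymm ?_ ?_
  · rw [uInvariant_eq_sSup σ]
    refine sSup_le ?_
    rintro _ ⟨n, a, ha, rfl⟩
    choose j hj using fun i => hp.exists_zpow _ (ha.ne_zero i)
    -- Rescaling changes exponents by even numbers, so `p ^ (-(j i / 2))` leaves the remainder `j i
    -- % 2` as exponent.
    have ha' := ha.rescale (c := fun i => p ^ (-(j i / 2))) fun i => zpow_ne_zero _ hp.ne_zero
    set a' := fun i => σ (p ^ (-(j i / 2))) * a i * p ^ (-(j i / 2)) with ha'_def
    have hwa : ∀ i, valD k D (a' i) = valD k D p ^ (j i % 2) := fun i => by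
      rw [ha'_def]
      simp only
      rw [map_mul, map_mul, hw, hj, map_zpow₀, ← zpow_add₀ hp.valD_ne_zero,
        ← zpow_add₀ hp.valD_ne_zero]
      congr 1
      omega
    have h0 := (ha'.comp (f := fun i : {i // j i % 2 = 0} => i.1) Subtype.val_injective).res h2
      hσ hw fun i => by simp [hwa, i.2]
    have hδ' : σ p⁻¹ = δ • p⁻¹ := by
      rw [σ.map_inv, hδ]
      rcases Int.units_eq_one_or δ with rfl | rfl <;> simp
    -- Entries with the value of `p` become units after scaling by `p⁻¹`, which changes `σ` to its
    -- conjugate and the sign to `δ * ε`.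
    have h1 := ((ha'.comp (f := fun i : {i // ¬ j i % 2 = 0} => i.1)
      Subtype.val_injective).scale (σ' := σ.conj hp.ne_zero hδ) (inv_ne_zero hp.ne_zero) hδ'
      fun x => by rw [inv_inv, Involution.conj_apply]).res h2 (fun c => by
        rw [Involution.conj_apply, hσ, ← Algebra.commutes, mul_assoc, inv_mul_cancel₀ hp.ne_zero,
          mul_one]) (valD_conj σ hw hp.ne_zero hδ) fun i => by
        have h1 : j i.1 % 2 = 1 := by have := i.2; omega
        simp [hwa, h1, hp.valD_ne_zero]
    refine le_trans (le_of_eq ?_) (add_le_add h0.card_le h1.card_le)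
    rw [← Nat.cast_add, ← Fintype.card_sum, Fintype.card_congr (Equiv.sumCompl _),
      Fintype.card_fin]
  · rw [uInvariant_eq_sSup (resInvolution σ hw), uInvariant_eq_sSup (resInvolution (σ.conj _ _) _),
      sSup_eq_iSup', sSup_eq_iSup']
    -- The empty form is anisotropic; adding suprema requires nonempty index sets.
    have hne : ∀ {E : Type _} [DivisionRing E] (τ : Involution E) (ε : ℤˣ),
        Nonempty {m : ℕ∞ | ∃ (n : ℕ) (a : Fin n → E), IsAnisoDiag τ ε a ∧ m = n} := fun τ ε =>
      ⟨0, 0, Fin.elim0, ⟨fun i => i.elim0, fun x _ => Subsingleton.elim _ _⟩, by simp⟩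
    have := hne (resInvolution σ hw) ε
    have := hne (resInvolution (σ.conj hp.ne_zero hδ) (valD_conj σ hw hp.ne_zero hδ)) (δ * ε)
    refine ENat.iSup_add_iSup_le ?_
    rintro ⟨_, n, a, ha, rfl⟩ ⟨_, m, b, hb, rfl⟩
    obtain ⟨c, hc⟩ := ha.sum_lift h2 hw hp hδ hb
    refine le_trans (le_of_eq ?_) hc.card_le
    simp

end Larmour

/-! ### Comparing `[D : k]` with the dimension of the residue algebra -/

section Dimension

variable {k : Type*} [Field k] {Γ₀ : Type*} [LinearOrderedCommGroupWithZero Γ₀]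
  [Valued k Γ₀] [CompleteSpace k] [(Valued.v : Valuation k Γ₀).IsRankOneDiscrete]
  {D : Type*} [DivisionRing D] [Algebra k D] [FiniteDimensional k D]

theorem IsUnif.valD_lt_zpow {p : D} (hp : IsUnif k p) {m : ℤ} {x : D}
    (h : valD k D x < valD k D p ^ m) : valD k D x ≤ valD k D p ^ (m + 1) := by
  by_cases hx : x = 0
  · simp [hx]
  obtain ⟨j, hj⟩ := hp.exists_zpow x hx
  have h0 := zero_lt_iff.2 hp.valD_ne_zero
  rw [hj] at h ⊢
  rw [zpow_lt_zpow_iff_right_of_lt_one₀ h0 hp.lt_one] at h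
  rw [zpow_le_zpow_iff_right_of_lt_one₀ h0 hp.lt_one]
  omega

/-- Successive approximation makes `W` dense. It is also closed, being finite-dimensional over a
complete field. -/
theorem eq_top_of_forall_exists_valD_sub_lt (W : Submodule k D)
    (h : ∀ x : D, x ≠ 0 → ∃ b ∈ W, valD k D (x - b) < valD k D x) : W = ⊤ := by
  obtain ⟨p, hp⟩ := exists_isUnif k D
  have h0 := zero_lt_iff.2 hp.valD_ne_zero
  let : Valued D Γ₀ := Valued.mk' (valD k D)
  let : (Valued.v : Valuation k Γ₀).RankOne :=
    Valuation.IsRankOneDiscrete.rankOne _ (e := 2) (by norm_num)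
  let : NontriviallyNormedField k := Valued.toNontriviallyNormedField k Γ₀
  have hγ : ∀ γ : (MonoidWithZeroHom.ValueGroup₀ (.ofClass (valD k D)))ˣ, ∃ m : ℤ,
      MonoidWithZeroHom.ValueGroup₀.embedding γ.1 = valD k D p ^ m := by
    intro γ
    obtain ⟨r, s, hr, hs, h⟩ := (valD k D).exists_div_eq_of_unit γ
    obtain ⟨m, hm⟩ := hp.exists_zpow (r / s) <| by
      rw [← (valD k D).ne_zero_iff, map_div₀]
      exact div_ne_zero hr.ne' hs.ne'
    exact ⟨m, by rw [← h, map_div₀, Valuation.embedding_restrict, Valuation.embedding_restrict,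
      ← map_div₀, hm]⟩
  -- On `k` the valuation of `D` is the power `v ^ [D : k]`, which on elements of absolute value at
  -- most one is bounded by `v`.
  have hcont : Continuous (algebraMap k D) := by
    refine continuous_of_continuousAt_zero (algebraMap k D) ?_
    rw [ContinuousAt, map_zero, (Valued.hasBasis_nhds_zero D Γ₀).tendsto_right_iff]
    rintro γ -
    obtain ⟨m, hm⟩ := hγ γ
    let a : k := Algebra.norm k p ^ m
    have ha : Valued.v a = valD k D p ^ m := map_zpow₀ _ _ _
    have hnhds : ∀ a : k, a ≠ 0 → {c : k | Valued.v c < Valued.v a} ∈ nhds (0 : k) :=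
      fun a ha => Valued.mem_nhds_zero.2 ⟨Units.mk0 ((Valued.v : Valuation k Γ₀).restrict a)
        (by simpa using ha), fun c hc => (Valuation.restrict_lt_iff _).1 hc⟩
    filter_upwards [hnhds a (by simp [a, zpow_ne_zero, hp.ne_zero]),
      hnhds 1 one_ne_zero] with c hc hc1
    simp only [map_one] at hc hc1
    rw [Valuation.restrict_lt_iff_lt_embedding, hm, ← ha]
    change valD k D _ < _
    rw [valD_algebraMap]
    exact (pow_le_of_le_one zero_le hc1.le finrank_pos.ne').trans_lt hc
  have : ContinuousSMul k D := ⟨by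
    simp_rw [Algebra.smul_def]
    exact (hcont.comp continuous_fst).mul continuous_snd⟩
  have hcl : IsClosed (W : Set D) := W.closed_of_finiteDimensional
  have happrox : ∀ x : D, ∀ m : ℤ, ∃ b ∈ W, valD k D (x - b) ≤ valD k D p ^ m := by
    intro x m
    by_cases hx : x = 0
    · exact ⟨0, W.zero_mem, by simp [hx]⟩
    obtain ⟨j, hj⟩ := hp.exists_zpow x hx
    rcases le_total m j with hmj | hmj
    · refine ⟨0, W.zero_mem, ?_⟩
      rw [sub_zero, hj]
      exact (zpow_le_zpow_iff_right_of_lt_one₀ h0 hp.lt_one).2 hmj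
    induction m, hmj using Int.leInduction with
    | base => exact ⟨0, W.zero_mem, by rw [sub_zero, hj]⟩
    | succ m _ ih =>
      obtain ⟨b, hb, hxb⟩ := ih
      by_cases hb0 : x - b = 0
      · exact ⟨b, hb, by simp [hb0]⟩
      obtain ⟨b', hb', hlt⟩ := h _ hb0
      refine ⟨b + b', W.add_mem hb hb', ?_⟩
      rw [← sub_sub]
      exact hp.valD_lt_zpow (hlt.trans_le hxb)
  rw [eq_top_iff]
  intro x _
  change x ∈ (W : Set D)
  rw [← hcl.closure_eq, mem_closure_iff_nhds]
  intro s hs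
  obtain ⟨γ, hγs⟩ := Valued.mem_nhds.1 hs
  obtain ⟨m, hm⟩ := hγ γ
  obtain ⟨b, hb, hxb⟩ := happrox x (m + 1)
  refine ⟨b, hγs ?_, hb⟩
  rw [Set.mem_ofPred_eq, Valuation.restrict_lt_iff_lt_embedding, hm]
  change valD k D (b - x) < _
  rw [Valuation.map_sub_swap]
  exact hxb.trans_lt ((zpow_lt_zpow_iff_right_of_lt_one₀ h0 hp.lt_one).2 (lt_add_one m))

theorem res_algebraMap_smul {c : k} (hc : Valued.v c ≤ 1) {y : D} (hy : valD k D y ≤ 1) :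
    res k D (c • y) = IsLocalRing.residue 𝒪[k] ⟨c, hc⟩ • res k D y := by
  rw [Algebra.smul_def, Algebra.smul_def, algebraMap_residue,
    res_mul (valD_algebraMap_le_one_iff.2 hc) hy]

theorem valD_algebraMap_smul (c : k) (y : D) :
    valD k D (c • y) = valD k D (algebraMap k D c) * valD k D y := by
  rw [Algebra.smul_def, map_mul]

/-- After division by a largest coefficient, independence of the residues excludes cancellation, so
the value of the sum is that of this coefficient. -/
theorem exists_valD_sum_smul_eq {ι : Type*} [Fintype ι] {y : ι → D} (hy : ∀ i, valD k D (y i) ≤ 1)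
    (hli : LinearIndependent 𝓀[k] fun i => res k D (y i)) {c : ι → k} (hc : c ≠ 0) :
    ∃ a : k, a ≠ 0 ∧ valD k D (∑ i, c i • y i) = valD k D (algebraMap k D a) := by
  obtain ⟨i₁, hi₁⟩ := Function.ne_iff.1 hc
  have : Nonempty ι := ⟨i₁⟩
  obtain ⟨i₀, hi₀⟩ := Finite.exists_max fun i => Valued.v (c i)
  have h0 : c i₀ ≠ 0 := fun h0 => hi₁ <| by
    have := hi₀ i₁
    rw [h0, map_zero, le_zero_iff, Valuation.zero_iff] at this
    exact this
  refine ⟨c i₀, h0, ?_⟩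
  have hd : ∀ i, Valued.v ((c i₀)⁻¹ * c i) ≤ 1 := fun i => by
    rw [map_mul, map_inv₀, mul_comm]
    exact mul_inv_le_of_le_mul₀ zero_le zero_le (by rw [one_mul]; exact hi₀ i)
  have hterm : ∀ i, valD k D (((c i₀)⁻¹ * c i) • y i) ≤ 1 := fun i => by
    rw [valD_algebraMap_smul]
    exact mul_le_one' (valD_algebraMap_le_one_iff.2 (hd i)) (hy i)
  have hsum : ∑ i, c i • y i = c i₀ • ∑ i, ((c i₀)⁻¹ * c i) • y i := by
    rw [Finset.smul_sum]
    refine Finset.sum_congr rfl fun i _ => ?_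
    rw [smul_smul, mul_inv_cancel_left₀ h0]
  rw [hsum, valD_algebraMap_smul, (res_ne_zero ((valD k D).map_sum_le fun i _ => hterm i)).1,
    mul_one]
  intro h
  rw [res_sum _ fun i _ => hterm i] at h
  simp only [fun i => res_algebraMap_smul (hd i) (hy i)] at h
  have h1 := Fintype.linearIndependent_iff.1 hli
    (fun i => IsLocalRing.residue 𝒪[k] ⟨(c i₀)⁻¹ * c i, hd i⟩) h i₀
  rw [IsLocalRing.residue_eq_zero_iff, IsLocalRing.mem_maximalIdeal, mem_nonunits_iff] at h1
  refine h1 ?_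
  convert isUnit_one
  exact Subtype.ext (inv_mul_cancel₀ h0)

theorem linearIndependent_of_res {ι : Type*} [Fintype ι] {y : ι → D}
    (hy : ∀ i, valD k D (y i) ≤ 1) (hli : LinearIndependent 𝓀[k] fun i => res k D (y i)) :
    LinearIndependent k y := by
  rw [Fintype.linearIndependent_iff]
  intro c hc
  by_contra! h
  obtain ⟨a, ha, h⟩ := exists_valD_sum_smul_eq hy hli (c := c) fun h0 => by simp [h0] at h
  rw [hc, map_zero, eq_comm, Valuation.zero_iff] at h
  exact ha ((map_eq_zero _).1 h)

/-- If the value group of `D` is larger than that of `k`, then lifts of independent families, in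
the degrees `0` and `1`, are independent. -/
theorem linearIndependent_sum_of_res {p : D} (hp : p ≠ 0)
    (hram : ∀ a : k, valD k D p ≠ valD k D (algebraMap k D a)) {ι κ : Type*} [Fintype ι]
    [Fintype κ] {y : ι → D} {z : κ → D}
    (hy : ∀ i, valD k D (y i) ≤ 1) (hz : ∀ i, valD k D (z i) ≤ 1)
    (hliy : LinearIndependent 𝓀[k] fun i => res k D (y i))
    (hliz : LinearIndependent 𝓀[k] fun i => res k D (z i)) :
    LinearIndependent k (Sum.elim y fun i => p * z i) := by
  have hliy' := linearIndependent_of_res (y := y) hy hliy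
  have hliz' := linearIndependent_of_res (y := z) hz hliz
  rw [Fintype.linearIndependent_iff] at hliy' hliz'
  rw [Fintype.linearIndependent_iff]
  intro c hc
  rw [Fintype.sum_sum_type] at hc
  simp only [Sum.elim_inl, Sum.elim_inr, ← mul_smul_comm] at hc
  rw [← Finset.mul_sum] at hc
  have hc2 : (fun i => c (Sum.inr i)) = 0 := by
    by_contra hc2
    obtain ⟨b, hb, hb'⟩ := exists_valD_sum_smul_eq hz hliz hc2
    have h2 := congrArg (valD k D) (eq_neg_of_add_eq_zero_right hc)
    rw [map_mul, hb', Valuation.map_neg] at h2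
    have hb0 : valD k D (algebraMap k D b) ≠ 0 :=
      (valD k D).ne_zero_iff.2 ((map_ne_zero _).2 hb)
    by_cases hc1 : (fun i => c (Sum.inl i)) = 0
    · have : ∀ i, c (Sum.inl i) = 0 := fun i => congrFun hc1 i
      simp only [this, zero_smul, Finset.sum_const_zero, map_zero] at h2
      exact mul_ne_zero ((valD k D).ne_zero_iff.2 hp) hb0 h2
    · obtain ⟨a, ha, ha'⟩ := exists_valD_sum_smul_eq hy hliy hc1
      refine hram (a / b) ?_
      rw [map_div₀, map_div₀, eq_div_iff hb0, h2, ha']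
  have h2 : ∀ i, c (Sum.inr i) = 0 := fun i => congrFun hc2 i
  simp only [h2, zero_smul, Finset.sum_const_zero, mul_zero, add_zero] at hc
  rintro (i | i)
  · exact hliy' _ hc i
  · exact h2 i

/-- Independent residues have independent lifts, which bounds the dimension by `[D : k]`. -/
instance finiteDimensional_residueAlgebra : FiniteDimensional 𝓀[k] (ResidueAlgebra k D) := by
  have : Module.rank 𝓀[k] (ResidueAlgebra k D) ≤ (finrank k D : ℕ) := by
    refine rank_le fun s hs => ?_
    choose y hy hys using fun i : s => exists_res_eq (i : ResidueAlgebra k D)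
    have := linearIndependent_of_res hy (by simpa only [hys] using hs)
    simpa using this.fintype_card_le_finrank
  exact Module.rank_lt_aleph0_iff.1 (this.trans_lt (Cardinal.natCast_lt_aleph0))

/-- The fundamental inequality (in fact an equality) bounding `[D : k]` by `e f`. -/
theorem finrank_le_mul_finrank_residueAlgebra {p : D} (hp : IsUnif k p) {c : k} {e : ℕ}
    (he : e ≠ 0) (hc : valD k D (algebraMap k D c) = valD k D p ^ e) :
    finrank k D ≤ e * finrank 𝓀[k] (ResidueAlgebra k D) := by
  let B := Module.finBasis 𝓀[k] (ResidueAlgebra k D)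
  choose y hy hyB using fun i => exists_res_eq (B i)
  -- The products of the first `e` powers of `p` with lifts of a residue basis span: any `x` is a
  -- power of `c` times some `p ^ r`, `r < e`, times a unit, whose residue can be expanded in the
  -- basis.
  let g : Fin e × Fin (finrank 𝓀[k] (ResidueAlgebra k D)) → D := fun i => p ^ (i.1 : ℕ) * y i.2
  have htop : Submodule.span k (Set.range g) = ⊤ := by
    refine eq_top_of_forall_exists_valD_sub_lt _ fun x hx => ?_
    obtain ⟨j, hj⟩ := hp.exists_zpow x hx
    have hc0 : algebraMap k D c ≠ 0 := fun h0 => by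
      rw [h0, map_zero] at hc
      exact pow_ne_zero _ hp.valD_ne_zero hc.symm
    have he0 : (e : ℤ) ≠ 0 := by exact_mod_cast he
    obtain ⟨r, hr⟩ : ∃ r : ℕ, (r : ℤ) = j % e := ⟨_, Int.toNat_of_nonneg (Int.emod_nonneg _ he0)⟩
    have hre : r < e := by
      have := Int.emod_lt_of_pos j (by omega : 0 < (e : ℤ))
      omega
    let s := (p ^ r)⁻¹ * ((algebraMap k D c) ^ (j / e))⁻¹ * x
    have hs : valD k D s = 1 := by
      have : (e : ℤ) * (j / e) + r = j := by rw [hr]; exact Int.mul_ediv_add_emod j e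
      rw [map_mul, map_mul, map_inv₀, map_inv₀, map_zpow₀, map_pow, hc, hj]
      have h1 := hp.valD_ne_zero
      have h2 : valD k D p ^ j = (valD k D p ^ e) ^ (j / e) * valD k D p ^ r := by
        rw [← zpow_natCast _ r, ← zpow_natCast _ e, ← zpow_mul, ← zpow_add₀ h1, this]
      rw [h2, mul_assoc, inv_mul_cancel_left₀ (zpow_ne_zero _ (pow_ne_zero _ h1)),
        inv_mul_cancel₀ (pow_ne_zero _ h1)]
    choose a ha using fun i => IsLocalRing.residue_surjective (B.repr (res k D s) i)
    have hterm : ∀ i, valD k D ((a i : k) • y i) ≤ 1 := fun i => by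
      rw [valD_algebraMap_smul]
      exact mul_le_one' (valD_algebraMap_le_one_iff.2 (a i).2) (hy i)
    have hsum : valD k D (∑ i, (a i : k) • y i) ≤ 1 := (valD k D).map_sum_le fun i _ => hterm i
    have hlt : valD k D (s - ∑ i, (a i : k) • y i) < 1 := by
      rw [← res_eq_res hs.le hsum, res_sum _ fun i _ => hterm i]
      conv_lhs => rw [← B.sum_repr (res k D s)]
      refine Finset.sum_congr rfl fun i _ => ?_
      rw [res_algebraMap_smul (a i).2 (hy i), hyB, ← ha]
    have hxs : x = (algebraMap k D c) ^ (j / e) * (p ^ r * s) := by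
      have h1 := pow_ne_zero r hp.ne_zero
      have h2 := zpow_ne_zero (j / e) hc0
      simp only [s]
      rw [mul_assoc (p ^ r)⁻¹, mul_inv_cancel_left₀ h1, mul_inv_cancel_left₀ h2]
    refine ⟨(algebraMap k D c) ^ (j / e) * (p ^ r * ∑ i, (a i : k) • y i), ?_, ?_⟩
    · rw [← map_zpow₀, ← Algebra.smul_def, Finset.mul_sum]
      refine Submodule.smul_mem _ _ (Submodule.sum_mem _ fun i _ => ?_)
      rw [mul_smul_comm]
      exact Submodule.smul_mem _ _ (Submodule.subset_span ⟨(⟨r, hre⟩, i), rfl⟩)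
    · conv_lhs => rw [hxs]
      rw [← mul_sub, ← mul_sub, map_mul, map_mul, hxs, map_mul, map_mul, hs, mul_one]
      refine mul_lt_mul_of_pos_left (mul_lt_of_lt_one_right ?_ hlt) ?_ <;>
      · rw [zero_lt_iff, (valD k D).ne_zero_iff]
        first | exact pow_ne_zero r hp.ne_zero | exact zpow_ne_zero _ hc0
  have := finrank_range_le_card (R := k) (b := g)
  rw [Set.finrank, htop, finrank_top] at this
  simpa using this

end Dimension

/-! ### Types measured over a subfield of the center -/

section Center

variable (F E : Type*) [Field F] [DivisionRing E] [Algebra F E]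

/-- The center of an `F`-algebra is an `F`-algebra. -/
abbrev centerAlgebra : Algebra F (Subring.center E) :=
  ((algebraMap F E).codRestrict (Subring.center E) fun c =>
    Subring.mem_center_iff.2 fun x => (Algebra.commutes c x).symm).toAlgebra

theorem finiteDimensional_center_left [FiniteDimensional F E] :
    letI := centerAlgebra F E
    FiniteDimensional F (Subring.center E) := by
  let := centerAlgebra F E
  have : IsScalarTower F (Subring.center E) E := IsScalarTower.of_algebraMap_eq fun _ => rfl
  exact FiniteDimensional.left F (Subring.center E) E

theorem finiteDimensional_center_right [FiniteDimensional F E] :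
    FiniteDimensional (Subring.center E) E := by
  let := centerAlgebra F E
  have : IsScalarTower F (Subring.center E) E := IsScalarTower.of_algebraMap_eq fun _ => rfl
  exact FiniteDimensional.right F (Subring.center E) E

variable {F E}

/-- Passing from the center to `F` multiplies all dimensions by the same degree, so the type remains
the sign of the difference. Types over `k` and over its residue field can thus be compared without
knowing the center of the residue algebra. -/
theorem Involution.HasType.exists_finrank_sub [FiniteDimensional F E] (h2 : (2 : E) ≠ 0)
    {σ : Involution E} (hF : ∀ c : F, σ (algebraMap F E c) = algebraMap F E c) {ζ : ℤˣ}
    (h : σ.HasType ζ) :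
    ∃ m : ℕ, 0 < m ∧ (finrank F (signSpace (σ.toEnd hF) 1) : ℤ) -
      finrank F (signSpace (σ.toEnd hF) (-1)) = ζ * m := by
  obtain ⟨hσ, d, hd, hs⟩ := h
  let := centerAlgebra F E
  have : IsScalarTower F (Subring.center E) E := IsScalarTower.of_algebraMap_eq fun _ => rfl
  have := finiteDimensional_center_right F E
  have := finiteDimensional_center_left F E
  have hsum := finrank_signSpace_add (two_ne_zero_center h2) (T := σ.toEnd hσ.algebraMap) σ.invol'
  rw [Involution.sym_eq_signSpace] at hs
  have hr : ∀ ξ : ℤˣ, finrank F (signSpace (σ.toEnd hF) ξ) = finrank F (Subring.center E) *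
      finrank (Subring.center E) (signSpace (σ.toEnd hσ.algebraMap) ξ) := fun ξ => by
    rw [finrank_mul_finrank]
    rfl
  have hd0 : 0 < d := Nat.pos_of_ne_zero fun h0 => by
    have : 0 < finrank (Subring.center E) E := finrank_pos
    rw [hd, h0] at this
    exact absurd this (by norm_num)
  refine ⟨finrank F (Subring.center E) * d, Nat.mul_pos finrank_pos hd0, ?_⟩
  rw [hr, hr]
  rw [hd] at hsum
  zify at hsum
  push_cast
  have : (finrank (Subring.center E) (signSpace (σ.toEnd hσ.algebraMap) 1) : ℤ) -
      finrank (Subring.center E) (signSpace (σ.toEnd hσ.algebraMap) (-1)) = ζ * d := by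
    linear_combination hs - hsum
  linear_combination (finrank F (Subring.center E) : ℤ) * this

/-- Multiplication by the central skew element `l` exchanges symmetric and skew elements. Used for
both signs, it shows that a unitary involution has equally many of each. -/
theorem finrank_signSpace_le_of_skew [FiniteDimensional F E] {σ : Involution E}
    (hF : ∀ c : F, σ (algebraMap F E c) = algebraMap F E c) {l : E} (hl : l ∈ Subring.center E)
    (hl0 : l ≠ 0) (hσl : σ l = -l) (ξ : ℤˣ) :
    finrank F (signSpace (σ.toEnd hF) ξ) ≤ finrank F (signSpace (σ.toEnd hF) (-ξ)) := by
  let f : signSpace (σ.toEnd hF) ξ →ₗ[F] signSpace (σ.toEnd hF) (-ξ) :=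
    ((LinearMap.mulLeft F l).restrict (p := signSpace (σ.toEnd hF) ξ) fun x hx => by
      rw [mem_signSpace] at hx ⊢
      change σ x = ξ • x at hx
      change σ (l * x) = -ξ • (l * x)
      rw [σ.map_mul', hσl, hx, mul_neg, Units.neg_smul, smul_mul_assoc,
        Subring.mem_center_iff.1 hl])
  refine LinearMap.finrank_le_finrank_of_injective (f := f) fun x y hxy => ?_
  exact Subtype.ext (mul_left_cancel₀ hl0 (congrArg Subtype.val hxy))

end Center

theorem card_le_finrank_of_mem {F V : Type*} [Field F] [AddCommGroup V] [Module F V]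
    [FiniteDimensional F V] {ι : Type*} [Fintype ι] {y : ι → V} (hy : LinearIndependent F y)
    {S : Submodule F V} (hS : ∀ i, y i ∈ S) : Fintype.card ι ≤ finrank F S := by
  have : LinearIndependent F fun i => (⟨y i, hS i⟩ : S) := LinearIndependent.of_comp S.subtype hy
  exact this.fintype_card_le_finrank

theorem sign_eq_of_mul_eq {ζ ξ : ℤˣ} {m m' : ℕ} (hm : 0 < m) (hm' : 0 < m') {a : ℤ}
    (h : a = ζ * m) (h' : a = ξ * m') : ξ = ζ := by
  rcases Int.units_eq_one_or ζ with rfl | rfl <;> rcases Int.units_eq_one_or ξ with rfl | rfl <;>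
  simp only [Units.val_one, Units.val_neg] at h h' ⊢ <;> omega

/-! ### The type of the residue involution -/

section ResidueType

variable {k : Type*} [Field k] {Γ₀ : Type*} [LinearOrderedCommGroupWithZero Γ₀]
  [Valued k Γ₀] [CompleteSpace k] [(Valued.v : Valuation k Γ₀).IsRankOneDiscrete]
  {D : Type*} [DivisionRing D] [Algebra k D] [FiniteDimensional k D]

theorem resInvolution_algebraMap {σ : Involution D}
    (hσ : ∀ c : k, σ (algebraMap k D c) = algebraMap k D c)
    (hw : ∀ x, valD k D (σ x) = valD k D x) (c : 𝓀[k]) :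
    resInvolution σ hw (algebraMap 𝓀[k] (ResidueAlgebra k D) c) = algebraMap _ _ c := by
  obtain ⟨c, rfl⟩ := IsLocalRing.residue_surjective c
  rw [algebraMap_residue, resInvolution_res σ hw (valD_algebraMap_le_one_iff.2 c.2), hσ]

theorem two_ne_zero_residueAlgebra (h2 : (2 : 𝓀[k]) ≠ 0) : (2 : ResidueAlgebra k D) ≠ 0 := by
  rw [← map_ofNat (algebraMap 𝓀[k] (ResidueAlgebra k D)) 2]
  exact (map_ne_zero _).2 h2

theorem Involution.conj_algebraMap {σ : Involution D}
    (hσ : ∀ c : k, σ (algebraMap k D c) = algebraMap k D c) {p : D} {δ : ℤˣ} (hp : p ≠ 0)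
    (hδ : σ p = δ • p) (c : k) : σ.conj hp hδ (algebraMap k D c) = algebraMap k D c := by
  rw [Involution.conj_apply, hσ, ← Algebra.commutes, mul_assoc, inv_mul_cancel₀ hp, mul_one]

theorem exists_lift_signSpace (h2 : (2 : 𝓀[k]) ≠ 0) {σ : Involution D}
    (hσ : ∀ c : k, σ (algebraMap k D c) = algebraMap k D c)
    (hw : ∀ x, valD k D (σ x) = valD k D x) (ξ : ℤˣ) :
    ∃ y : Fin (finrank 𝓀[k] (signSpace ((resInvolution σ hw).toEnd
        (resInvolution_algebraMap hσ hw)) ξ)) → D,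
      (∀ i, valD k D (y i) ≤ 1) ∧ (LinearIndependent 𝓀[k] fun i => res k D (y i)) ∧
        ∀ i, σ (y i) = ξ • y i := by
  let B := Module.finBasis 𝓀[k] (signSpace ((resInvolution σ hw).toEnd
        (resInvolution_algebraMap hσ hw)) ξ)
  choose y hy hyσ hyr using fun i => exists_res_eq_symm h2 σ hw (mem_signSpace.1 (B i).2)
  refine ⟨y, hy, ?_, hyσ⟩
  simp only [hyr]
  exact B.linearIndependent.map' (Submodule.subtype _) (Submodule.ker_subtype _)

/-- Lifting shows that the residue eigenspaces are no larger than those of `σ`, and the bound `hn`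
on total dimensions turns both inequalities into equalities. -/
theorem Involution.HasType.eq_of_res_unramified (h2 : (2 : 𝓀[k]) ≠ 0) {σ : Involution D}
    (hσ : ∀ c : k, σ (algebraMap k D c) = algebraMap k D c)
    (hw : ∀ x, valD k D (σ x) = valD k D x)
    (hn : finrank k D ≤ finrank 𝓀[k] (ResidueAlgebra k D)) {ζ ξ : ℤˣ} (h : σ.HasType ζ)
    (h' : (resInvolution σ hw).HasType ξ) : ξ = ζ := by
  have h2D : (2 : D) ≠ 0 := two_ne_zero_of_residue h2
  have h2k : (2 : k) ≠ 0 := fun h => h2D (by rw [← map_ofNat (algebraMap k D) 2, h, _root_.map_zero])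
  obtain ⟨m, hm, hs⟩ := h.exists_finrank_sub h2D hσ
  obtain ⟨m', hm', hs'⟩ := h'.exists_finrank_sub (two_ne_zero_residueAlgebra h2)
    (resInvolution_algebraMap hσ hw)
  have hle : ∀ ξ : ℤˣ, finrank 𝓀[k] (signSpace ((resInvolution σ hw).toEnd
        (resInvolution_algebraMap hσ hw)) ξ) ≤ finrank k (signSpace (σ.toEnd hσ) ξ) := fun ξ => by
    obtain ⟨y, hy, hli, hyσ⟩ := exists_lift_signSpace h2 hσ hw ξ
    have hli' := linearIndependent_of_res (y := y) hy hli
    have := card_le_finrank_of_mem hli' (S := signSpace (σ.toEnd hσ) ξ)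
      fun i => mem_signSpace.2 (hyσ i)
    simpa using this
  have h1 := hle 1
  have h3 := hle (-1)
  have h4 := finrank_signSpace_add h2k (T := σ.toEnd hσ) σ.invol'
  have h5 := finrank_signSpace_add h2 (T := (resInvolution σ hw).toEnd
        (resInvolution_algebraMap hσ hw)) (resInvolution σ hw).invol'
  exact sign_eq_of_mul_eq hm hm' hs (by rw [← hs']; omega)

/-- The eigenspaces of `σ` contain lifts in the degrees `0` and `1`, from the residues of `σ` and of
its conjugate by `p`; `hn` forces equality. The second residue is not of the first kind, so it
contributes equally to both eigenspaces and does not affect their difference. -/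
theorem Involution.HasType.eq_of_res_ramified (h2 : (2 : 𝓀[k]) ≠ 0) {σ : Involution D}
    (hσ : ∀ c : k, σ (algebraMap k D c) = algebraMap k D c)
    (hw : ∀ x, valD k D (σ x) = valD k D x) {p : D} (hp : p ≠ 0) {δ : ℤˣ} (hδ : σ p = δ • p)
    (hram : ∀ a : k, valD k D p ≠ valD k D (algebraMap k D a))
    (hn : finrank k D ≤ 2 * finrank 𝓀[k] (ResidueAlgebra k D))
    (hunit : ¬ (resInvolution (σ.conj hp hδ) (valD_conj σ hw hp hδ)).IsFirstKind)
    {ζ ξ : ℤˣ} (h : σ.HasType ζ) (h' : (resInvolution σ hw).HasType ξ) : ξ = ζ := by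
  have h2D : (2 : D) ≠ 0 := two_ne_zero_of_residue h2
  have h2k : (2 : k) ≠ 0 := fun h => h2D (by rw [← map_ofNat (algebraMap k D) 2, h, _root_.map_zero])
  have hσ' := Involution.conj_algebraMap hσ hp hδ
  have hw' := valD_conj σ hw hp hδ
  obtain ⟨m, hm, hs⟩ := h.exists_finrank_sub h2D hσ
  obtain ⟨m', hm', hs'⟩ := h'.exists_finrank_sub (two_ne_zero_residueAlgebra h2)
    (resInvolution_algebraMap hσ hw)
  obtain ⟨l, hl, hl0, hlσ⟩ := Involution.exists_skew_center hunit
  have h7 := finrank_signSpace_le_of_skew (resInvolution_algebraMap hσ' hw') hl hl0 hlσ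
  have hle : ∀ ξ : ℤˣ, finrank 𝓀[k] (signSpace ((resInvolution σ hw).toEnd
        (resInvolution_algebraMap hσ hw)) ξ) +
      finrank 𝓀[k] (signSpace ((resInvolution (σ.conj hp hδ) hw').toEnd
        (resInvolution_algebraMap hσ' hw')) (δ * ξ)) ≤ finrank k (signSpace (σ.toEnd hσ) ξ) :=
      fun ξ => by
    obtain ⟨y, hy, hliy, hyσ⟩ := exists_lift_signSpace h2 hσ hw ξ
    obtain ⟨z, hz, hliz, hzσ⟩ := exists_lift_signSpace h2 hσ' hw' (δ * ξ)
    have := card_le_finrank_of_mem (linearIndependent_sum_of_res hp hram hy hz hliy hliz)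
      (S := signSpace (σ.toEnd hσ) ξ) (by
        rintro (i | i)
        · exact mem_signSpace.2 (hyσ i)
        · refine mem_signSpace.2 ?_
          change σ (p * z i) = ξ • (p * z i)
          rw [σ.map_mul', hδ, mul_smul_comm, ← Involution.mul_conj_apply σ hp hδ, hzσ,
            mul_smul_comm, smul_smul, ← mul_assoc, Int.units_mul_self, one_mul])
    simpa using this
  have h1 := hle 1
  have h3 := hle (-1)
  have h4 := finrank_signSpace_add h2k (T := σ.toEnd hσ) σ.invol'
  have h5 := finrank_signSpace_add h2 (T := (resInvolution σ hw).toEnd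
        (resInvolution_algebraMap hσ hw)) (resInvolution σ hw).invol'
  have h6 := finrank_signSpace_add h2 (T := (resInvolution (σ.conj hp hδ) hw').toEnd
        (resInvolution_algebraMap hσ' hw')) (resInvolution (σ.conj hp hδ) hw').invol'
  have h8 := h7 1
  have h9 := h7 (-1)
  rw [neg_neg] at h9
  rw [mul_one] at h1
  rw [mul_neg_one] at h3
  refine sign_eq_of_mul_eq hm hm' hs ?_
  rw [← hs']
  rcases Int.units_eq_one_or δ with rfl | rfl
  · omega
  · rw [neg_neg] at h3
    omega

end ResidueType

/-- An involution acts on the center as a field automorphism. -/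
def Involution.centerEquiv {F E : Type*} [Field F] [DivisionRing E] [Algebra F E]
    (σ : Involution E) (hF : ∀ c : F, σ (algebraMap F E c) = algebraMap F E c) :
    letI := centerAlgebra F E
    Subring.center E ≃ₐ[F] Subring.center E :=
  letI := centerAlgebra F E
  { toFun := fun z => ⟨σ z, σ.map_mem_center z.2⟩
    invFun := fun z => ⟨σ z, σ.map_mem_center z.2⟩
    left_inv := fun z => Subtype.ext (σ.invol' z)
    right_inv := fun z => Subtype.ext (σ.invol' z)
    map_add' := fun x y => Subtype.ext (σ.map_add' x y)
    map_mul' := fun x y => Subtype.ext (by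
      change σ (x * y) = σ x * σ y
      rw [σ.map_mul', Subring.mem_center_iff.1 (σ.map_mem_center x.2)])
    commutes' := fun c => Subtype.ext (hF c) }

/-- By Galois theory `α β` generates all automorphisms, so `α` is a power of it and commutes with
it. Hence `(α β)² = 1`, and `α` is `1` or `α β`; in the second case `β = 1`. -/
theorem dihedral_cases {F Z : Type*} [Field F] [Field Z] [Algebra F Z] [FiniteDimensional F Z]
    {α β : Z ≃ₐ[F] Z} (hα : ∀ z, α (α z) = z) (hβ : ∀ z, β (β z) = z)
    (hfix : ∀ z, α (β z) = z → z ∈ Set.range (algebraMap F Z)) :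
    (∀ z, α (β (α (β z))) = z) ∧ ((∀ z, z ∈ Set.range (algebraMap F Z)) ∨
      ((∀ z, α z = z) ∧ ∃ z, β z ≠ z) ∨ ((∀ z, β z = z) ∧ ∃ z, α z ≠ z)) := by
  have hα1 : α * α = 1 := AlgEquiv.ext hα
  have hβ1 : β * β = 1 := AlgEquiv.ext hβ
  have htop : Subgroup.zpowers (α * β) = ⊤ := by
    rw [← IntermediateField.fixingSubgroup_fixedField (Subgroup.zpowers (α * β)),
      ← IntermediateField.fixingSubgroup_bot]
    congr 1
    rw [eq_bot_iff]
    intro z hz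
    rw [IntermediateField.mem_bot]
    exact hfix z (hz ⟨α * β, Subgroup.mem_zpowers _⟩)
  obtain ⟨i, hi⟩ : ∃ i : ℤ, (α * β) ^ i = α := by
    rw [← Subgroup.mem_zpowers_iff, htop]
    exact Subgroup.mem_top α
  have hcomm : Commute α (α * β) := by
    have := (Commute.refl (α * β)).zpow_left i
    rwa [hi] at this
  have hsq : α * β * (α * β) = 1 := by
    have : α * β * (α * β) = α * (α * β) * β := by
      rw [hcomm.eq, mul_assoc (α * β)]
    rw [this, ← mul_assoc, hα1, one_mul, hβ1]
  refine ⟨fun z => DFunLike.congr_fun hsq z, ?_⟩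
  have hcases : α = 1 ∨ β = 1 := by
    rcases Int.even_or_odd' i with ⟨j, rfl | rfl⟩
    · left
      rw [← hi, zpow_mul, zpow_two, hsq, one_zpow]
    · right
      rw [zpow_add, zpow_mul, zpow_two, hsq, one_zpow, one_mul, zpow_one] at hi
      exact mul_eq_left.1 hi
  by_cases hall : ∀ z, z ∈ Set.range (algebraMap F Z)
  · exact Or.inl hall
  · right
    push Not at hall
    obtain ⟨z, hz⟩ := hall
    rcases hcases with rfl | rfl
    · exact Or.inl ⟨fun _ => rfl, z, fun h => hz (hfix z h)⟩
    · exact Or.inr ⟨fun _ => rfl, z, fun h => hz (hfix z h)⟩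

/-! ### Elements that are central up to higher order -/

section GradedCenter

variable {k : Type*} [Field k] {Γ₀ : Type*} [LinearOrderedCommGroupWithZero Γ₀]
  [Valued k Γ₀] [CompleteSpace k] [(Valued.v : Valuation k Γ₀).IsRankOneDiscrete]
  {D : Type*} [DivisionRing D] [Algebra k D] [FiniteDimensional k D]

theorem natDegree_minpoly_dvd_finrank (y : D) : (minpoly k y).natDegree ∣ finrank k D := by
  obtain ⟨p, _, φ, z, rfl⟩ := exists_field (k := k) y
  have : FiniteDimensional k (AdjoinRoot p) :=
    FiniteDimensional.of_injective φ.toLinearMap φ.toRingHom.injective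
  rw [minpoly.algHom_eq φ φ.toRingHom.injective]
  exact (minpoly.degree_dvd (Algebra.IsIntegral.isIntegral z)).trans
    (finrank_dvd_of_algHom ((Algebra.lmul k D).comp φ))

theorem valD_eq_of_sub_lt {x y : D} (h : valD k D (y - x) < valD k D y) :
    valD k D x = valD k D y := by
  rw [Valuation.map_sub_swap] at h
  exact Valuation.map_eq_of_sub_lt _ h

/-- Every conjugate of `y` is congruent to `y`, and a sum of `m = deg y` conjugates is some `a` in
`k`. So `a / m` approximates `y`: `m` divides `[D : k]`, hence is a unit at the residue
characteristic, which is not two. -/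
theorem exists_algebraMap_sub_lt [Algebra.IsCentral k D] (h2 : (2 : 𝓀[k]) ≠ 0)
    (hodd : ∀ q : ℕ, q.Prime → q ≠ 2 → ¬ q ∣ finrank k D) {y : D}
    (hc : ∀ x : D, x ≠ 0 → valD k D (x * y * x⁻¹ - y) < valD k D y) :
    ∃ a : k, valD k D (y - algebraMap k D a) < valD k D y := by
  obtain ⟨l, hl, hlen, a, ha⟩ := exists_sum_conj_eq (k := k) y
  have hy0 : 0 < valD k D y := zero_le.trans_lt (hc 1 one_ne_zero)
  have hsum : ∀ l : List D, (∀ z ∈ l, ∃ u : D, u ≠ 0 ∧ z = u * y * u⁻¹) →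
      valD k D (l.sum - l.length * y) < valD k D y := by
    intro l hl
    induction l with
    | nil => simpa using hy0
    | cons z l ih =>
      obtain ⟨u, hu, rfl⟩ := hl z (by simp)
      have h1 := ih fun z hz => hl z (by simp [hz])
      have : (u * y * u⁻¹ :: l).sum - ((u * y * u⁻¹ :: l).length : D) * y =
          (u * y * u⁻¹ - y) + (l.sum - l.length * y) := by
        rw [List.sum_cons, List.length_cons]
        push_cast
        noncomm_ring
      rw [this]
      exact (valD k D).map_add_lt (hc u hu) h1
  have h1 := hsum l hl
  rw [hlen, ← ha] at h1
  set m := (minpoly k y).natDegree with hm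
  have hm0 : 0 < m := minpoly.natDegree_pos (Algebra.IsIntegral.isIntegral y)
  have hmk : (m : 𝓀[k]) ≠ 0 := fun h0 => by
    obtain ⟨q, hq⟩ := CharP.exists 𝓀[k]
    have hqm := (CharP.cast_eq_zero_iff 𝓀[k] q m).1 h0
    rcases CharP.char_is_prime_or_zero 𝓀[k] q with hqp | rfl
    · refine hodd q hqp ?_ (hqm.trans (natDegree_minpoly_dvd_finrank y))
      rintro rfl
      exact h2 (by exact_mod_cast CharP.cast_eq_zero 𝓀[k] 2)
    · exact hm0.ne' (zero_dvd_iff.1 hqm)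
  have hwm := valD_natCast (D := D) hmk
  have hmD : (m : D) ≠ 0 := fun h => by simp [h] at hwm
  refine ⟨a / m, ?_⟩
  have h3 : valD k D ((m : D) * (y - algebraMap k D (a / m))) =
      valD k D (algebraMap k D a - m * y) := by
    rw [mul_sub, map_div₀, map_natCast, (Nat.cast_commute m (algebraMap k D a / m)).eq, div_mul_cancel₀ _ hmD,
      Valuation.map_sub_swap, (Nat.cast_commute m y).eq]
  rw [map_mul, hwm, one_mul] at h3
  rwa [h3]

/-- Elements commuting with `p` and with the units of the valuation ring up to higher order
are central up to higher order. -/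
theorem exists_algebraMap_of_commute [Algebra.IsCentral k D] (h2 : (2 : 𝓀[k]) ≠ 0)
    (hodd : ∀ q : ℕ, q.Prime → q ≠ 2 → ¬ q ∣ finrank k D) {p : D} (hp : IsUnif k p) {y : D}
    (hu : ∀ x : D, valD k D x = 1 → valD k D (x * y - y * x) < valD k D y)
    (hpy : valD k D (p * y - y * p) < valD k D p * valD k D y) :
    ∃ a : k, valD k D (y - algebraMap k D a) < valD k D y := by
  have hw0 : ∀ {x : D}, x ≠ 0 → 0 < valD k D x := fun hx =>
    zero_lt_iff.2 ((valD k D).ne_zero_iff.2 hx)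
  -- Commuting with `y` up to higher order is stable under products and inverses, and every nonzero
  -- element is a unit times a power of `p`.
  have hmul : ∀ x x' : D, x ≠ 0 → x' ≠ 0 →
      valD k D (x * y - y * x) < valD k D x * valD k D y →
      valD k D (x' * y - y * x') < valD k D x' * valD k D y →
      valD k D (x * x' * y - y * (x * x')) < valD k D (x * x') * valD k D y := by
    intro x x' hx hx' h h'
    have : x * x' * y - y * (x * x') = x * (x' * y - y * x') + (x * y - y * x) * x' := by
      noncomm_ring
    rw [this, map_mul (valD k D) x x']
    refine (valD k D).map_add_lt ?_ ?_
    · rw [map_mul, mul_assoc]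
      exact mul_lt_mul_of_pos_left h' (hw0 hx)
    · rw [map_mul, mul_right_comm]
      exact mul_lt_mul_of_pos_right h (hw0 hx')
  have hinv : ∀ x : D, x ≠ 0 → valD k D (x * y - y * x) < valD k D x * valD k D y →
      valD k D (x⁻¹ * y - y * x⁻¹) < valD k D x⁻¹ * valD k D y := by
    intro x hx h
    have : x⁻¹ * y - y * x⁻¹ = x⁻¹ * (y * x - x * y) * x⁻¹ := by
      rw [mul_sub, sub_mul, ← mul_assoc, mul_inv_cancel_right₀ hx, ← mul_assoc,
        inv_mul_cancel₀ hx, one_mul]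
    rw [this, map_mul, map_mul, Valuation.map_sub_swap]
    have hx' := hw0 (inv_ne_zero hx)
    calc valD k D x⁻¹ * valD k D (x * y - y * x) * valD k D x⁻¹
        < valD k D x⁻¹ * (valD k D x * valD k D y) * valD k D x⁻¹ :=
          mul_lt_mul_of_pos_right (mul_lt_mul_of_pos_left h hx') hx'
      _ = valD k D x⁻¹ * valD k D y := by
          rw [← mul_assoc, ← map_mul, inv_mul_cancel₀ hx, map_one, one_mul, mul_comm]
  have hpow : ∀ n : ℕ, valD k D (p ^ n * y - y * p ^ n) < valD k D (p ^ n) * valD k D y := by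
    intro n
    have hy0 : 0 < valD k D y := zero_le.trans_lt (hu 1 (map_one _))
    induction n with
    | zero => simpa using hy0
    | succ n ih => rw [pow_succ]; exact hmul _ _ (pow_ne_zero n hp.ne_zero) hp.ne_zero ih hpy
  have hzpow : ∀ n : ℤ, valD k D (p ^ n * y - y * p ^ n) < valD k D (p ^ n) * valD k D y := by
    intro n
    obtain ⟨m, rfl | rfl⟩ := n.eq_nat_or_neg
    · simpa using hpow m
    · rw [zpow_neg, zpow_natCast]
      exact hinv _ (pow_ne_zero m hp.ne_zero) (hpow m)
  refine exists_algebraMap_sub_lt h2 hodd fun x hx => ?_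
  obtain ⟨j, hj⟩ := hp.exists_zpow x hx
  have hpj := zpow_ne_zero j hp.ne_zero
  have hu1 : valD k D (x * (p ^ j)⁻¹) = 1 := by
    rw [map_mul, map_inv₀, map_zpow₀, ← hj, mul_inv_cancel₀]
    exact (valD k D).ne_zero_iff.2 hx
  have h := hmul (x * (p ^ j)⁻¹) (p ^ j) (mul_ne_zero hx (inv_ne_zero hpj)) hpj
    (by rw [hu1, one_mul]; exact hu _ hu1) (hzpow j)
  rw [inv_mul_cancel_right₀ hpj] at h
  have h3 : x * y * x⁻¹ - y = (x * y - y * x) * x⁻¹ := by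
    rw [sub_mul, mul_inv_cancel_right₀ hx]
  rw [h3, map_mul, map_inv₀]
  exact mul_inv_lt_of_lt_mul₀ (by rwa [mul_comm])

theorem valD_conj_self {p : D} (hp : p ≠ 0) (x : D) : valD k D (p * x * p⁻¹) = valD k D x := by
  rw [map_mul, map_mul, map_inv₀, mul_right_comm, mul_inv_cancel₀, one_mul]
  exact (valD k D).ne_zero_iff.2 hp

/-- The automorphism of the residue algebra induced by conjugation. -/
def resConj {p : D} (hp : p ≠ 0) : ResidueAlgebra k D →+* ResidueAlgebra k D :=
  have key {x : D} (hx : valD k D x ≤ 1) : resLift (k := k) (fun x => p * x * p⁻¹) (res k D x) =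
      res k D (p * x * p⁻¹) :=
    resLift_res (fun x y => by rw [mul_add, add_mul]) (valD_conj_self hp) hx
  have le {x : D} (hx : valD k D x ≤ 1) : valD k D (p * x * p⁻¹) ≤ 1 := by
    rwa [valD_conj_self hp]
  { toFun := resLift fun x => p * x * p⁻¹
    map_zero' := by rw [← res_zero, key (by simp)]; simp
    map_one' := by rw [← res_one, key (by simp)]; simp [hp]
    map_add' := fun a b => by
      obtain ⟨x, hx, rfl⟩ := exists_res_eq a
      obtain ⟨y, hy, rfl⟩ := exists_res_eq b
      rw [← res_add hx hy, key hx, key hy, key ((valD k D).map_add_le hx hy),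
        ← res_add (le hx) (le hy), mul_add, add_mul]
    map_mul' := fun a b => by
      obtain ⟨x, hx, rfl⟩ := exists_res_eq a
      obtain ⟨y, hy, rfl⟩ := exists_res_eq b
      rw [← res_mul hx hy, key hx, key hy, key (by rw [map_mul]; exact mul_le_one' hx hy),
        ← res_mul (le hx) (le hy)]
      simp only [mul_assoc, inv_mul_cancel_left₀ hp] }

theorem resConj_res {p : D} (hp : p ≠ 0) {x : D} (hx : valD k D x ≤ 1) :
    resConj (k := k) hp (res k D x) = res k D (p * x * p⁻¹) :=
  resLift_res (fun x y => by rw [mul_add, add_mul]) (valD_conj_self hp) hx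

/-- Already in `D`, `σ (p⁻¹ σ(x) p) = p x p⁻¹`, since the two signs `δ` cancel. -/
theorem resInvolution_resInvolution_conj {σ : Involution D}
    (hw : ∀ x, valD k D (σ x) = valD k D x) {p : D} {δ : ℤˣ} (hp : p ≠ 0) (hδ : σ p = δ • p)
    (a : ResidueAlgebra k D) :
    resInvolution σ hw (resInvolution (σ.conj hp hδ) (valD_conj σ hw hp hδ) a) =
      resConj hp a := by
  obtain ⟨x, hx, rfl⟩ := exists_res_eq a
  rw [resInvolution_res _ _ hx, resInvolution_res _ _ (by rwa [valD_conj σ hw hp hδ]),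
    resConj_res hp hx, Involution.conj_apply, σ.map_mul', σ.map_mul', σ.invol', σ.map_inv, hδ]
  rcases Int.units_eq_one_or δ with rfl | rfl <;> simp [mul_assoc]

/-- A lift of `z` commutes with units and with `p` up to higher order, so it is congruent to an
element of `k`. -/
theorem mem_range_of_resConj_eq [Algebra.IsCentral k D] (h2 : (2 : 𝓀[k]) ≠ 0)
    (hodd : ∀ q : ℕ, q.Prime → q ≠ 2 → ¬ q ∣ finrank k D) {p : D} (hp : IsUnif k p)
    {z : ResidueAlgebra k D} (hz : z ∈ Subring.center (ResidueAlgebra k D))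
    (h : resConj hp.ne_zero z = z) :
    z ∈ Set.range (algebraMap 𝓀[k] (ResidueAlgebra k D)) := by
  obtain ⟨y, hy, rfl⟩ := exists_res_eq z
  by_cases h0 : res k D y = 0
  · exact ⟨0, by rw [h0, map_zero]⟩
  have hy1 := (res_ne_zero hy).1 h0
  rw [resConj_res _ hy, res_eq_res (by rwa [valD_conj_self hp.ne_zero]) hy] at h
  obtain ⟨a, ha⟩ := exists_algebraMap_of_commute h2 hodd hp (y := y) (fun x hx => by
      rw [hy1, ← res_eq_res (by rw [map_mul, hx, hy1, one_mul])
        (by rw [map_mul, hx, hy1, one_mul]), res_mul hx.le hy, res_mul hy hx.le]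
      exact Subring.mem_center_iff.1 hz _) (by
      have : p * y - y * p = (p * y * p⁻¹ - y) * p := by
        rw [sub_mul, inv_mul_cancel_right₀ hp.ne_zero]
      rw [this, map_mul, hy1, mul_one]
      exact mul_lt_of_lt_one_left (zero_lt_iff.2 hp.valD_ne_zero) h)
  have ha1 : valD k D (algebraMap k D a) ≤ 1 := (valD_eq_of_sub_lt ha).trans_le hy
  rw [hy1, ← res_eq_res hy ha1] at ha
  exact ⟨IsLocalRing.residue 𝒪[k] ⟨a, valD_algebraMap_le_one_iff.1 ha1⟩, by
    rw [algebraMap_residue, ha]⟩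

/-- If conjugation by `q` acts on residues as conjugation by `a`, and `u` lifts `a⁻¹`, then `u q` is
central up to higher order, hence has the value of an element of `k`. The conditions `hpq` and `hpa`
give the commutation with `p`. -/
theorem exists_valD_algebraMap_eq [Algebra.IsCentral k D] (h2 : (2 : 𝓀[k]) ≠ 0)
    (hodd : ∀ q : ℕ, q.Prime → q ≠ 2 → ¬ q ∣ finrank k D) {p : D} (hp : IsUnif k p) {q : D}
    (hq : q ≠ 0) (hpq : p * q = q * p) {a : ResidueAlgebra k D} (ha : a ≠ 0)
    (hpa : resConj hp.ne_zero a = a) (hqa : ∀ x, resConj hq x * a = a * x) :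
    ∃ c : k, valD k D q = valD k D (algebraMap k D c) := by
  obtain ⟨u, hu, hua⟩ := exists_res_eq a⁻¹
  have hu1 : valD k D u = 1 := (res_ne_zero hu).1 (by rw [hua]; exact inv_ne_zero ha)
  have hwq : 0 < valD k D q := zero_lt_iff.2 ((valD k D).ne_zero_iff.2 hq)
  have hpa' : resConj hp.ne_zero a⁻¹ = a⁻¹ := by rw [map_inv₀, hpa]
  have hwuq : valD k D (u * q) = valD k D q := by rw [map_mul, hu1, one_mul]
  obtain ⟨c, hc⟩ := exists_algebraMap_of_commute h2 hodd hp (y := u * q) (fun x hx => by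
      have hx' : valD k D (q * x * q⁻¹) = 1 := by rw [valD_conj_self hq, hx]
      have : x * (u * q) - u * q * x = (x * u - u * (q * x * q⁻¹)) * q := by
        rw [sub_mul, mul_assoc x, mul_assoc u (q * x * q⁻¹), inv_mul_cancel_right₀ hq, mul_assoc u]
      rw [this, hwuq, map_mul]
      refine mul_lt_of_lt_one_left hwq ?_
      rw [← res_eq_res (by rw [map_mul, hx, hu1, one_mul]) (by rw [map_mul, hx', hu1, one_mul]),
        res_mul hx.le hu, res_mul hu hx'.le, ← resConj_res hq hx.le, hua, eq_comm,
        inv_mul_eq_iff_eq_mul₀ ha, ← mul_assoc, eq_mul_inv_iff_mul_eq₀ ha]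
      exact hqa _) (by
      have hu' : valD k D (p * u * p⁻¹) = 1 := by rw [valD_conj_self hp.ne_zero, hu1]
      have : p * (u * q) - u * q * p = (p * u * p⁻¹ - u) * (p * q) := by
        rw [sub_mul, ← mul_assoc _ p q, inv_mul_cancel_right₀ hp.ne_zero, hpq]
        simp only [mul_assoc]
      rw [this, hwuq, map_mul, map_mul]
      refine mul_lt_of_lt_one_left (mul_pos (zero_lt_iff.2 hp.valD_ne_zero) hwq) ?_
      rw [← res_eq_res hu'.le hu, ← resConj_res hp.ne_zero hu, hua, hpa'])
  exact ⟨c, by rw [valD_eq_of_sub_lt hc, hwuq]⟩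

end GradedCenter

theorem resInvolution_congr {k : Type*} [Field k] {Γ₀ : Type*} [LinearOrderedCommGroupWithZero Γ₀]
    [Valued k Γ₀] [CompleteSpace k] [(Valued.v : Valuation k Γ₀).IsRankOneDiscrete]
    {D : Type*} [DivisionRing D] [Algebra k D] [FiniteDimensional k D] {σ τ : Involution D}
    (h : σ = τ) (hσ : ∀ x, valD k D (σ x) = valD k D x) (hτ : ∀ x, valD k D (τ x) = valD k D x) :
    resInvolution σ hσ = resInvolution τ hτ := by
  subst h
  rfl

/-! ### The unramified and ramified cases -/

section Main

variable {k : Type*} [Field k] {Γ₀ : Type*} [LinearOrderedCommGroupWithZero Γ₀]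
  [Valued k Γ₀] [CompleteSpace k] [(Valued.v : Valuation k Γ₀).IsRankOneDiscrete]
  {D : Type*} [DivisionRing D] [Algebra k D] [FiniteDimensional k D] [Algebra.IsCentral k D]

theorem IsUnif.isUnramified {p : D} (hp : IsUnif k p) {c : k}
    (hc : valD k D p = valD k D (algebraMap k D c)) : IsUnramified k D := fun x hx => by
  obtain ⟨j, hj⟩ := hp.exists_zpow x hx
  exact ⟨c ^ j, by rw [hj, hc, map_zpow₀, map_zpow₀]⟩

theorem resConj_algebraMap {σ : Involution D}
    (hσ : ∀ c : k, σ (algebraMap k D c) = algebraMap k D c) {p : D} {δ : ℤˣ} (hp : p ≠ 0)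
    (hδ : σ p = δ • p) (c : 𝓀[k]) :
    resConj hp (algebraMap 𝓀[k] (ResidueAlgebra k D) c) = algebraMap _ _ c := by
  have hw := valD_involution σ hσ
  rw [← resInvolution_resInvolution_conj hw hp hδ, resInvolution_algebraMap
    (Involution.conj_algebraMap hσ hp hδ), resInvolution_algebraMap hσ]

theorem isFirstKind_resInvolution {σ : Involution D}
    (hσ : ∀ c : k, σ (algebraMap k D c) = algebraMap k D c)
    (hw : ∀ x, valD k D (σ x) = valD k D x)
    (hc : ∀ z ∈ Subring.center (ResidueAlgebra k D),
      z ∈ Set.range (algebraMap 𝓀[k] (ResidueAlgebra k D))) :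
    (resInvolution σ hw).IsFirstKind := fun z hz => by
  obtain ⟨c, rfl⟩ := hc z hz
  exact resInvolution_algebraMap hσ hw c

/-- Apply `dihedral_cases` to the two residue involutions on the center: their product is
conjugation by `p`, whose fixed field there is the residue field of `k`. -/
theorem resInvolution_center_cases (h2 : (2 : 𝓀[k]) ≠ 0)
    (hodd : ∀ q : ℕ, q.Prime → q ≠ 2 → ¬ q ∣ finrank k D) {σ : Involution D}
    (hσ : ∀ c : k, σ (algebraMap k D c) = algebraMap k D c)
    (hw : ∀ x, valD k D (σ x) = valD k D x) {p : D} (hp : IsUnif k p) {δ : ℤˣ}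
    (hδ : σ p = δ • p) :
    (∀ z ∈ Subring.center (ResidueAlgebra k D), resConj hp.ne_zero (resConj hp.ne_zero z) = z) ∧
    ((∀ z ∈ Subring.center (ResidueAlgebra k D),
        z ∈ Set.range (algebraMap 𝓀[k] (ResidueAlgebra k D))) ∨
      ((resInvolution σ hw).IsFirstKind ∧
        ¬ (resInvolution (σ.conj hp.ne_zero hδ) (valD_conj σ hw hp.ne_zero hδ)).IsFirstKind) ∨
      ((resInvolution (σ.conj hp.ne_zero hδ) (valD_conj σ hw hp.ne_zero hδ)).IsFirstKind ∧
        ¬ (resInvolution σ hw).IsFirstKind)) := by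
  let := centerAlgebra 𝓀[k] (ResidueAlgebra k D)
  have := finiteDimensional_center_left 𝓀[k] (ResidueAlgebra k D)
  let σ₀ := resInvolution σ hw
  let σ₁ := resInvolution (σ.conj hp.ne_zero hδ) (valD_conj σ hw hp.ne_zero hδ)
  let α := σ₀.centerEquiv (resInvolution_algebraMap hσ hw)
  let β := σ₁.centerEquiv (resInvolution_algebraMap (Involution.conj_algebraMap hσ hp.ne_zero hδ)
    (valD_conj σ hw hp.ne_zero hδ))
  have hθ : ∀ z : Subring.center (ResidueAlgebra k D),
      ((α (β z) : Subring.center (ResidueAlgebra k D)) : ResidueAlgebra k D) =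
        resConj hp.ne_zero z := fun z => resInvolution_resInvolution_conj hw hp.ne_zero hδ z
  have hrange : ∀ z : Subring.center (ResidueAlgebra k D),
      (z : ResidueAlgebra k D) ∈ Set.range (algebraMap 𝓀[k] (ResidueAlgebra k D)) ↔
        z ∈ Set.range (algebraMap 𝓀[k] (Subring.center (ResidueAlgebra k D))) := fun z =>
    exists_congr fun c => ⟨fun h => Subtype.ext h, fun h => congrArg Subtype.val h⟩
  obtain ⟨h1, h⟩ := dihedral_cases (α := α) (β := β) (fun z => Subtype.ext (σ₀.invol' z))
    (fun z => Subtype.ext (σ₁.invol' z)) fun z hz => (hrange z).1 <|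
      mem_range_of_resConj_eq h2 hodd hp z.2 (by rw [← hθ, hz])
  refine ⟨fun z hz => ?_, ?_⟩
  · have := congrArg Subtype.val (h1 ⟨z, hz⟩)
    rwa [hθ, hθ] at this
  · refine h.imp (fun h z hz => (hrange ⟨z, hz⟩).2 (h _)) (Or.imp ?_ ?_)
    · rintro ⟨ha, z, hz⟩
      exact ⟨fun z hz => congrArg Subtype.val (ha ⟨z, hz⟩),
        fun h => hz (Subtype.ext (h z z.2))⟩
    · rintro ⟨ha, z, hz⟩
      exact ⟨fun z hz => congrArg Subtype.val (ha ⟨z, hz⟩),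
        fun h => hz (Subtype.ext (h z z.2))⟩

/-- When the residue algebra is central, conjugation by `p` acts on it as an inner automorphism by
Skolem–Noether, so `p` has the value of an element of `k`. -/
theorem isUnramified_of_center (h2 : (2 : 𝓀[k]) ≠ 0)
    (hodd : ∀ q : ℕ, q.Prime → q ≠ 2 → ¬ q ∣ finrank k D) {σ : Involution D}
    (hσ : ∀ c : k, σ (algebraMap k D c) = algebraMap k D c) {p : D} (hp : IsUnif k p) {δ : ℤˣ}
    (hδ : σ p = δ • p)
    (hc : ∀ z ∈ Subring.center (ResidueAlgebra k D),
      z ∈ Set.range (algebraMap 𝓀[k] (ResidueAlgebra k D))) : IsUnramified k D := by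
  have : Algebra.IsCentral 𝓀[k] (ResidueAlgebra k D) := ⟨fun z hz => by
    rw [Algebra.mem_bot]
    exact hc z hz⟩
  let θ : ResidueAlgebra k D →ₐ[𝓀[k]] ResidueAlgebra k D :=
    { resConj hp.ne_zero with commutes' := resConj_algebraMap hσ hp.ne_zero hδ }
  obtain ⟨a, ha, h⟩ := exists_intertwiner θ
  obtain ⟨c, hc⟩ := exists_valD_algebraMap_eq h2 hodd hp hp.ne_zero rfl ha
    (mul_right_cancel₀ ha (h a)) h
  exact hp.isUnramified hc

theorem resConj_mul_self {p : D} (hp : p ≠ 0) (a : ResidueAlgebra k D) :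
    resConj (mul_ne_zero hp hp) a = resConj hp (resConj hp a) := by
  obtain ⟨x, hx, rfl⟩ := exists_res_eq a
  rw [resConj_res _ hx, resConj_res _ hx, resConj_res _ (by rwa [valD_conj_self hp])]
  congr 1
  simp only [mul_inv_rev, mul_assoc]

/-- The square of conjugation by `p` fixes the center, so it is inner on the residue algebra. This
bounds the ramification index by two. -/
theorem exists_valD_algebraMap_eq_sq (h2 : (2 : 𝓀[k]) ≠ 0)
    (hodd : ∀ q : ℕ, q.Prime → q ≠ 2 → ¬ q ∣ finrank k D) {p : D} (hp : IsUnif k p)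
    (hsq : ∀ z ∈ Subring.center (ResidueAlgebra k D),
      resConj hp.ne_zero (resConj hp.ne_zero z) = z)
    (hc : ¬ ∀ z ∈ Subring.center (ResidueAlgebra k D),
      z ∈ Set.range (algebraMap 𝓀[k] (ResidueAlgebra k D))) :
    ∃ c : k, valD k D (p * p) = valD k D (algebraMap k D c) := by
  have := finiteDimensional_center_right 𝓀[k] (ResidueAlgebra k D)
  let θ := resConj (k := k) hp.ne_zero
  let θ₂ : ResidueAlgebra k D →ₐ[Subring.center (ResidueAlgebra k D)] ResidueAlgebra k D :=
    { θ.comp θ with commutes' := fun z => hsq z z.2 }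
  obtain ⟨a, ha, h⟩ := exists_intertwiner θ₂
  have h' : ∀ x, θ (θ x) * a = a * x := h
  have haa : θ (θ a) = a := mul_right_cancel₀ ha (h' a)
  have hsurj : Function.Surjective θ := fun x =>
    ⟨θ (a⁻¹ * x * a), mul_right_cancel₀ ha (by rw [h', mul_assoc, mul_inv_cancel_left₀ ha])⟩
  have hθa : ∀ x, θ (θ x) * θ a = θ a * x := fun x => by
    obtain ⟨y, rfl⟩ := hsurj x
    rw [← map_mul, h', map_mul]
  -- The intertwiner must also be fixed by `θ`. Since `θ (θ a) = a`, take `a + θ a`; if that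
  -- vanishes, multiply `a` by `z - θ z` with `z` central and not fixed, which corrects the sign.
  obtain ⟨b, hb, hbθ, hbx⟩ : ∃ b, b ≠ 0 ∧ θ b = b ∧ ∀ x, θ (θ x) * b = b * x := by
    by_cases h0 : a + θ a = 0
    · push Not at hc
      obtain ⟨z, hz, hzr⟩ := hc
      have hz0 : z - θ z ≠ 0 := fun h =>
        hzr (mem_range_of_resConj_eq h2 hodd hp hz (sub_eq_zero.1 h).symm)
      have hzθ : θ (z - θ z) = -(z - θ z) := by
        rw [map_sub, hsq z hz, neg_sub]
      have hzc : ∀ x, x * (z - θ z) = (z - θ z) * x := fun x => by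
        obtain ⟨y, rfl⟩ := hsurj x
        rw [mul_sub, sub_mul, ← map_mul, ← map_mul, Subring.mem_center_iff.1 hz,
          Subring.mem_center_iff.1 hz]
      refine ⟨(z - θ z) * a, mul_ne_zero hz0 ha, ?_, fun x => ?_⟩
      · rw [map_mul, hzθ, eq_neg_of_add_eq_zero_right h0, neg_mul_neg]
      · rw [← mul_assoc, hzc, mul_assoc, h', mul_assoc]
    · refine ⟨a + θ a, h0, by rw [map_add, haa, add_comm], fun x => ?_⟩
      rw [mul_add, add_mul, h', hθa]
  exact exists_valD_algebraMap_eq h2 hodd hp (mul_ne_zero hp.ne_zero hp.ne_zero)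
    (mul_assoc _ _ _).symm hb hbθ fun x => by rw [resConj_mul_self]; exact hbx x

theorem isFirstKind_of_isCentral {σ : Involution D}
    (hσ : ∀ c : k, σ (algebraMap k D c) = algebraMap k D c) : σ.IsFirstKind := fun z hz => by
  obtain ⟨c, rfl⟩ := Algebra.mem_bot.1 (Algebra.IsCentral.out (K := k) (D := D) hz)
  exact hσ c

/-- A uniformizer taken from `k` is central and symmetric, so both residue involutions are that of
`σ`, with the same sign. -/
theorem uInvariant_of_isUnramified (h2 : (2 : 𝓀[k]) ≠ 0)
    (hodd : ∀ q : ℕ, q.Prime → q ≠ 2 → ¬ q ∣ finrank k D) {σ : Involution D}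
    (hσ : ∀ c : k, σ (algebraMap k D c) = algebraMap k D c) (hD : IsUnramified k D) :
    ∃ uplus uminus : ℕ∞, IsUPlus (ResidueAlgebra k D) uplus ∧
      IsUMinus (ResidueAlgebra k D) uminus ∧ IsUPlus D (2 * uplus) ∧ IsUMinus D (2 * uminus) := by
  have := finiteDimensional_center_right 𝓀[k] (ResidueAlgebra k D)
  have := finiteDimensional_center_right k D
  have h2D := two_ne_zero_of_residue (D := D) h2
  have h2E := two_ne_zero_residueAlgebra (D := D) h2
  obtain ⟨q, hq⟩ := exists_isUnif k D
  obtain ⟨c, hc⟩ := hD q hq.ne_zero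
  have hp : IsUnif k (algebraMap k D c) := hq.of_eq hc.symm
  have hδ : σ (algebraMap k D c) = (1 : ℤˣ) • algebraMap k D c := by rw [hσ, one_smul]
  have hw := valD_involution σ hσ
  have hcenter : ∀ z ∈ Subring.center (ResidueAlgebra k D),
      z ∈ Set.range (algebraMap 𝓀[k] (ResidueAlgebra k D)) := fun z hz =>
    mem_range_of_resConj_eq h2 hodd hp hz <| by
      obtain ⟨x, hx, rfl⟩ := exists_res_eq z
      rw [resConj_res _ hx, Algebra.commutes, mul_inv_cancel_right₀ hp.ne_zero]
  obtain ⟨ζ, hζ⟩ := (isFirstKind_of_isCentral hσ).exists_hasType h2D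
  obtain ⟨ξ, hξ⟩ := (isFirstKind_resInvolution hσ hw hcenter).exists_hasType h2E
  obtain rfl := hζ.eq_of_res_unramified h2 hσ hw
    (by simpa using finrank_le_mul_finrank_residueAlgebra hp one_ne_zero (pow_one _).symm) hξ
  have hconj : σ.conj hp.ne_zero hδ = σ := by
    have : ∀ x, σ.conj hp.ne_zero hδ x = σ x := fun x => by
      rw [Involution.conj_apply, mul_assoc, ← Algebra.commutes, inv_mul_cancel_left₀ hp.ne_zero]
    cases σ
    simp only [Involution.conj, Involution.mk.injEq]
    exact funext this
  have hu : ∀ ε, uInvariant σ ε = 2 * uInvariant (resInvolution σ hw) ε := fun ε => by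
    rw [uInvariant_eq_add h2 hσ hw hp hδ, resInvolution_congr hconj _ hw, one_mul, two_mul]
  refine ⟨_, _, isUPlus_of_hasType h2E hξ, isUMinus_of_hasType h2E hξ, ?_, ?_⟩
  · rw [← hu]
    exact isUPlus_of_hasType h2D hζ
  · rw [← hu]
    exact isUMinus_of_hasType h2D hζ

theorem uInvariant_of_isFirstKind_res (h2 : (2 : 𝓀[k]) ≠ 0)
    (hodd : ∀ q : ℕ, q.Prime → q ≠ 2 → ¬ q ∣ finrank k D) {σ : Involution D}
    (hσ : ∀ c : k, σ (algebraMap k D c) = algebraMap k D c)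
    (hw : ∀ x, valD k D (σ x) = valD k D x) (hk : (resInvolution σ hw).IsFirstKind)
    (hD : ¬ IsUnramified k D) :
    ∃ uzero uplus uminus : ℕ∞, IsUZero 𝓀[k] (ResidueAlgebra k D) uzero ∧
      IsUPlus (ResidueAlgebra k D) uplus ∧ IsUMinus (ResidueAlgebra k D) uminus ∧
      IsUPlus D (uzero + uplus) ∧ IsUMinus D (uzero + uminus) := by
  have := finiteDimensional_center_right 𝓀[k] (ResidueAlgebra k D)
  have := finiteDimensional_center_right k D
  have h2D := two_ne_zero_of_residue (D := D) h2
  have h2E := two_ne_zero_residueAlgebra (D := D) h2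
  obtain ⟨q, hq⟩ := exists_isUnif k D
  obtain ⟨p, δ, hp, hδ⟩ := hq.exists_skew h2 σ hw
  obtain ⟨hsq, hcases⟩ := resInvolution_center_cases h2 hodd hσ hw hp hδ
  have hc := fun hc => hD (isUnramified_of_center h2 hodd hσ hp hδ hc)
  obtain ⟨-, hk'⟩ := (hcases.resolve_left hc).resolve_right fun h => h.2 hk
  have hunit : (resInvolution (σ.conj hp.ne_zero hδ)
      (valD_conj σ hw hp.ne_zero hδ)).IsUnitary 𝓀[k] := by
    -- On the center the residue of `σ` is trivial, so what the other residue involution fixes is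
    -- also fixed by conjugation by `p`.
    refine ⟨hk', fun z hz => ⟨fun h => mem_range_of_resConj_eq h2 hodd hp hz ?_, ?_⟩⟩
    · rw [← resInvolution_resInvolution_conj hw hp.ne_zero hδ, h, hk z hz]
    · rintro ⟨c, rfl⟩
      exact resInvolution_algebraMap (Involution.conj_algebraMap hσ hp.ne_zero hδ) _ c
  obtain ⟨c, hc2⟩ := exists_valD_algebraMap_eq_sq h2 hodd hp hsq hc
  obtain ⟨ζ, hζ⟩ := (isFirstKind_of_isCentral hσ).exists_hasType h2D
  obtain ⟨ξ, hξ⟩ := hk.exists_hasType h2E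
  obtain rfl := hζ.eq_of_res_ramified h2 hσ hw hp.ne_zero hδ
    (fun a ha => hD (hp.isUnramified ha))
    (finrank_le_mul_finrank_residueAlgebra hp two_ne_zero (by rw [← hc2, map_mul, sq])) hk' hξ
  have h0 := isUZero_of_isUnitary h2E 𝓀[k] hunit 1
  -- The sign `δ * ε` of the second residue form is immaterial because that involution is unitary.
  have hu : ∀ ε, uInvariant σ ε = uInvariant (resInvolution (σ.conj hp.ne_zero hδ)
      (valD_conj σ hw hp.ne_zero hδ)) 1 + uInvariant (resInvolution σ hw) ε := fun ε => by
    rw [uInvariant_eq_add h2 hσ hw hp hδ, h0.2 _ (δ * ε) hunit, add_comm]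
  refine ⟨_, _, _, h0, isUPlus_of_hasType h2E hξ, isUMinus_of_hasType h2E hξ, ?_, ?_⟩
  · rw [← hu]
    exact isUPlus_of_hasType h2D hζ
  · rw [← hu]
    exact isUMinus_of_hasType h2D hζ

theorem uInvariant_of_not_isUnramified (h2 : (2 : 𝓀[k]) ≠ 0)
    (hodd : ∀ q : ℕ, q.Prime → q ≠ 2 → ¬ q ∣ finrank k D) {σ : Involution D}
    (hσ : ∀ c : k, σ (algebraMap k D c) = algebraMap k D c) (hD : ¬ IsUnramified k D) :
    ∃ uzero uplus uminus : ℕ∞, IsUZero 𝓀[k] (ResidueAlgebra k D) uzero ∧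
      IsUPlus (ResidueAlgebra k D) uplus ∧ IsUMinus (ResidueAlgebra k D) uminus ∧
      IsUPlus D (uzero + uplus) ∧ IsUMinus D (uzero + uminus) := by
  have hw := valD_involution σ hσ
  obtain ⟨q, hq⟩ := exists_isUnif k D
  obtain ⟨p, δ, hp, hδ⟩ := hq.exists_skew h2 σ hw
  rcases (resInvolution_center_cases h2 hodd hσ hw hp hδ).2 with hc | ⟨hk, -⟩ | ⟨hk, -⟩
  · exact absurd (isUnramified_of_center h2 hodd hσ hp hδ hc) hD
  · exact uInvariant_of_isFirstKind_res h2 hodd hσ hw hk hD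
  -- Here the residue of the conjugate of `σ` by `p` is of the first kind, so that conjugate takes
  -- the place of `σ`; the conclusion does not involve the choice.
  · exact uInvariant_of_isFirstKind_res h2 hodd (Involution.conj_algebraMap hσ hp.ne_zero hδ) _ hk
      hD

end Main

end HermU

end

theorem corollary2p6
    (k : Type*) [Field k] {Γ₀ : Type*} [LinearOrderedCommGroupWithZero Γ₀] [Valued k Γ₀]
    [CompleteSpace k] [(Valued.v : Valuation k Γ₀).IsRankOneDiscrete]
    (hchar : ringChar 𝓀[k] ≠ 2)
    (D : Type*) [DivisionRing D] [Algebra k D] [FiniteDimensional k D] [Algebra.IsCentral k D]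
    (hper : HermU.HasPeriodTwo k D) :
    (HermU.IsUnramified k D →
      ∃ uplus uminus : ℕ∞,
        HermU.IsUPlus (HermU.ResidueAlgebra k D) uplus ∧
        HermU.IsUMinus (HermU.ResidueAlgebra k D) uminus ∧
        HermU.IsUPlus D (2 * uplus) ∧
        HermU.IsUMinus D (2 * uminus)) ∧
    (¬ HermU.IsUnramified k D →
      ∃ uzero uplus uminus : ℕ∞,
        HermU.IsUZero 𝓀[k] (HermU.ResidueAlgebra k D) uzero ∧
        HermU.IsUPlus (HermU.ResidueAlgebra k D) uplus ∧
        HermU.IsUMinus (HermU.ResidueAlgebra k D) uminus ∧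
        HermU.IsUPlus D (uzero + uplus) ∧
        HermU.IsUMinus D (uzero + uminus)) := by
  have h2 : (2 : 𝓀[k]) ≠ 0 := Ring.two_ne_zero hchar
  have h2D : (2 : D) ≠ 0 := HermU.two_ne_zero_of_residue h2
  have h2k : (2 : k) ≠ 0 := fun h => h2D (by rw [← map_ofNat (algebraMap k D) 2, h, map_zero])
  -- The two commuting actions of `D` coming from the splitting of `D ⊗ D` supply both the tameness
  -- statement `hodd` and the involution.
  obtain ⟨W, _, _, _, α, β, hc, hd⟩ := HermU.exists_commute_of_isSplit hper.2
  have hodd : ∀ q : ℕ, q.Prime → q ≠ 2 → ¬ q ∣ finrank k D := fun q hq hq2 =>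
    HermU.not_dvd_finrank_of_commute k D W h2k α β hc hd hq hq2
  obtain ⟨σ, hσ⟩ := HermU.exists_involution_of_commute α β hc hd
  exact ⟨HermU.uInvariant_of_isUnramified h2 hodd hσ,
    HermU.uInvariant_of_not_isUnramified h2 hodd hσ⟩
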